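/- Let $n\ge 1$ and let $\Gamma\subsetneq\mathbb R^n$ be an open, convex, symmetric cone with vertex at the origin such that $\Gamma_n\subseteq\Gamma\subseteq\Gamma_1$, where $\Gamma_k=\{x\in\mathbb R^n:\sigma_1(x)>0,\dots,\sigma_k(x)>0\}$ and $\sigma_k$ is the $k$-th elementary symmetric sum. Let $f:\overline\Gamma\to[0,\infty)$ be continuous, symmetric and concave, strictly increasing in each variable on $\Gamma$, with $f>0$ on $\Gamma$ and $f=0$ on $\partial\Gamma$. Let $M(\Gamma,n)$ be the set of Hermitian $n\times n$ matrices $H$ whose vector of eigenvalues $\lambda(H)$ lies in $\Gamma$, and for Hermitian $H$ put $F(H)=f(\lambda(H))$ if $H\in\overline{M(\Gamma,n)}$ and $F(H)=-\infty$ otherwise. Write $Hq=\big(\partial^2 q/\partial z_j\partial\bar z_k\big)$ for the complex Hessian of $q$. Let $\Omega\subset\mathbb C^n$ be a bounded domain and $\psi\ge 0$ a continuous function on $\overline\Omega$. Let $USC(\Omega)$ be the set of upper semicontinuous functions $u:\Omega\to[-\infty,\infty)$, $u\not\equiv-\infty$. A function $u\in USC(\Omega)$ is a viscosity subsolution of $F(Hu)=\psi$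 in $\Omega$ (that is, $F(Hu)\ge\psi$ in the viscosity sense) if $F(Hq(z_0))\ge\psi(z_0)$ for every $z_0\in\Omega$ and every function $q$ of class $C^2$ near $z_0$ such that $q(z_0)=u(z_0)$ and $u\le q$ near $z_0$. The function $u$ is $\Gamma$-subharmonic if for every open $U\Subset\Omega$ there is a decreasing sequence of functions $u_j\in C^\infty(U)$, with $Hu_j(z)\in M(\Gamma,n)$ for all $z\in U$, that converges pointwise to $u$ on $U$. Let $\chi$ be a standard mollifier on $\mathbb C^n$, that is, a smooth nonnegative radial function with support in the closed unit ball and $\int\chi=1$; put $\chi_\epsilon(z)=\epsilon^{-2n}\chi(z/\epsilon)$ and $\Omega_\epsilon=\{z\in\Omega: d(z,\partial\Omega)>\epsilon\}$ for $\epsilon>0$. **Theorem.** Let $u\in USC(\Omega)$. (a) $u$ is $\Gamma$-subharmonic if and only if $F(Hu)\ge 0$ in the viscosity sense in $\Omega$. (b) If $u$ is $\Gamma$-subharmonic, then $u>-\infty$ almost everywhere in $\Omega$ and $u\in L^1_{loc}(\Omega)$, so that the convolutions $u*\chi_\epsilon$ are well defined on $\Omega_\epsilon$. (c) $u$ is a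 viscosity subsolution of $F(Hu)=\psi$ in $\Omega$ if and only if $u$ is $\Gamma$-subharmonic and, for every $\epsilon>0$, $u*\chi_\epsilon$ is of class $C^2$ on $\Omega_\epsilon$ and $F(H(u*\chi_\epsilon))(z)\ge(\psi*\chi_\epsilon)(z)$ at every $z\in\Omega_\epsilon$. -/

import Mathlib

open Set Filter Topology MeasureTheory
open scoped ContDiff

namespace HessianViscosity

noncomputable section

/-- Complex Euclidean space `ℂⁿ` with its Euclidean norm. -/
abbrev Cn (n : ℕ) : Type := EuclideanSpace ℂ (Fin n)

/-- The `k`-th elementary symmetric sum `σ_k(x)` of the coordinates of `x ∈ ℝⁿ`. -/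
def sigma {n : ℕ} (k : ℕ) (x : Fin n → ℝ) : ℝ :=
  ∑ s ∈ Finset.powersetCard k (Finset.univ : Finset (Fin n)), ∏ i ∈ s, x i

/-- `Γ_k = {x ∈ ℝⁿ : σ_1(x) > 0, …, σ_k(x) > 0}`. -/
def GammaCone (n k : ℕ) : Set (Fin n → ℝ) :=
  {x | ∀ j, 1 ≤ j → j ≤ k → 0 < sigma j x}

/-- `Γ ⊊ ℝⁿ` is an open, convex, symmetric cone with vertex at the origin and
`Γ_n ⊆ Γ ⊆ Γ_1`. -/
structure IsAdmissibleCone {n : ℕ} (Γ : Set (Fin n → ℝ)) : Prop where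
  ne_univ : Γ ≠ univ
  isOpen : IsOpen Γ
  convex : Convex ℝ Γ
  smul_mem : ∀ x ∈ Γ, ∀ t : ℝ, 0 < t → t • x ∈ Γ
  symmetric : ∀ x ∈ Γ, ∀ π : Equiv.Perm (Fin n), x ∘ π ∈ Γ
  gamma_n_subset : GammaCone n n ⊆ Γ
  subset_gamma_one : Γ ⊆ GammaCone n 1

/-- The conditions on the function `f : closure Γ → [0, ∞)`. Values of `f` off `closure Γ` play
no role. Strict monotonicity in each variable is required at the points of `Γ`: on the boundary
of `Γ` the function vanishes identically. -/
structure IsAdmissibleFunction {n : ℕ} (Γ : Set (Fin n → ℝ)) (f : (Fin n → ℝ) → ℝ) : Prop where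
  continuousOn : ContinuousOn f (closure Γ)
  symmetric : ∀ x ∈ closure Γ, ∀ π : Equiv.Perm (Fin n), f (x ∘ π) = f x
  strictMono : ∀ x ∈ Γ, ∀ i : Fin n, ∀ t : ℝ, 0 < t → x + Pi.single i t ∈ Γ →
    f x < f (x + Pi.single i t)
  concave : ConcaveOn ℝ (closure Γ) f
  pos : ∀ x ∈ Γ, 0 < f x
  zero_on_frontier : ∀ x ∈ frontier Γ, f x = 0

/-- `M(Γ, n)`: the Hermitian `n × n` matrices whose vector of eigenvalues lies in `Γ`. -/
def MGamma {n : ℕ} (Γ : Set (Fin n → ℝ)) : Set (Matrix (Fin n) (Fin n) ℂ) :=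
  {A | ∃ hA : A.IsHermitian, hA.eigenvalues ∈ Γ}

open Classical in
/-- The operator `F : ℋⁿ → [-∞, ∞)`: `F(A) = f(λ(A))` for Hermitian `A` in the closure of
`M(Γ, n)`, and `F(A) = -∞` otherwise. (The value at non-Hermitian matrices is immaterial: `F` is
applied to complex Hessians of `C²` functions only.) -/
def FOp {n : ℕ} (Γ : Set (Fin n → ℝ)) (f : (Fin n → ℝ) → ℝ)
    (A : Matrix (Fin n) (Fin n) ℂ) : EReal :=
  if h : A.IsHermitian ∧ A ∈ closure (MGamma Γ) then ((f h.1.eigenvalues : ℝ) : EReal) else ⊥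

/-- The second real derivative `D²q(z)(v, w)`. -/
def secondDeriv {n : ℕ} (q : Cn n → ℝ) (z v w : Cn n) : ℝ :=
  iteratedFDeriv ℝ 2 q z ![v, w]

/-- The complex Hessian `Hq(z) = (∂²q / ∂z_j ∂z̄_k)(z)`. With
`∂/∂z_j = (∂/∂x_j - i ∂/∂y_j)/2` and `∂/∂z̄_k = (∂/∂x_k + i ∂/∂y_k)/2`, its `(j, k)` entry is
`(q_{x_j x_k} + q_{y_j y_k} + i (q_{x_j y_k} - q_{y_j x_k})) / 4`; the real directions `x_j`, `y_j`
are the vectors `e_j` and `i e_j`. -/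
def complexHessian {n : ℕ} (q : Cn n → ℝ) (z : Cn n) : Matrix (Fin n) (Fin n) ℂ :=
  Matrix.of fun j k =>
    let ex : Fin n → Cn n := fun l => EuclideanSpace.single l (1 : ℂ)
    let ey : Fin n → Cn n := fun l => EuclideanSpace.single l Complex.I
    (((secondDeriv q z (ex j) (ex k) + secondDeriv q z (ey j) (ey k) : ℝ) : ℂ)
      + Complex.I *
        ((secondDeriv q z (ex j) (ey k) - secondDeriv q z (ey j) (ex k) : ℝ) : ℂ)) / 4

/-- `u ∈ USC(Ω)`: `u : Ω → [-∞, ∞)` is upper semicontinuous (and, as usual, not identically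
`-∞`). Values off `Ω` play no role. -/
structure IsUSC {n : ℕ} (Ω : Set (Cn n)) (u : Cn n → EReal) : Prop where
  upperSemicontinuousOn : UpperSemicontinuousOn u Ω
  ne_top : ∀ z ∈ Ω, u z ≠ ⊤
  not_identically_bot : ∃ z ∈ Ω, u z ≠ ⊥

/-- `q` is an upper test function for `u` at `z₀`: it is `C²` near `z₀`, `u(z₀) = q(z₀)`, and
`u ≤ q` near `z₀`. (There is none when `u(z₀) = -∞`.) -/
def IsUpperTest {n : ℕ} (u : Cn n → EReal) (z₀ : Cn n) (q : Cn n → ℝ) : Prop :=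
  ContDiffAt ℝ 2 q z₀ ∧ u z₀ = ((q z₀ : ℝ) : EReal) ∧
    ∀ᶠ z in 𝓝 z₀, u z ≤ ((q z : ℝ) : EReal)

/-- `u` is a viscosity subsolution of `F(Hu) = ψ(z, u)` in `Ω`, i.e. `F(Hu) ≥ ψ(z, u)` in the
viscosity sense. At a contact point `u(z₀) = q(z₀)`. -/
def IsViscositySubsolution {n : ℕ} (Γ : Set (Fin n → ℝ)) (f : (Fin n → ℝ) → ℝ)
    (Ω : Set (Cn n)) (ψ : Cn n → ℝ → ℝ) (u : Cn n → EReal) : Prop :=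
  ∀ z₀ ∈ Ω, ∀ q : Cn n → ℝ, IsUpperTest u z₀ q →
    ((ψ z₀ (q z₀) : ℝ) : EReal) ≤ FOp Γ f (complexHessian q z₀)

/-- `w` is a smooth `Γ`-subharmonic function on the open set `U`. -/
def IsSmoothGammaSubharmonic {n : ℕ} (Γ : Set (Fin n → ℝ)) (U : Set (Cn n))
    (w : Cn n → ℝ) : Prop :=
  ContDiffOn ℝ ∞ w U ∧ ∀ z ∈ U, complexHessian w z ∈ MGamma Γ

/-- `u` is `Γ`-subharmonic on `Ω`: on every open `U ⋐ Ω` it is the pointwise limit of a decreasing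
sequence of smooth `Γ`-subharmonic functions. -/
def IsGammaSubharmonic {n : ℕ} (Γ : Set (Fin n → ℝ)) (Ω : Set (Cn n))
    (u : Cn n → EReal) : Prop :=
  ∀ U : Set (Cn n), IsOpen U → IsCompact (closure U) → closure U ⊆ Ω →
    ∃ v : ℕ → Cn n → ℝ,
      (∀ j, IsSmoothGammaSubharmonic Γ U (v j)) ∧
      (∀ z ∈ U, ∀ j, v (j + 1) z ≤ v j z) ∧
      (∀ z ∈ U, Tendsto (fun j => ((v j z : ℝ) : EReal)) atTop (𝓝 (u z)))

/-- `F(Hw) ≥ g` in `U` in the classical sense: `w` is `C²` and the inequality holds pointwise. -/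
def IsClassicalSubsolution {n : ℕ} (Γ : Set (Fin n → ℝ)) (f : (Fin n → ℝ) → ℝ)
    (U : Set (Cn n)) (g : Cn n → ℝ) (w : Cn n → ℝ) : Prop :=
  ContDiffOn ℝ 2 w U ∧ ∀ z ∈ U, ((g z : ℝ) : EReal) ≤ FOp Γ f (complexHessian w z)

/-- `χ` is a standard mollifier on `ℂⁿ`: smooth, nonnegative, radial, supported in the closed unit
ball, with integral one. The normalized bump `c · exp (-1 / (1 - |z|²))` is an example. -/
structure IsStandardMollifier {n : ℕ} (χ : Cn n → ℝ) : Prop where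
  contDiff : ContDiff ℝ ∞ χ
  nonneg : ∀ z, 0 ≤ χ z
  radial : ∀ z w, ‖z‖ = ‖w‖ → χ z = χ w
  support_subset : Function.support χ ⊆ Metric.closedBall 0 1
  integral_eq_one : ∫ z, χ z = 1

/-- `χ_ε(z) = ε^{-2n} χ(z/ε)`. -/
def mollifier {n : ℕ} (χ : Cn n → ℝ) (ε : ℝ) (z : Cn n) : ℝ :=
  (ε ^ (2 * n))⁻¹ * χ (ε⁻¹ • z)

/-- The convolution `g ∗ χ_ε`, that is `z ↦ ∫ g(w) χ_ε(z - w) dw`. For `z ∈ Ω_ε` only the values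
of `g` in the closed ball of radius `ε` about `z`, which is contained in `Ω`, enter. -/
def mollify {n : ℕ} (χ : Cn n → ℝ) (ε : ℝ) (g : Cn n → ℝ) : Cn n → ℝ :=
  convolution g (mollifier χ ε) (ContinuousLinearMap.mul ℝ ℝ) volume

/-- `Ω_ε = {z ∈ Ω : d(z, ∂Ω) > ε}`. -/
def shrink {n : ℕ} (Ω : Set (Cn n)) (ε : ℝ) : Set (Cn n) :=
  {z | z ∈ Ω ∧ ε < Metric.infDist z (frontier Ω)}

end

end HessianViscosity

set_option linter.unusedSectionVars false

/-! The nonlinear inequality `c ≤ F(A)` is a family of linear ones. The concave function `f` is the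
infimum of its affine majorants `a + ∑ pᵢ xᵢ` on `closure Γ` with `pᵢ > 0`, and outside `closure Γ`
the infimum of these majorants is `-∞`. By the theorems of Schur and Birkhoff, the diagonal of `U A
U*` lies in every convex symmetric set that contains the eigenvalues of `A`. Hence `c ≤ F(A)` means
`c ≤ a + ∑ pᵢ (U A U*)ᵢᵢ` for all these majorants and all unitary `U` (`coe_le_fOp_iff_majorants`).
On complex Hessians each such linear form is a Laplacian in suitable real linear coordinates
(`exists_equiv_secondOrderOp_eq`).

A linear constant coefficient inequality `Lu ≥ g` in the viscosity sense survives convolution.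
Comparison on the ball with solutions of the Dirichlet problem gives a sub-mean value inequality on
small ellipsoids (`sphere_submean`). Tonelli's theorem transfers it to `u * η`, and Taylor expansion
turns it into `L(u * η) ≥ g * η` (`conv_le_secondOrderOp_conv`). Collecting all `L` recovers `F(H(u
* η)) ≥ g * η` (`IsViscositySubsolution.conv_le_fOp`).

Conversely, viscosity inequalities survive limits from above: a test function of `u`, made strict by
a small quadratic term, touches the approximants at nearby points (`le_secondOrderOp_of_approx`).
This serves both for decreasing smooth sequences and for the convolutions `u * χ_ε`, which lie above
`u` since `Γ ⊆ Γ_1` makes `u` subharmonic. Subharmonicity and the connectedness of `Ω` also give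
local integrability. A decreasing smooth sequence for a viscosity subsolution consists of
convolutions plus small multiples of `1 + |z|²`, with radii chosen recursively. -/

namespace HessianViscosity

/-! ### Second derivatives, Taylor's formula and the second order condition at a maximum. -/

section SecondOrder

variable {E : Type*} [NormedAddCommGroup E] [NormedSpace ℝ E]

/-- The second derivative as a bilinear form. -/
noncomputable def hess (q : E → ℝ) (z v w : E) : ℝ := fderiv ℝ (fderiv ℝ q) z v w

/-- The constant coefficient operator `∑ k, D²q(z)(w k, w k)`. -/
noncomputable def secondOrderOp {ι : Type*} [Fintype ι] (w : ι → E) (q : E → ℝ) (z : E) : ℝ :=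
  ∑ k, hess q z (w k) (w k)

theorem hess_congr {f g : E → ℝ} {z : E} (h : f =ᶠ[𝓝 z] g) (v w : E) :
    hess f z v w = hess g z v w := by
  unfold hess
  rw [h.fderiv.fderiv_eq]

theorem eventually_differentiableAt {f : E → ℝ} {z : E} (hf : ContDiffAt ℝ 2 f z) :
    ∀ᶠ x in 𝓝 z, DifferentiableAt ℝ f x := by
  filter_upwards [hf.eventually (by simp)] with x hx
  exact hx.differentiableAt (by simp)

theorem contDiffAt_fderiv {f : E → ℝ} {z : E} (hf : ContDiffAt ℝ 2 f z) :
    ContDiffAt ℝ 1 (fderiv ℝ f) z :=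
  hf.fderiv_right (m := 1) (by norm_num)

theorem differentiableAt_fderiv {f : E → ℝ} {z : E} (hf : ContDiffAt ℝ 2 f z) :
    DifferentiableAt ℝ (fderiv ℝ f) z :=
  (contDiffAt_fderiv hf).differentiableAt (by simp)

theorem hess_add {f g : E → ℝ} {z : E} (hf : ContDiffAt ℝ 2 f z) (hg : ContDiffAt ℝ 2 g z)
    (v w : E) : hess (fun x => f x + g x) z v w = hess f z v w + hess g z v w := by
  unfold hess
  have : fderiv ℝ (fun x => f x + g x) =ᶠ[𝓝 z] fun x => fderiv ℝ f x + fderiv ℝ g x := by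
    filter_upwards [eventually_differentiableAt hf, eventually_differentiableAt hg] with x h1 h2
    exact fderiv_fun_add h1 h2
  rw [this.fderiv_eq, fderiv_fun_add (differentiableAt_fderiv hf) (differentiableAt_fderiv hg)]
  rfl

theorem hess_const_mul {f : E → ℝ} {z : E} (hf : ContDiffAt ℝ 2 f z) (c : ℝ)
    (v w : E) : hess (fun x => c * f x) z v w = c * hess f z v w := by
  unfold hess
  have : fderiv ℝ (fun x => c * f x) =ᶠ[𝓝 z] fun x => c • fderiv ℝ f x := by
    filter_upwards [eventually_differentiableAt hf] with x h1
    exact fderiv_const_mul h1 c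
  rw [this.fderiv_eq, fderiv_fun_const_smul (differentiableAt_fderiv hf)]
  rfl

theorem hess_sub {f g : E → ℝ} {z : E} (hf : ContDiffAt ℝ 2 f z) (hg : ContDiffAt ℝ 2 g z)
    (v w : E) : hess (fun x => f x - g x) z v w = hess f z v w - hess g z v w := by
  have h := hess_add hf (contDiffAt_const.mul hg : ContDiffAt ℝ 2 (fun x => (-1 : ℝ) * g x) z) v w
  rw [hess_const_mul hg] at h
  rw [sub_eq_add_neg, ← neg_one_mul (hess g z v w), ← h]
  congr 1
  ext x
  ring

theorem hess_const (c : ℝ) (z v w : E) : hess (fun _ : E => c) z v w = 0 := by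
  unfold hess
  simp

theorem hess_comp_affine {F : Type*} [NormedAddCommGroup F] [NormedSpace ℝ F] {h : F → ℝ}
    (A : E →L[ℝ] F) (c : F) {y : E} (hh : ContDiffAt ℝ 2 h (A y + c)) (v w : E) :
    hess (fun y => h (A y + c)) y v w = hess h (A y + c) (A v) (A w) := by
  unfold hess
  have hA : ∀ x, HasFDerivAt (fun y => A y + c) A x := fun x => A.hasFDerivAt.add_const c
  have hcont : ContinuousAt (fun y => A y + c) y := (hA y).continuousAt
  have : fderiv ℝ (fun y => h (A y + c)) =ᶠ[𝓝 y] fun x => (fderiv ℝ h (A x + c)).comp A := by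
    filter_upwards [hcont.eventually (eventually_differentiableAt hh)] with x hx
    exact (hx.hasFDerivAt.comp x (hA x)).fderiv
  rw [this.fderiv_eq]
  have h2 : HasFDerivAt (fun x => fderiv ℝ h (A x + c))
      ((fderiv ℝ (fderiv ℝ h) (A y + c)).comp A) y :=
    (differentiableAt_fderiv hh).hasFDerivAt.comp y (hA y)
  have h3 := h2.clm_comp (hasFDerivAt_const A y)
  rw [h3.fderiv]
  simp

theorem hess_symm {q : E → ℝ} {z : E} (hq : ContDiffAt ℝ 2 q z) (v w : E) :
    hess q z v w = hess q z w v :=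
  hq.isSymmSndFDerivAt (by simp) v w

/-- The derivative of the remainder at `y` is the first order remainder of `Dq`, at most `c‖y‖`
because `Dq` is differentiable at `z`. The mean value inequality on the ball of radius `‖h‖`
supplies the second factor `‖h‖`. -/
theorem isLittleO_taylor_two {q : E → ℝ} {z : E} (hq : ContDiffAt ℝ 2 q z) :
    (fun h : E => q (z + h) - q z - fderiv ℝ q z h - (1 / 2) * hess q z h h)
      =o[𝓝 0] fun h => ‖h‖ ^ 2 := by
  rw [Asymptotics.isLittleO_iff]
  intro c hc
  have hd := (differentiableAt_fderiv hq).hasFDerivAt.isLittleO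
  rw [Asymptotics.isLittleO_iff] at hd
  have h1 := hd hc
  have h2 := eventually_differentiableAt hq
  obtain ⟨ρ, hρ, hball⟩ := Metric.eventually_nhds_iff_ball.1 (h1.and h2)
  filter_upwards [Metric.ball_mem_nhds (0 : E) hρ] with h hh
  rw [mem_ball_zero_iff] at hh
  let k : E → ℝ := fun y => q (z + y) - q z - fderiv ℝ q z y - (1 / 2) * hess q z y y
  have hk : ∀ y ∈ Metric.closedBall (0 : E) ‖h‖, HasFDerivWithinAt k
      (fderiv ℝ q (z + y) - fderiv ℝ q z - fderiv ℝ (fderiv ℝ q) z y)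
      (Metric.closedBall (0 : E) ‖h‖) y := by
    intro y hy
    rw [mem_closedBall_zero_iff] at hy
    have hyz : z + y ∈ Metric.ball z ρ := by
      rw [mem_ball_iff_norm]; simpa using hy.trans_lt hh
    have e1 : HasFDerivAt (fun y => q (z + y)) (fderiv ℝ q (z + y)) y := by
      have := (hball _ hyz).2.hasFDerivAt
      exact this.comp y ((hasFDerivAt_id y).const_add z)
    have e2 : HasFDerivAt (fun y => hess q z y y)
        (2 • fderiv ℝ (fderiv ℝ q) z y) y := by
      have := ((fderiv ℝ (fderiv ℝ q) z).hasFDerivAt (x := y)).clm_apply (hasFDerivAt_id y)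
      refine this.congr_fderiv ?_
      ext w
      have := hess_symm hq y w
      simp only [hess] at this
      simp [two_smul, this]
    have e3 := ((e1.sub_const (q z)).sub ((fderiv ℝ q z).hasFDerivAt (x := y))).sub
      (e2.const_mul (1 / 2))
    refine (e3.congr_fderiv ?_).hasFDerivWithinAt
    ext w
    simp
  have hb : ∀ y ∈ Metric.closedBall (0 : E) ‖h‖,
      ‖fderiv ℝ q (z + y) - fderiv ℝ q z - fderiv ℝ (fderiv ℝ q) z y‖ ≤ c * ‖h‖ := by
    intro y hy
    rw [mem_closedBall_zero_iff] at hy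
    have hyz : z + y ∈ Metric.ball z ρ := by
      rw [mem_ball_iff_norm]; simpa using hy.trans_lt hh
    have := (hball _ hyz).1
    simp only [add_sub_cancel_left] at this
    exact this.trans (by gcongr)
  have := (convex_closedBall (0 : E) ‖h‖).norm_image_sub_le_of_norm_hasFDerivWithin_le hk hb
    (Metric.mem_closedBall_self (norm_nonneg h)) (by simp : h ∈ Metric.closedBall (0 : E) ‖h‖)
  have hk0 : k 0 = 0 := by simp [k, hess]
  rw [hk0, sub_zero, sub_zero] at this
  calc ‖q (z + h) - q z - fderiv ℝ q z h - (1 / 2) * hess q z h h‖ = ‖k h‖ := rfl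
    _ ≤ c * ‖h‖ * ‖h‖ := this
    _ = c * ‖‖h‖ ^ 2‖ := by rw [Real.norm_of_nonneg (by positivity)]; ring

theorem hess_smul_smul (q : E → ℝ) (z v w : E) (s t : ℝ) :
    hess q z (s • v) (t • w) = s * t * hess q z v w := by
  simp [hess]; ring

theorem hess_nonpos_of_isLocalMax {q : E → ℝ} {z : E} (hq : ContDiffAt ℝ 2 q z)
    (hmax : IsLocalMax q z) (v : E) : hess q z v v ≤ 0 := by
  by_contra! hpos
  have hd : fderiv ℝ q z = 0 := hmax.fderiv_eq_zero
  have ht := isLittleO_taylor_two hq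
  rw [Asymptotics.isLittleO_iff] at ht
  have hv : 0 < ‖v‖ ^ 2 + 1 := by positivity
  -- With this constant the Taylor remainder along `t • v` is at most a quarter of `t² D²q(v, v)`,
  -- half of the quadratic term.
  have hc : 0 < hess q z v v / (4 * (‖v‖ ^ 2 + 1)) := by positivity
  have h1 := ht hc
  have h2 : ∀ᶠ h in 𝓝 (0 : E), q (z + h) ≤ q z := by
    have : Tendsto (fun h : E => z + h) (𝓝 0) (𝓝 z) := by
      have : Continuous (fun h : E => z + h) := by fun_prop
      simpa using this.tendsto 0
    exact this.eventually hmax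
  have h3 : Tendsto (fun t : ℝ => t • v) (𝓝[>] 0) (𝓝 0) := by
    have : Continuous (fun t : ℝ => t • v) := by fun_prop
    have := this.tendsto 0
    rw [zero_smul] at this
    exact this.mono_left nhdsWithin_le_nhds
  obtain ⟨t, ⟨ht1, ht2⟩, ht0⟩ :=
    ((h3.eventually (h1.and h2)).and self_mem_nhdsWithin).exists
  have ht0 : 0 < t := ht0
  rw [hd, hess_smul_smul] at ht1
  simp only [zero_apply, sub_zero, Real.norm_eq_abs] at ht1
  have h4 := (abs_le.1 ht1).1
  rw [abs_of_nonneg (by positivity), norm_smul, mul_pow, Real.norm_eq_abs, sq_abs] at h4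
  have h5 : hess q z v v / (4 * (‖v‖ ^ 2 + 1)) * (t ^ 2 * ‖v‖ ^ 2) ≤
      t ^ 2 * (hess q z v v / 4) := by
    have : hess q z v v / (4 * (‖v‖ ^ 2 + 1)) * (t ^ 2 * ‖v‖ ^ 2) =
      t ^ 2 * (hess q z v v / 4) * (‖v‖ ^ 2 / (‖v‖ ^ 2 + 1)) := by field_simp
    rw [this]
    refine mul_le_of_le_one_right (by positivity) ?_
    rw [div_le_one hv]; linarith
  nlinarith [mul_pos (pow_pos ht0 2) hpos]

theorem hess_le_of_isLocalMax_sub {f g : E → ℝ} {z : E} (hf : ContDiffAt ℝ 2 f z)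
    (hg : ContDiffAt ℝ 2 g z) (hmax : IsLocalMax (fun x => f x - g x) z) (v : E) :
    hess f z v v ≤ hess g z v v := by
  have := hess_nonpos_of_isLocalMax (hf.sub hg) hmax v
  rw [show hess (fun x => f x - g x) z v v = _ from hess_sub hf hg v v] at this
  linarith

theorem continuousAt_hess {q : E → ℝ} {z : E} (hq : ContDiffAt ℝ 2 q z) (v w : E) :
    ContinuousAt (fun x => hess q x v w) z := by
  have h1 : ContDiffAt ℝ 0 (fderiv ℝ (fderiv ℝ q)) z :=
    (contDiffAt_fderiv hq).fderiv_right (m := 0) (by norm_num)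
  exact (h1.continuousAt.clm_apply continuousAt_const).clm_apply continuousAt_const

theorem continuousAt_secondOrderOp {ι : Type*} [Fintype ι] (w : ι → E) {q : E → ℝ} {z : E}
    (hq : ContDiffAt ℝ 2 q z) : ContinuousAt (secondOrderOp w q) z :=
  tendsto_finsetSum _ fun k _ => continuousAt_hess hq (w k) (w k)

theorem secondOrderOp_add {ι : Type*} [Fintype ι] (w : ι → E) {f g : E → ℝ} {z : E}
    (hf : ContDiffAt ℝ 2 f z) (hg : ContDiffAt ℝ 2 g z) :
    secondOrderOp w (fun x => f x + g x) z = secondOrderOp w f z + secondOrderOp w g z := by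
  simp only [secondOrderOp, hess_add hf hg, Finset.sum_add_distrib]

theorem secondOrderOp_const_mul {ι : Type*} [Fintype ι] (w : ι → E) {f : E → ℝ} {z : E}
    (hf : ContDiffAt ℝ 2 f z) (c : ℝ) :
    secondOrderOp w (fun x => c * f x) z = c * secondOrderOp w f z := by
  simp only [secondOrderOp, hess_const_mul hf, Finset.mul_sum]

theorem secondOrderOp_const {ι : Type*} [Fintype ι] (w : ι → E) (c : ℝ) (z : E) :
    secondOrderOp w (fun _ => c) z = 0 := by
  simp only [secondOrderOp, hess_const, Finset.sum_const_zero]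

end SecondOrder

/-! ### Second derivatives of the squared norm. -/

section NormSq

variable {E : Type*} [NormedAddCommGroup E] [InnerProductSpace ℝ E]

theorem contDiff_norm_sub_sq (a : E) {n : WithTop ℕ∞} :
    ContDiff ℝ n (fun x : E => ‖x - a‖ ^ 2) :=
  (contDiff_id.sub contDiff_const).norm_sq ℝ

theorem hess_norm_sub_sq (a z v w : E) :
    hess (fun x : E => ‖x - a‖ ^ 2) z v w = 2 * inner ℝ v w := by
  unfold hess
  have : fderiv ℝ (fun x : E => ‖x - a‖ ^ 2) = fun x => (2 : ℝ) • innerSL ℝ (x - a) := by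
    ext x w
    have : HasFDerivAt (fun x : E => ‖x - a‖ ^ 2) _ x := ((hasFDerivAt_id x).sub_const a).norm_sq
    rw [this.fderiv]
    simp
  rw [this]
  have h2 : HasFDerivAt (fun x : E => (2 : ℝ) • innerSL ℝ (x - a))
      ((2 : ℝ) • (innerSL ℝ (E := E)).comp (ContinuousLinearMap.id ℝ E)) z :=
    (((innerSL ℝ (E := E)).hasFDerivAt).comp z ((hasFDerivAt_id z).sub_const a)).const_smul (2 : ℝ)
  rw [h2.fderiv]
  simp
  rfl

theorem secondOrderOp_norm_sub_sq {ι : Type*} [Fintype ι] (w : ι → E) (a z : E) :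
    secondOrderOp w (fun x : E => ‖x - a‖ ^ 2) z = 2 * ∑ k, ‖w k‖ ^ 2 := by
  simp only [secondOrderOp, hess_norm_sub_sq, real_inner_self_eq_norm_sq, Finset.mul_sum]

end NormSq

/-! ### Comparison principle on the unit ball. -/

section Comparison

variable {E : Type*} [NormedAddCommGroup E] [InnerProductSpace ℝ E]

/-- `q` is `C²` near `z` and touches `u` from above at `z`. -/
def TouchesAbove (u : E → EReal) (z : E) (q : E → ℝ) : Prop :=
  ContDiffAt ℝ 2 q z ∧ u z = ((q z : ℝ) : EReal) ∧ ∀ᶠ x in 𝓝 z, u x ≤ ((q x : ℝ) : EReal)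

/-- The constant `c` is the maximum of `u - q` on `K`, so `q + c` is a test function from above. The
lower bound `a` ensures that the maximum is not `-∞`. -/
theorem exists_max_sub {X : Type*} [TopologicalSpace X] {K : Set X} (hK : IsCompact K)
    {u : X → EReal} (hu : UpperSemicontinuousOn u K) {q : X → ℝ}
    (hq : ContinuousOn q K) {x₀ : X} (hx₀ : x₀ ∈ K) {a : ℝ}
    (ha : ((q x₀ + a : ℝ) : EReal) ≤ u x₀) (hx₀top : ∀ x ∈ K, u x ≠ ⊤) :
    ∃ x₁ ∈ K, ∃ c : ℝ, a ≤ c ∧ u x₁ = ((q x₁ + c : ℝ) : EReal) ∧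
      ∀ x ∈ K, u x ≤ ((q x + c : ℝ) : EReal) := by
  have hφ : UpperSemicontinuousOn (fun x => u x + ((-q x : ℝ) : EReal)) K := by
    refine hu.add' ?_ ?_
    · exact ContinuousOn.upperSemicontinuousOn
        (continuous_coe_real_ereal.comp_continuousOn hq.neg)
    · intro x hx
      exact EReal.continuousAt_add (Or.inr (EReal.coe_ne_bot _)) (Or.inr (EReal.coe_ne_top _))
  obtain ⟨x₁, hx₁, hmax⟩ := hφ.exists_isMaxOn ⟨x₀, hx₀⟩ hK
  have key : ∀ x, u x + ((-q x : ℝ) : EReal) = u x - (q x : EReal) := fun x => by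
    rw [EReal.coe_neg, sub_eq_add_neg]
  have h0 : (a : EReal) ≤ u x₁ - (q x₁ : EReal) := by
    have h1 : u x₀ + ((-q x₀ : ℝ) : EReal) ≤ u x₁ + ((-q x₁ : ℝ) : EReal) := hmax hx₀
    rw [key, key] at h1
    refine le_trans ?_ h1
    rw [EReal.le_sub_iff_add_le (Or.inl (EReal.coe_ne_bot _)) (Or.inl (EReal.coe_ne_top _)),
      ← EReal.coe_add, add_comm]
    exact ha
  have hbot : u x₁ ≠ ⊥ := by
    intro hb
    rw [hb] at h0
    simp at h0
  have hreal := EReal.coe_toReal (hx₀top x₁ hx₁) hbot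
  refine ⟨x₁, hx₁, (u x₁).toReal - q x₁, ?_, ?_, ?_⟩
  · rw [← hreal, ← EReal.coe_sub, EReal.coe_le_coe_iff] at h0
    exact h0
  · rw [add_sub_cancel]; exact hreal.symm
  · intro x hx
    have h1 : u x + ((-q x : ℝ) : EReal) ≤ u x₁ + ((-q x₁ : ℝ) : EReal) := hmax hx
    rw [key, key, ← hreal, ← EReal.coe_sub,
      EReal.sub_le_iff_le_add (Or.inl (EReal.coe_ne_bot _)) (Or.inl (EReal.coe_ne_top _)),
      ← EReal.coe_add, add_comm] at h1
    exact h1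

theorem TouchesAbove.comp_affine {u : E → EReal} (T : E ≃L[ℝ] E) {r : ℝ} (hr : r ≠ 0) (z : E)
    {x : E} {q : E → ℝ} (hq : TouchesAbove (fun x => u (z + r • T x)) x q) :
    TouchesAbove u (z + r • T x) (fun y => q ((r⁻¹ • (T.symm : E →L[ℝ] E)) y
      + -(r⁻¹ • T.symm z))) := by
  have hinv : ∀ y, (r⁻¹ • (T.symm : E →L[ℝ] E)) (z + r • T y) + -(r⁻¹ • T.symm z) = y := by
    intro y
    simp [hr]
  have hinv' : ∀ y, z + r • T ((r⁻¹ • (T.symm : E →L[ℝ] E)) y + -(r⁻¹ • T.symm z)) = y := by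
    intro y
    simp [hr, smul_smul]
  have hcd : ContDiff ℝ 2 fun y : E => (r⁻¹ • (T.symm : E →L[ℝ] E)) y + -(r⁻¹ • T.symm z) :=
    (ContinuousLinearMap.contDiff _).add contDiff_const
  refine ⟨?_, ?_, ?_⟩
  · refine ContDiffAt.comp (g := q) (z + r • T x) ?_ hcd.contDiffAt
    rw [hinv]; exact hq.1
  · change u _ = ((q _ : ℝ) : EReal)
    rw [hinv]; exact hq.2.1
  · have ht : Tendsto (fun y : E => (r⁻¹ • (T.symm : E →L[ℝ] E)) y + -(r⁻¹ • T.symm z))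
        (𝓝 (z + r • T x)) (𝓝 x) := by
      have := hcd.continuous.tendsto (z + r • T x)
      rwa [hinv] at this
    filter_upwards [ht.eventually hq.2.2] with y hy
    rwa [hinv'] at hy

variable {ι : Type*} [Fintype ι] [Nonempty ι] (b : OrthonormalBasis ι ℝ E)

/-- If `u` exceeded `h` somewhere, the strict supersolution `h - δ‖x‖²`, shifted up, would touch `u`
from above at a maximum point of the difference. An interior contact contradicts the viscosity
inequality. -/
theorem comparison_unit_ball [ProperSpace E] {u : E → EReal} {g₀ : ℝ}
    (husc : UpperSemicontinuousOn u (Metric.closedBall 0 1))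
    (htop : ∀ x ∈ Metric.closedBall (0 : E) 1, u x ≠ ⊤)
    (hvisc : ∀ x ∈ Metric.ball (0 : E) 1, ∀ q, TouchesAbove u x q → g₀ ≤ secondOrderOp b q x)
    {h : E → ℝ} (hh : ContDiff ℝ 2 h)
    (hlap : ∀ x ∈ Metric.ball (0 : E) 1, secondOrderOp b h x ≤ g₀)
    (hbd : ∀ x ∈ Metric.sphere (0 : E) 1, u x ≤ (h x : EReal)) :
    ∀ x ∈ Metric.closedBall (0 : E) 1, u x ≤ (h x : EReal) := by
  intro x₀ hx₀
  by_contra! hlt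
  obtain ⟨y, hy1, hy2⟩ := EReal.lt_iff_exists_real_btwn.1 hlt
  rw [EReal.coe_lt_coe_iff] at hy1
  set δ := y - h x₀ with hδ
  have hδpos : 0 < δ := by linarith
  have hsm : ContDiff ℝ 2 (fun x : E => (-δ) * ‖x - 0‖ ^ 2) :=
    contDiff_const.mul (contDiff_norm_sub_sq 0)
  let q : E → ℝ := fun x => h x + (-δ) * ‖x - 0‖ ^ 2
  have hqC : ContDiff ℝ 2 q := hh.add hsm
  obtain ⟨x₁, hx₁, c, hc, hu₁, hle⟩ := exists_max_sub (isCompact_closedBall (0 : E) 1) husc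
    (q := q) hqC.continuous.continuousOn hx₀ (a := δ + δ * ‖x₀‖ ^ 2) (by
      refine le_trans ?_ hy2.le
      rw [EReal.coe_le_coe_iff]
      simp only [q, sub_zero]
      linarith) htop
  have hcδ : δ ≤ c := le_trans (by nlinarith [sq_nonneg ‖x₀‖]) hc
  -- On the sphere the perturbation equals `-δ`, so contact there gives `c ≤ δ`. With `δ + δ‖x₀‖² ≤
  -- c` this forces `x₀ = 0` and `c = δ`, hence `u x₀ ≤ y`, against the choice of `y`.
  by_cases hs : x₁ ∈ Metric.sphere (0 : E) 1
  · have h1 := hbd x₁ hs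
    rw [hu₁, EReal.coe_le_coe_iff] at h1
    have h2 : ‖x₁‖ = 1 := by simpa using hs
    simp only [q, sub_zero, h2] at h1
    have hc' : c = δ := by linarith
    have h3 : ‖x₀‖ ^ 2 = 0 := by
      have : δ * ‖x₀‖ ^ 2 ≤ 0 := by linarith
      nlinarith [sq_nonneg ‖x₀‖]
    have := hle x₀ hx₀
    have h5 := hy2.trans_le this
    rw [EReal.coe_lt_coe_iff] at h5
    simp only [q, sub_zero, h3] at h5
    linarith
  · have hball : x₁ ∈ Metric.ball (0 : E) 1 := by
      rw [mem_ball_zero_iff]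
      rw [mem_closedBall_zero_iff] at hx₁
      exact lt_of_le_of_ne hx₁ (by simpa using hs)
    have := hvisc x₁ hball (fun x => q x + c) ⟨(hqC.add contDiff_const).contDiffAt, hu₁, by
      filter_upwards [Metric.isOpen_ball.mem_nhds hball] with x hx
      exact hle x (Metric.ball_subset_closedBall hx)⟩
    rw [secondOrderOp_add b hqC.contDiffAt contDiffAt_const, secondOrderOp_const,
      secondOrderOp_add b hh.contDiffAt hsm.contDiffAt,
      secondOrderOp_const_mul b (contDiff_norm_sub_sq 0).contDiffAt,
      secondOrderOp_norm_sub_sq] at this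
    have h6 := hlap x₁ hball
    simp only [b.norm_eq_one, one_pow, Finset.sum_const, Finset.card_univ, nsmul_eq_mul,
      mul_one] at this
    have : (0 : ℝ) < Fintype.card ι := by exact_mod_cast Fintype.card_pos
    nlinarith [mul_pos hδpos this]

/-- A smooth function is its own viscosity subsolution: where `q` touches it from above, its second
derivatives are at most those of `q`. The bound is then comparison with the constant `0`. -/
theorem nonpos_of_subharmonic_of_sphere [ProperSpace E] {h : E → ℝ} (hh : ContDiff ℝ 2 h)
    (hlap : ∀ x ∈ Metric.ball (0 : E) 1, 0 ≤ secondOrderOp b h x)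
    (hbd : ∀ x ∈ Metric.sphere (0 : E) 1, h x ≤ 0) :
    ∀ x ∈ Metric.closedBall (0 : E) 1, h x ≤ 0 := by
  have := comparison_unit_ball b (u := fun x => (h x : EReal)) (g₀ := 0) (h := fun _ => 0)
    ((continuous_coe_real_ereal.comp hh.continuous).upperSemicontinuous.upperSemicontinuousOn _)
    (fun x _ => EReal.coe_ne_top _) (fun x hx q hq => ?_) contDiff_const
    (fun x _ => (secondOrderOp_const _ _ _).le)
    (fun x hx => by exact_mod_cast hbd x hx)
  · intro x hx
    exact_mod_cast this x hx
  · refine (hlap x hx).trans (Finset.sum_le_sum fun k _ => ?_)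
    refine hess_le_of_isLocalMax_sub hh.contDiffAt hq.1 ?_ _
    filter_upwards [hq.2.2] with y hy
    have h1 := EReal.coe_eq_coe_iff.1 hq.2.1
    have h2 := EReal.coe_le_coe_iff.1 hy
    linarith

end Comparison

/-! ### Polynomial Dirichlet problem on the ball and density of polynomials on the sphere. -/

section Polynomials

open MvPolynomial

variable {E : Type*} [NormedAddCommGroup E] [InnerProductSpace ℝ E]
  {ι : Type*} [Fintype ι] (b : OrthonormalBasis ι ℝ E)

/-- The function on `E` given by a polynomial in the coordinates of an orthonormal basis. -/
noncomputable def polyFun (p : MvPolynomial ι ℝ) (x : E) : ℝ :=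
  eval (fun i => inner ℝ (b i) x) p

/-- The algebraic Laplacian. -/
noncomputable def polyLaplacian : MvPolynomial ι ℝ →ₗ[ℝ] MvPolynomial ι ℝ :=
  ∑ i, (pderiv i).toLinearMap ∘ₗ (pderiv i).toLinearMap

theorem polyLaplacian_apply (p : MvPolynomial ι ℝ) :
    polyLaplacian p = ∑ i, pderiv i (pderiv i p) := by
  simp [polyLaplacian]

theorem hasFDerivAt_polyFun (p : MvPolynomial ι ℝ) (x : E) :
    HasFDerivAt (polyFun b p) (∑ i, polyFun b (pderiv i p) x • innerSL ℝ (b i)) x := by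
  induction p using MvPolynomial.induction_on with
  | C a =>
    have : polyFun b (C a) = fun _ => a := by ext; simp [polyFun]
    rw [this]
    refine (hasFDerivAt_const a x).congr_fderiv ?_
    simp [polyFun]
  | add p q hp hq =>
    have : polyFun b (p + q) = fun x => polyFun b p x + polyFun b q x := by ext; simp [polyFun]
    rw [this]
    refine (hp.add hq).congr_fderiv ?_
    rw [← Finset.sum_add_distrib]
    refine Finset.sum_congr rfl fun i _ => ?_
    simp [polyFun, add_smul]
  | mul_X p j hp =>
    have : polyFun b (p * X j) = fun x => polyFun b p x * innerSL ℝ (b j) x := by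
      ext; simp [polyFun]
    rw [this]
    refine (hp.mul ((innerSL ℝ (b j)).hasFDerivAt)).congr_fderiv ?_
    classical
    have : ∀ i, polyFun b (pderiv i (p * X j)) x • innerSL ℝ (b i) =
        (inner ℝ (b j) x : ℝ) • polyFun b (pderiv i p) x • innerSL ℝ (b i) +
        (if i = j then polyFun b p x • innerSL ℝ (b j) else 0) := by
      intro i
      by_cases hij : i = j
      · subst hij
        simp only [polyFun, Derivation.leibniz, pderiv_X_self, smul_eq_mul, mul_one, map_add,
          map_mul, eval_X, if_true, add_smul, mul_smul]
        rw [add_comm]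
      · simp [polyFun, Derivation.leibniz, pderiv_X_of_ne (Ne.symm hij), hij, mul_smul]
    rw [Finset.sum_congr rfl fun i _ => this i, Finset.sum_add_distrib, ← Finset.smul_sum,
      Finset.sum_ite_eq' Finset.univ j, if_pos (Finset.mem_univ j), add_comm]
    rfl

theorem contDiff_polyFun (p : MvPolynomial ι ℝ) {n : WithTop ℕ∞} :
    ContDiff ℝ n (polyFun b p) := by
  induction p using MvPolynomial.induction_on with
  | C a =>
    have : polyFun b (C a) = fun _ => a := by ext; simp [polyFun]
    rw [this]; exact contDiff_const
  | add p q hp hq =>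
    have : polyFun b (p + q) = fun x => polyFun b p x + polyFun b q x := by ext; simp [polyFun]
    rw [this]; exact hp.add hq
  | mul_X p j hp =>
    have : polyFun b (p * X j) = fun x => polyFun b p x * innerSL ℝ (b j) x := by
      ext; simp [polyFun]
    rw [this]; exact hp.mul (innerSL ℝ (b j)).contDiff

theorem fderiv_polyFun_basis (p : MvPolynomial ι ℝ) (x : E) (i : ι) :
    fderiv ℝ (polyFun b p) x (b i) = polyFun b (pderiv i p) x := by
  classical
  rw [(hasFDerivAt_polyFun b p x).fderiv]
  simp [b.inner_eq_ite]

theorem hess_eq_fderiv {q : E → ℝ} {z : E} (hq : ContDiffAt ℝ 2 q z) (v w : E) :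
    hess q z v w = fderiv ℝ (fun x => fderiv ℝ q x w) z v := by
  have := (differentiableAt_fderiv hq).hasFDerivAt.clm_apply (hasFDerivAt_const w z)
  rw [this.fderiv]
  simp [hess]

theorem secondOrderOp_polyFun (p : MvPolynomial ι ℝ) (x : E) :
    secondOrderOp b (polyFun b p) x = polyFun b (polyLaplacian p) x := by
  simp only [secondOrderOp, polyLaplacian_apply]
  rw [show polyFun b (∑ i, pderiv i (pderiv i p)) x = ∑ i, polyFun b (pderiv i (pderiv i p)) x by
    simp [polyFun]]
  refine Finset.sum_congr rfl fun i _ => ?_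
  rw [hess_eq_fderiv (contDiff_polyFun b p).contDiffAt]
  have : (fun x => fderiv ℝ (polyFun b p) x (b i)) = polyFun b (pderiv i p) := by
    ext y; exact fderiv_polyFun_basis b p y i
  rw [this, fderiv_polyFun_basis]

theorem polyFun_normSq (x : E) : polyFun b (∑ i, X i ^ 2) x = ‖x‖ ^ 2 := by
  rw [← b.sum_sq_norm_inner_right x]
  simp [polyFun]

theorem polyFun_injective_of_ball {p : MvPolynomial ι ℝ} {r : ℝ} (hr : 0 < r)
    (h : ∀ x ∈ Metric.ball (0 : E) r, polyFun b p x = 0) : p = 0 := by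
  classical
  -- The cube of half-side `s` fits inside the ball, and a polynomial vanishing on a product of
  -- infinite sets is zero.
  obtain ⟨s, hs, hs'⟩ : ∃ s : ℝ, 0 < s ∧ Fintype.card ι * s ^ 2 < r ^ 2 := by
    have hN : (0 : ℝ) ≤ Fintype.card ι := by positivity
    refine ⟨r / (Fintype.card ι + 1), by positivity, ?_⟩
    rw [div_pow, mul_div_assoc', div_lt_iff₀ (by positivity)]
    have : (Fintype.card ι : ℝ) < (Fintype.card ι + 1) ^ 2 := by nlinarith
    nlinarith [pow_pos hr 2]
  refine funext_set (fun _ => Ioo (-s) s) (fun _ => Ioo_infinite (by linarith)) fun y hy => ?_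
  have hinner : ∀ i, inner ℝ (b i) (b.repr.symm (WithLp.toLp 2 y)) = y i := fun i => by
    rw [← b.repr_apply_apply]; simp
  have hx : b.repr.symm (WithLp.toLp 2 y) ∈ Metric.ball (0 : E) r := by
    rw [mem_ball_zero_iff]
    refine lt_of_pow_lt_pow_left₀ 2 hr.le ?_
    rw [← b.sum_sq_norm_inner_right]
    refine lt_of_le_of_lt ?_ hs'
    calc _ ≤ ∑ i : ι, s ^ 2 := by
          refine Finset.sum_le_sum fun i _ => ?_
          rw [hinner, Real.norm_eq_abs, sq_abs]
          have := hy i (mem_univ i)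
          nlinarith [this.1, this.2]
      _ = _ := by simp
  have := h _ hx
  simpa [polyFun, hinner] using this

theorem totalDegree_pderiv_le {ι : Type*} (p : MvPolynomial ι ℝ) (i : ι) :
    (pderiv i p).totalDegree ≤ p.totalDegree - 1 := by
  classical
  refine Finset.sup_le fun m hm => ?_
  rw [mem_support_iff, coeff_pderiv] at hm
  have h1 : m + Finsupp.single i 1 ∈ p.support := by
    rw [mem_support_iff]
    exact left_ne_zero_of_mul hm
  have h2 := le_totalDegree h1
  rw [Finsupp.sum_add_index' (by simp) (by simp)] at h2
  simp at h2
  omega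

/-- The loss of two degrees offsets the gain from the factor `1 - |x|²`, so that `q ↦ Δ((1 - |x|²)
q)` preserves each space of polynomials of bounded degree. -/
theorem totalDegree_polyLaplacian_le (p : MvPolynomial ι ℝ) :
    (polyLaplacian p).totalDegree ≤ p.totalDegree - 2 := by
  rw [polyLaplacian_apply]
  refine totalDegree_finsetSum_le fun i _ => ?_
  have h1 := totalDegree_pderiv_le (pderiv i p) i
  have h2 := totalDegree_pderiv_le p i
  omega

theorem totalDegree_one_sub_normSq_mul_le (q : MvPolynomial ι ℝ) :
    ((1 - ∑ i, X i ^ 2) * q).totalDegree ≤ q.totalDegree + 2 := by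
  refine (totalDegree_mul _ _).trans ?_
  rw [add_comm]
  gcongr
  refine (totalDegree_sub _ _).trans (max_le (by simp) ?_)
  refine totalDegree_finsetSum_le fun i _ => ?_
  exact (totalDegree_pow _ _).trans (by simp)

theorem polyFun_mul (p q : MvPolynomial ι ℝ) (x : E) :
    polyFun b (p * q) x = polyFun b p x * polyFun b q x := by
  simp [polyFun]

theorem polyFun_sub (p q : MvPolynomial ι ℝ) (x : E) :
    polyFun b (p - q) x = polyFun b p x - polyFun b q x := by
  simp [polyFun]

theorem polyFun_one (x : E) : polyFun b 1 x = 1 := by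
  simp [polyFun]

theorem polyFun_one_sub_normSq_mul (q : MvPolynomial ι ℝ) (x : E) :
    polyFun b ((1 - ∑ i, X i ^ 2) * q) x = (1 - ‖x‖ ^ 2) * polyFun b q x := by
  rw [polyFun_mul, polyFun_sub, polyFun_one, polyFun_normSq]

/-- The product is harmonic and vanishes on the unit sphere. The maximum principle for `q` and `-q`
makes it vanish in the ball, where `1 - |x|²` is positive. -/
theorem eq_zero_of_polyLaplacian_one_sub_normSq_mul [Nonempty ι] [ProperSpace E]
    (b : OrthonormalBasis ι ℝ E)
    {q : MvPolynomial ι ℝ} (hq : polyLaplacian ((1 - ∑ i, X i ^ 2) * q) = 0) : q = 0 := by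
  have key : ∀ q : MvPolynomial ι ℝ, polyLaplacian ((1 - ∑ i, X i ^ 2) * q) = 0 →
      ∀ x ∈ Metric.closedBall (0 : E) 1, polyFun b ((1 - ∑ i, X i ^ 2) * q) x ≤ 0 := by
    intro q hq
    refine nonpos_of_subharmonic_of_sphere b (contDiff_polyFun b _) (fun x _ => ?_) fun x hx => ?_
    · rw [secondOrderOp_polyFun, hq]
      simp [polyFun]
    · rw [polyFun_one_sub_normSq_mul]
      have : ‖x‖ = 1 := by simpa using hx
      simp [this]
  refine polyFun_injective_of_ball b one_pos fun x hx => ?_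
  have h1 := key q hq x (Metric.ball_subset_closedBall hx)
  have h2 := key (-q) (by rw [mul_neg, map_neg, hq, neg_zero]) x
    (Metric.ball_subset_closedBall hx)
  rw [polyFun_one_sub_normSq_mul] at h1 h2
  have h3 : polyFun b (-q) x = -polyFun b q x := by simp [polyFun]
  rw [h3] at h2
  have h4 : 0 < 1 - ‖x‖ ^ 2 := by
    rw [mem_ball_zero_iff] at hx
    nlinarith [norm_nonneg x]
  nlinarith

/-- The solution is `p - (1 - |x|²) q` with `Δ((1 - |x|²) q) = Δp`. Such a `q` exists because `q ↦
Δ((1 - |x|²) q)` is an injective endomorphism of a finite dimensional space, hence surjective. -/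
theorem exists_harmonic_polynomial_eq_on_sphere [Nonempty ι] [ProperSpace E]
    (p : MvPolynomial ι ℝ) :
    ∃ h : MvPolynomial ι ℝ, polyLaplacian h = 0 ∧
      ∀ x ∈ Metric.sphere (0 : E) 1, polyFun b h x = polyFun b p x := by
  set d := p.totalDegree
  let T₀ : MvPolynomial ι ℝ →ₗ[ℝ] MvPolynomial ι ℝ :=
    polyLaplacian ∘ₗ LinearMap.mulLeft ℝ (1 - ∑ i, X i ^ 2)
  have hT₀ : ∀ q ∈ restrictTotalDegree ι ℝ d, T₀ q ∈ restrictTotalDegree ι ℝ d := by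
    intro q hq
    rw [mem_restrictTotalDegree] at hq ⊢
    have h1 := totalDegree_polyLaplacian_le ((1 - ∑ i, X i ^ 2) * q)
    have h2 := totalDegree_one_sub_normSq_mul_le q
    have h3 : T₀ q = polyLaplacian ((1 - ∑ i, X i ^ 2) * q) := rfl
    rw [h3]
    omega
  let T := T₀.restrict hT₀
  have hinj : Function.Injective T := by
    rw [← LinearMap.ker_eq_bot, LinearMap.ker_eq_bot']
    intro q hq
    have h1 : polyLaplacian ((1 - ∑ i, X i ^ 2) * (q : MvPolynomial ι ℝ)) = 0 :=
      congrArg Subtype.val hq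
    exact Subtype.ext (eq_zero_of_polyLaplacian_one_sub_normSq_mul b h1)
  have hsurj := LinearMap.injective_iff_surjective.1 hinj
  have hp : polyLaplacian p ∈ restrictTotalDegree ι ℝ d := by
    rw [mem_restrictTotalDegree]
    have := totalDegree_polyLaplacian_le p
    omega
  obtain ⟨q, hq⟩ := hsurj ⟨_, hp⟩
  have h1 : polyLaplacian ((1 - ∑ i, X i ^ 2) * (q : MvPolynomial ι ℝ)) = polyLaplacian p :=
    congrArg Subtype.val hq
  refine ⟨p - (1 - ∑ i, X i ^ 2) * (q : MvPolynomial ι ℝ), by rw [map_sub, h1, sub_self], fun x hx => ?_⟩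
  have : ‖x‖ = 1 := by simpa using hx
  rw [polyFun_sub, polyFun_one_sub_normSq_mul, this]
  ring

/-- Stone–Weierstrass: the coordinate functions separate the points of the sphere. -/
theorem exists_polyFun_near_on_sphere [ProperSpace E]
    (φ : C(Metric.sphere (0 : E) 1, ℝ)) {δ : ℝ} (hδ : 0 < δ) :
    ∃ p : MvPolynomial ι ℝ, ∀ x : Metric.sphere (0 : E) 1, |polyFun b p x - φ x| < δ := by
  let c : ι → C(Metric.sphere (0 : E) 1, ℝ) := fun i =>
    ⟨fun x => inner ℝ (b i) (x : E), by fun_prop⟩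
  let A : Subalgebra ℝ C(Metric.sphere (0 : E) 1, ℝ) := (aeval c).range
  have hc : ∀ (p : MvPolynomial ι ℝ) (x : Metric.sphere (0 : E) 1),
      (aeval c p) x = polyFun b p x := by
    intro p x
    induction p using MvPolynomial.induction_on with
    | C a => simp [polyFun]
    | add p q hp hq =>
      rw [map_add, ContinuousMap.add_apply, hp, hq]
      simp [polyFun]
    | mul_X p j hp =>
      rw [map_mul, ContinuousMap.mul_apply, hp]
      simp [polyFun, c]
  have hA : A.SeparatesPoints := by
    intro x y hxy
    obtain ⟨i, hi⟩ : ∃ i, inner ℝ (b i) (x : E) ≠ inner ℝ (b i) (y : E) := by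
      by_contra! hall
      apply hxy
      refine Subtype.ext (b.repr.injective ?_)
      ext i
      rw [b.repr_apply_apply, b.repr_apply_apply, hall]
    exact ⟨c i, ⟨c i, ⟨X i, by simp⟩, rfl⟩, hi⟩
  have htop := ContinuousMap.subalgebra_topologicalClosure_eq_top_of_separatesPoints A hA
  have hφ : φ ∈ closure (A : Set C(Metric.sphere (0 : E) 1, ℝ)) := by
    rw [← Subalgebra.topologicalClosure_coe, htop]
    trivial
  obtain ⟨g, ⟨p, rfl⟩, hp⟩ := Metric.mem_closure_iff.1 hφ δ hδ
  refine ⟨p, fun x => ?_⟩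
  have := (ContinuousMap.dist_apply_le_dist x).trans_lt hp
  rw [Real.dist_eq, abs_sub_comm] at this
  rw [← hc]
  exact this

end Polynomials

/-! ### Homogeneous components of harmonic polynomials. -/

section HomogeneousComponents

open MvPolynomial

variable {ι : Type*} [Fintype ι]

theorem pderiv_homogeneousComponent_succ {ι : Type*} (p : MvPolynomial ι ℝ) (i : ι) (k : ℕ) :
    pderiv i (homogeneousComponent (k + 1) p) = homogeneousComponent k (pderiv i p) := by
  classical
  ext m
  rw [coeff_pderiv, coeff_homogeneousComponent, coeff_homogeneousComponent, coeff_pderiv]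
  have : (m + Finsupp.single i 1).degree = m.degree + 1 := by simp
  rw [this]
  by_cases h : m.degree = k <;> simp [h]

/-- The Laplacian maps the component of degree `k + 2` to the component of degree `k` of the
Laplacian. Components of degree at most one are harmonic in any case. -/
theorem polyLaplacian_homogeneousComponent {p : MvPolynomial ι ℝ} (hp : polyLaplacian p = 0)
    (k : ℕ) : polyLaplacian (homogeneousComponent k p) = 0 := by
  match k with
  | 0 => simp [polyLaplacian_apply]
  | 1 =>
    rw [polyLaplacian_apply]
    refine Finset.sum_eq_zero fun i _ => ?_
    rw [show 1 = 0 + 1 from rfl, pderiv_homogeneousComponent_succ, homogeneousComponent_zero,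
      pderiv_C]
  | k + 2 =>
    rw [polyLaplacian_apply]
    simp only [pderiv_homogeneousComponent_succ]
    rw [← map_sum, ← polyLaplacian_apply, hp, map_zero]

end HomogeneousComponents

/-! ### Integration in polar coordinates. -/

section Polar

variable {E : Type*} [NormedAddCommGroup E] [NormedSpace ℝ E] [FiniteDimensional ℝ E]
  [MeasurableSpace E] [BorelSpace E] (μ : Measure E) [μ.IsAddHaarMeasure]

theorem measurableEmbedding_polar :
    MeasurableEmbedding fun y : Metric.sphere (0 : E) 1 × Ioi (0 : ℝ) => (y.2 : ℝ) • (y.1 : E) :=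
  (MeasurableEmbedding.subtype_coe (measurableSet_singleton (0 : E)).compl).comp
    (homeomorphUnitSphereProd E).symm.measurableEmbedding

/-- Polar coordinates cover the complement of the origin, which is a null set because the space is
nontrivial. -/
theorem map_polar [Nontrivial E] : Measure.map
    (fun y : Metric.sphere (0 : E) 1 × Ioi (0 : ℝ) => (y.2 : ℝ) • (y.1 : E))
    (μ.toSphere.prod (Measure.volumeIoiPow (Module.finrank ℝ E - 1))) = μ := by
  have h1 := (μ.measurePreserving_homeomorphUnitSphereProd.symm
    (homeomorphUnitSphereProd E).toMeasurableEquiv)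
  have h2 : (fun y : Metric.sphere (0 : E) 1 × Ioi (0 : ℝ) => (y.2 : ℝ) • (y.1 : E)) =
      Subtype.val ∘ (homeomorphUnitSphereProd E).toMeasurableEquiv.symm := by
    ext y; rfl
  rw [h2, ← Measure.map_map measurable_subtype_coe (MeasurableEquiv.measurable _), h1.map_eq,
    (MeasurableEmbedding.subtype_coe (measurableSet_singleton (0 : E)).compl).map_comap,
    Subtype.range_coe, Measure.restrict_eq_self_of_ae_mem]
  rw [ae_iff]
  simp

theorem lintegral_polar [Nontrivial E] {F : E → ENNReal} (hF : Measurable F) :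
    ∫⁻ x, F x ∂μ = ∫⁻ r, ∫⁻ y, F ((r : ℝ) • (y : E)) ∂μ.toSphere
      ∂(Measure.volumeIoiPow (Module.finrank ℝ E - 1)) := by
  conv_lhs => rw [← map_polar μ, lintegral_map hF measurableEmbedding_polar.measurable]
  exact lintegral_prod_symm _ (hF.comp measurableEmbedding_polar.measurable).aemeasurable

theorem integral_polar_of_separated [Nontrivial E] {φ : Metric.sphere (0 : E) 1 → ℝ} {w : ℝ → ℝ} {F : E → ℝ}
    (hF : ∀ (y : Metric.sphere (0 : E) 1) (r : ℝ), 0 < r → F (r • (y : E)) = φ y * w r) :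
    ∫ x, F x ∂μ = (∫ y, φ y ∂μ.toSphere) *
      ∫ r : Ioi (0 : ℝ), w r ∂(Measure.volumeIoiPow (Module.finrank ℝ E - 1)) := by
  conv_lhs => rw [← map_polar μ, measurableEmbedding_polar.integral_map]
  rw [← integral_prod_mul]
  exact integral_congr_ae (Eventually.of_forall fun y => hF y.1 y.2 y.2.2)

end Polar

/-! ### Spherical means of harmonic polynomials, linear forms and quadratic forms. -/

section MeanValue

open MvPolynomial

theorem hasDerivAt_max_sq (s : ℝ) : HasDerivAt (fun s : ℝ => (max 0 s) ^ 2) (2 * max 0 s) s := by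
  rcases lt_trichotomy s 0 with h | h | h
  · rw [max_eq_left h.le, mul_zero]
    refine (hasDerivAt_const s (0 : ℝ)).congr_of_eventuallyEq ?_
    filter_upwards [Iio_mem_nhds h] with x hx
    simp [max_eq_left (le_of_lt (mem_Iio.1 hx))]
  · subst h
    simp only [max_self, mul_zero]
    rw [hasDerivAt_iff_isLittleO]
    simp only [max_self, ne_eq, OfNat.ofNat_ne_zero, not_false_eq_true, zero_pow, sub_zero,
      smul_zero]
    have h1 : (fun x : ℝ => max 0 x ^ 2) =O[𝓝 0] fun x : ℝ => x ^ 2 := by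
      refine Asymptotics.IsBigO.of_bound 1 (Eventually.of_forall fun x => ?_)
      rw [one_mul, Real.norm_of_nonneg (by positivity), Real.norm_of_nonneg (by positivity)]
      rcases le_total 0 x with h | h
      · rw [max_eq_right h]
      · rw [max_eq_left h]; nlinarith
    refine h1.trans_isLittleO ?_
    simpa using Asymptotics.isLittleO_pow_pow (𝕜 := ℝ) (show 1 < 2 by norm_num)
  · rw [max_eq_right h.le]
    have : HasDerivAt (fun x : ℝ => x ^ 2) (2 * s) s := by simpa using hasDerivAt_pow 2 s
    refine this.congr_of_eventuallyEq ?_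
    filter_upwards [Ioi_mem_nhds h] with x hx
    simp [max_eq_right (le_of_lt (mem_Ioi.1 hx))]

variable {E : Type*} [NormedAddCommGroup E] [InnerProductSpace ℝ E]

theorem hasCompactSupport_max_one_sub_normSq {E : Type*} [NormedAddCommGroup E]
    [ProperSpace E] : HasCompactSupport fun x : E => max 0 (1 - ‖x‖ ^ 2) := by
  refine HasCompactSupport.intro (isCompact_closedBall (0 : E) 1) fun x hx => ?_
  rw [mem_closedBall_zero_iff, not_le] at hx
  exact max_eq_left (by nlinarith)

theorem hasFDerivAt_max_one_sub_normSq_sq (x : E) :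
    HasFDerivAt (fun x : E => (max 0 (1 - ‖x‖ ^ 2)) ^ 2)
      ((-4 * max 0 (1 - ‖x‖ ^ 2)) • innerSL ℝ x) x := by
  have h1 : HasFDerivAt (fun x : E => 1 - ‖x‖ ^ 2) _ x :=
    ((hasStrictFDerivAt_norm_sq x).hasFDerivAt).const_sub 1
  have h2 := (hasDerivAt_max_sq (1 - ‖x‖ ^ 2)).comp_hasFDerivAt x h1
  refine h2.congr_fderiv ?_
  ext v
  simp
  ring

theorem continuous_polyFun {ι : Type*} [Fintype ι] (b : OrthonormalBasis ι ℝ E) (p : MvPolynomial ι ℝ) : Continuous (polyFun b p) :=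
  (contDiff_polyFun b p (n := 0)).continuous

theorem polyFun_smul_of_isHomogeneous {ι : Type*} [Fintype ι]
    (b : OrthonormalBasis ι ℝ E) {p : MvPolynomial ι ℝ} {d : ℕ} (hp : p.IsHomogeneous d)
    (r : ℝ) (x : E) : polyFun b p (r • x) = r ^ d * polyFun b p x := by
  unfold polyFun
  simp only [inner_smul_right, eval_eq, Finset.mul_sum]
  refine Finset.sum_congr rfl fun m hm => ?_
  have hdeg : ∑ i, m i = d := by
    have := hp.degree_eq_sum_deg_support hm
    rw [this]
    exact (Finset.sum_subset (Finset.subset_univ _) (by simp)).symm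
  simp only [mul_pow, Finset.prod_mul_distrib]
  have : ∏ i ∈ m.support, r ^ m i = r ^ d := by
    rw [Finset.prod_pow_eq_pow_sum, ← hdeg]
    congr 1
    exact Finset.sum_subset (Finset.subset_univ _) (by simp)
  rw [this]
  ring

/-- The uniform probability measure on the unit sphere. -/
noncomputable def sphereProb [MeasurableSpace E] (μ : Measure E) : Measure (Metric.sphere (0 : E) 1) :=
  (μ.toSphere univ)⁻¹ • μ.toSphere

theorem integral_sphereProb [MeasurableSpace E] (μ : Measure E)
    (φ : Metric.sphere (0 : E) 1 → ℝ) :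
    ∫ y, φ y ∂sphereProb μ = (μ.toSphere.real univ)⁻¹ * ∫ y, φ y ∂μ.toSphere := by
  rw [sphereProb, integral_smul_measure, ENNReal.toReal_inv]
  rfl

variable [FiniteDimensional ℝ E]
  [MeasurableSpace E] [BorelSpace E] (μ : Measure E) [μ.IsAddHaarMeasure]
  {ι : Type*} [Fintype ι] (b : OrthonormalBasis ι ℝ E)

/-- Integration by parts against the compactly supported differentiable weight `(1 - |x|²)₊²`, whose
gradient is `-4 (1 - |x|²)₊ x`. -/
theorem integral_polyFun_pderiv_mul_inner (p : MvPolynomial ι ℝ) (i : ι) :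
    ∫ x, polyFun b (pderiv i p) x * (inner ℝ (b i) x * max 0 (1 - ‖x‖ ^ 2)) ∂μ =
      (1 / 4) * ∫ x, polyFun b (pderiv i (pderiv i p)) x * (max 0 (1 - ‖x‖ ^ 2)) ^ 2 ∂μ := by
  have hc := hasCompactSupport_max_one_sub_normSq (E := E)
  have hc2 : HasCompactSupport fun x : E => (max 0 (1 - ‖x‖ ^ 2)) ^ 2 :=
    hc.comp_left (g := fun s : ℝ => s ^ 2) (by simp)
  have hcont : Continuous fun x : E => max 0 (1 - ‖x‖ ^ 2) := by fun_prop
  have hW : ∀ x : E, fderiv ℝ (fun x : E => (max 0 (1 - ‖x‖ ^ 2)) ^ 2) x (b i) =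
      -4 * (inner ℝ (b i) x * max 0 (1 - ‖x‖ ^ 2)) := by
    intro x
    rw [(hasFDerivAt_max_one_sub_normSq_sq x).fderiv]
    simp only [smul_apply, innerSL_apply_apply, smul_eq_mul, real_inner_comm]
    ring
  have hP := continuous_polyFun b
  have key := integral_mul_fderiv_eq_neg_fderiv_mul_of_integrable (μ := μ)
    (f := polyFun b (pderiv i p)) (g := fun x : E => (max 0 (1 - ‖x‖ ^ 2)) ^ 2) (v := b i)
    ?_ ?_ ?_ (fun x _ => (contDiff_polyFun b _ (n := 1)).differentiable (by simp) x)
    (fun x _ => (hasFDerivAt_max_one_sub_normSq_sq x).differentiableAt)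
  · simp only [fderiv_polyFun_basis, hW] at key
    rw [← neg_eq_iff_eq_neg] at key
    rw [← key, ← integral_neg, ← integral_const_mul]
    congr 1
    ext x
    ring
  · simp only [fderiv_polyFun_basis]
    exact ((hP _).mul (hcont.pow 2)).integrable_of_hasCompactSupport hc2.mul_left
  · simp only [hW]
    refine Continuous.integrable_of_hasCompactSupport (by have := hP (pderiv i p); fun_prop) ?_
    exact (((hc.mul_left (f := fun x => inner ℝ (b i) x)).mul_left
      (f := fun _ => (-4 : ℝ)))).mul_left
  · exact ((hP _).mul (hcont.pow 2)).integrable_of_hasCompactSupport hc2.mul_left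

/-- Euler's identity `d p = ∑ xᵢ ∂ᵢp` followed by integration by parts leaves the integral of `Δp`
against a weight. -/
theorem integral_harmonic_homogeneous_mul {p : MvPolynomial ι ℝ} {d : ℕ} (hd : d ≠ 0)
    (hp : p.IsHomogeneous d) (hlap : polyLaplacian p = 0) :
    ∫ x, polyFun b p x * max 0 (1 - ‖x‖ ^ 2) ∂μ = 0 := by
  have hE := hp.sum_X_mul_pderiv
  have hE' : ∀ x : E, (d : ℝ) * polyFun b p x =
      ∑ i, inner ℝ (b i) x * polyFun b (pderiv i p) x := by
    intro x
    have := congrArg (fun q => polyFun b q x) hE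
    simp only [polyFun, map_sum, map_mul, eval_X, nsmul_eq_mul, map_natCast] at this
    exact this.symm
  have hc := hasCompactSupport_max_one_sub_normSq (E := E)
  have hc2 : HasCompactSupport fun x : E => (max 0 (1 - ‖x‖ ^ 2)) ^ 2 :=
    hc.comp_left (g := fun s : ℝ => s ^ 2) (by simp)
  have hcont : Continuous fun x : E => max 0 (1 - ‖x‖ ^ 2) := by fun_prop
  have hP := continuous_polyFun b
  have h1 : (d : ℝ) * ∫ x, polyFun b p x * max 0 (1 - ‖x‖ ^ 2) ∂μ =
      ∑ i, ∫ x, polyFun b (pderiv i p) x * (inner ℝ (b i) x * max 0 (1 - ‖x‖ ^ 2)) ∂μ := by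
    rw [← integral_const_mul, ← integral_finsetSum]
    · congr 1
      ext x
      rw [← mul_assoc, hE', Finset.sum_mul]
      refine Finset.sum_congr rfl fun i _ => by ring
    · intro i _
      refine Continuous.integrable_of_hasCompactSupport (by have := hP (pderiv i p); fun_prop) ?_
      exact (hc.mul_left (f := fun x => inner ℝ (b i) x)).mul_left
  simp only [integral_polyFun_pderiv_mul_inner] at h1
  rw [← Finset.mul_sum, ← integral_finsetSum] at h1
  · have h2 : ∀ x : E, ∑ i, polyFun b (pderiv i (pderiv i p)) x * (max 0 (1 - ‖x‖ ^ 2)) ^ 2 = 0 := by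
      intro x
      rw [← Finset.sum_mul]
      have := congrArg (fun q => polyFun b q x) hlap
      simp only [polyLaplacian_apply, polyFun, map_sum, map_zero] at this
      simp only [polyFun]
      rw [this, zero_mul]
    simp only [h2, integral_zero, mul_zero] at h1
    exact (mul_eq_zero.1 h1).resolve_left (by exact_mod_cast hd)
  · intro i _
    exact ((hP _).mul (hcont.pow 2)).integrable_of_hasCompactSupport hc2.mul_left

variable [Nontrivial E]

theorem integral_sphere_harmonic_homogeneous {p : MvPolynomial ι ℝ} {d : ℕ} (hd : d ≠ 0)
    (hp : p.IsHomogeneous d) (hlap : polyLaplacian p = 0) :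
    ∫ y : Metric.sphere (0 : E) 1, polyFun b p y ∂μ.toSphere = 0 := by
  have h1 := integral_polar_of_separated μ (F := fun x => polyFun b p x * max 0 (1 - ‖x‖ ^ 2))
    (φ := fun y => polyFun b p y) (w := fun r => r ^ d * max 0 (1 - r ^ 2)) (by
      intro y r hr
      have : ‖(y : E)‖ = 1 := by simp
      rw [polyFun_smul_of_isHomogeneous b hp, norm_smul, this, mul_one, Real.norm_eq_abs, sq_abs]
      ring)
  have h2 := integral_polar_of_separated μ (F := fun x : E => ‖x‖ ^ d * max 0 (1 - ‖x‖ ^ 2))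
    (φ := fun y => 1) (w := fun r => r ^ d * max 0 (1 - r ^ 2)) (by
      intro y r hr
      have : ‖(y : E)‖ = 1 := by simp
      rw [norm_smul, this, mul_one, Real.norm_of_nonneg hr.le]
      ring)
  rw [integral_harmonic_homogeneous_mul μ b hd hp hlap] at h1
  -- The vanishing integral over `E` is the spherical integral times a radial factor. That factor is
  -- nonzero, as it also occurs in the positive integral of `‖x‖^d (1 - |x|²)₊`.
  refine (mul_eq_zero.1 h1.symm).resolve_right fun h0 => ?_
  rw [h0, mul_zero] at h2
  have hc := hasCompactSupport_max_one_sub_normSq (E := E)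
  obtain ⟨v, hv⟩ := exists_norm_eq (E := E) (c := 1 / 2) (by norm_num)
  have hpos := Continuous.integral_pos_of_hasCompactSupport_nonneg_nonzero (μ := μ)
    (f := fun x : E => ‖x‖ ^ d * max 0 (1 - ‖x‖ ^ 2)) (x := v) (by fun_prop) hc.mul_left
    (fun x => by positivity) (by rw [hv]; norm_num)
  exact hpos.ne' h2

/-- Among the homogeneous components only the constant one has a nonzero spherical integral. -/
theorem integral_sphere_harmonic {p : MvPolynomial ι ℝ} (hlap : polyLaplacian p = 0) :
    ∫ y : Metric.sphere (0 : E) 1, polyFun b p y ∂μ.toSphere =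
      μ.toSphere.real univ * polyFun b p 0 := by
  have hP := continuous_polyFun b
  have hint : ∀ q, Integrable (fun y : Metric.sphere (0 : E) 1 => polyFun b q y) μ.toSphere :=
    fun q => ((hP q).comp continuous_subtype_val).integrable_of_hasCompactSupport
      (HasCompactSupport.of_compactSpace _)
  have hsum : ∀ x, polyFun b p x =
      ∑ k ∈ Finset.range (p.totalDegree + 1), polyFun b (homogeneousComponent k p) x := by
    intro x
    conv_lhs => rw [← sum_homogeneousComponent p]
    simp [polyFun]
  simp only [hsum]
  rw [integral_finsetSum _ fun k _ => hint _, Finset.sum_range_succ', Finset.sum_range_succ']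
  rw [Finset.sum_eq_zero fun k _ => integral_sphere_harmonic_homogeneous μ b k.succ_ne_zero
    (homogeneousComponent_isHomogeneous _ _) (polyLaplacian_homogeneousComponent hlap _)]
  have h0 : ∀ k, polyFun b (homogeneousComponent (k + 1) p) (0 : E) = 0 := fun k => by
    have := polyFun_smul_of_isHomogeneous b (homogeneousComponent_isHomogeneous (k + 1) p) 0 (0 : E)
    simpa using this
  have h1 : polyFun b (homogeneousComponent 0 p) = fun _ => coeff 0 p := by
    ext x; simp [polyFun]
  simp only [h0, h1, Finset.sum_const_zero, zero_add, integral_const, smul_eq_mul]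

instance : IsProbabilityMeasure (sphereProb μ) := by
  have : NeZero μ.toSphere := ⟨μ.toSphere_ne_zero⟩
  exact isProbabilityMeasureSMul

theorem toSphere_real_univ_ne_zero : μ.toSphere.real univ ≠ 0 := by
  rw [measureReal_def, ENNReal.toReal_ne_zero]
  exact ⟨Measure.measure_univ_ne_zero.2 μ.toSphere_ne_zero, measure_ne_top _ _⟩

theorem integral_sphereProb_harmonic {p : MvPolynomial ι ℝ} (hlap : polyLaplacian p = 0) :
    ∫ y : Metric.sphere (0 : E) 1, polyFun b p y ∂sphereProb μ = polyFun b p 0 := by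
  rw [integral_sphereProb, integral_sphere_harmonic μ b hlap,
    inv_mul_cancel_left₀ (toSphere_real_univ_ne_zero μ)]

theorem integrable_sphereProb_of_continuous {φ : Metric.sphere (0 : E) 1 → ℝ}
    (hφ : Continuous φ) : Integrable φ (sphereProb μ) :=
  hφ.integrable_of_hasCompactSupport (HasCompactSupport.of_compactSpace _)

theorem integral_sphereProb_linear (l : E →L[ℝ] ℝ) :
    ∫ y : Metric.sphere (0 : E) 1, l y ∂sphereProb μ = 0 := by
  let b := stdOrthonormalBasis ℝ E
  let p : MvPolynomial (Fin (Module.finrank ℝ E)) ℝ := ∑ i, C (l (b i)) * X i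
  have hp : ∀ x, polyFun b p x = l x := by
    intro x
    conv_rhs => rw [← b.sum_repr' x]
    simp [polyFun, p, mul_comm]
  have hlap : polyLaplacian p = 0 := by
    classical
    simp only [p, map_sum]
    refine Finset.sum_eq_zero fun i _ => ?_
    rw [polyLaplacian_apply]
    refine Finset.sum_eq_zero fun k _ => ?_
    by_cases h : i = k
    · subst h; simp
    · simp [pderiv_X_of_ne h]
  have := integral_sphereProb_harmonic μ b hlap
  simpa only [hp, map_zero] using this

theorem polyLaplacian_C_mul_X_mul_X [DecidableEq ι] (a : ℝ) (i j : ι) :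
    polyLaplacian (C a * (X i * X j)) = if i = j then C (2 * a) else 0 := by
  rw [polyLaplacian_apply]
  have h : ∀ k, pderiv k (pderiv k (C a * (X i * X j) : MvPolynomial ι ℝ)) =
      if k = i then (if i = j then C (2 * a) else 0) else 0 := by
    intro k
    rw [pderiv_C_mul, pderiv_C_mul]
    by_cases h1 : k = i
    · subst h1
      by_cases h2 : k = j
      · subst h2
        simp only [Derivation.leibniz, pderiv_X_self, smul_eq_mul, mul_one, map_add, if_true, C_mul]
        rw [map_ofNat C 2]
        ring
      · simp [Derivation.leibniz, pderiv_X_of_ne (Ne.symm h2), h2]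
    · by_cases h2 : k = j
      · subst h2
        simp [Derivation.leibniz, pderiv_X_of_ne (Ne.symm h1), h1]
      · simp [Derivation.leibniz, pderiv_X_of_ne (Ne.symm h1),
          pderiv_X_of_ne (Ne.symm h2), h1]
  simp only [h, Finset.sum_ite_eq', Finset.mem_univ, if_true]

/-- Subtracting the multiple `t |x|²` with the same trace leaves a harmonic polynomial that vanishes
at the origin, and `|x|² = 1` on the sphere. -/
theorem integral_sphereProb_bilin [Nonempty ι] (B : E →L[ℝ] E →L[ℝ] ℝ) :
    ∫ y : Metric.sphere (0 : E) 1, B y y ∂sphereProb μ =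
      (∑ k, B (b k) (b k)) / Fintype.card ι := by
  classical
  set t := (∑ k, B (b k) (b k)) / Fintype.card ι with ht
  let p : MvPolynomial ι ℝ :=
    (∑ i, ∑ j, C (B (b i) (b j)) * (X i * X j)) - ∑ i, C t * (X i * X i)
  have hp : ∀ x, polyFun b p x = B x x - t * ‖x‖ ^ 2 := by
    intro x
    have hB : B x x = ∑ i, ∑ j, B (b i) (b j) * (inner ℝ (b i) x * inner ℝ (b j) x) := by
      calc B x x = B (∑ i, inner ℝ (b i) x • b i) (∑ i, inner ℝ (b i) x • b i) := by
            rw [b.sum_repr']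
        _ = _ := by
          simp only [map_sum, map_smul, sum_apply, smul_apply, smul_eq_mul]
          rw [Finset.sum_comm]
          simp only [Finset.mul_sum]
          refine Finset.sum_congr rfl fun i _ => Finset.sum_congr rfl fun j _ => by ring
    rw [hB, ← b.sum_sq_norm_inner_right x, Finset.mul_sum]
    simp only [polyFun, p, map_sub, map_sum, map_mul, eval_C, eval_X, Real.norm_eq_abs, sq_abs]
    congr 1
    exact Finset.sum_congr rfl fun i _ => by ring
  have hlap : polyLaplacian p = 0 := by
    simp only [p, map_sub, map_sum, polyLaplacian_C_mul_X_mul_X, Finset.sum_ite_eq,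
      Finset.mem_univ, if_true]
    rw [← map_sum, ← map_sum, ← map_sub, ← Finset.mul_sum, Finset.sum_const, Finset.card_univ,
      nsmul_eq_mul]
    have hN : (Fintype.card ι : ℝ) ≠ 0 := by exact_mod_cast Fintype.card_ne_zero
    rw [ht, show (2 * ∑ i, B (b i) (b i)) - (Fintype.card ι : ℝ) *
      (2 * ((∑ k, B (b k) (b k)) / Fintype.card ι)) = 0 by field_simp; ring, map_zero]
  have h1 := integral_sphereProb_harmonic μ b hlap
  simp only [hp, norm_eq_of_mem_sphere, one_pow, mul_one, map_zero, norm_zero] at h1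
  rw [integral_sub (integrable_sphereProb_of_continuous μ (by fun_prop)) (integrable_const _)] at h1
  simp at h1
  linarith

end MeanValue

/-! ### Lower semicontinuous functions as increasing limits of continuous ones. -/

section LowerSemicontinuousApprox

variable {X : Type*} [PseudoMetricSpace X]

/-- The largest `k`-Lipschitz function below `min W k`. -/
noncomputable def lipschitzMinorant (W : X → ENNReal) (k : ℕ) (x : X) : ENNReal :=
  ⨅ y, (min (W y) k + k * edist x y)

theorem lipschitzMinorant_le (W : X → ENNReal) (k : ℕ) (x : X) :
    lipschitzMinorant W k x ≤ min (W x) k :=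
  (iInf_le _ x).trans (by simp)

theorem lipschitzMinorant_ne_top (W : X → ENNReal) (k : ℕ) (x : X) :
    lipschitzMinorant W k x ≠ ⊤ :=
  ne_top_of_le_ne_top (ENNReal.natCast_ne_top k)
    ((lipschitzMinorant_le W k x).trans (min_le_right _ _))

theorem lipschitzMinorant_le_add (W : X → ENNReal) (k : ℕ) (x x' : X) :
    lipschitzMinorant W k x ≤ lipschitzMinorant W k x' + k * edist x x' := by
  conv_rhs => rw [lipschitzMinorant, ENNReal.iInf_add]
  refine le_iInf fun y => (iInf_le _ y).trans ?_
  rw [add_assoc, ← mul_add]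
  gcongr
  rw [add_comm]
  exact edist_triangle x x' y

theorem continuous_lipschitzMinorant (W : X → ENNReal) (k : ℕ) :
    Continuous fun x => (lipschitzMinorant W k x).toReal := by
  refine LipschitzWith.continuous (K := k) (LipschitzWith.of_le_add_mul _ fun x y => ?_)
  have h := lipschitzMinorant_le_add W k x y
  have hy := lipschitzMinorant_ne_top W k y
  have hk : (k : ENNReal) * edist x y ≠ ⊤ :=
    ENNReal.mul_ne_top (ENNReal.natCast_ne_top k) (edist_ne_top x y)
  have := ENNReal.toReal_mono (ENNReal.add_ne_top.2 ⟨hy, hk⟩) h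
  rw [ENNReal.toReal_add hy hk, ENNReal.toReal_mul] at this
  simpa [edist_dist] using this

theorem monotone_lipschitzMinorant (W : X → ENNReal) : Monotone (lipschitzMinorant W) := by
  intro k l hkl x
  refine iInf_mono fun y => ?_
  have : (k : ENNReal) ≤ l := by exact_mod_cast hkl
  gcongr

/-- For `c' < W x`, points within `r` of `x` have `W > c'` by semicontinuity, while farther points
carry the penalty `k r ≥ c'`. -/
theorem iSup_lipschitzMinorant {W : X → ENNReal} (hW : LowerSemicontinuous W) (x : X) :
    ⨆ k, lipschitzMinorant W k x = W x := by
  refine le_antisymm (iSup_le fun k => (lipschitzMinorant_le W k x).trans (min_le_left _ _)) ?_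
  refine le_of_forall_lt fun c hc => ?_
  obtain ⟨c', hcc', hc'⟩ := exists_between hc
  obtain ⟨r, hr, hball⟩ := EMetric.mem_nhds_iff.1 (hW x c' hc')
  obtain ⟨k, hk⟩ : ∃ k : ℕ, c' ≤ k ∧ c' ≤ k * r := by
    have hc'top : c' ≠ ⊤ := hc'.ne_top
    obtain ⟨k₁, hk₁⟩ := ENNReal.exists_nat_gt hc'top
    obtain ⟨k₂, hk₂⟩ := ENNReal.exists_nat_mul_gt hr.ne' hc'top
    refine ⟨max k₁ k₂, hk₁.le.trans (by exact_mod_cast le_max_left _ _), hk₂.le.trans ?_⟩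
    gcongr
    exact le_max_right _ _
  refine hcc'.trans_le (le_trans ?_ (le_iSup _ k))
  refine le_iInf fun y => ?_
  by_cases hy : edist y x < r
  · exact le_add_right (le_min (le_of_lt (hball hy)) hk.1)
  · rw [not_lt, edist_comm] at hy
    exact le_add_left (hk.2.trans (by gcongr))

/-- By monotone convergence along the Lipschitz minorants it suffices to bound the integrals of
continuous minorants. -/
theorem lintegral_le_of_continuous_minorants [MeasurableSpace X] [OpensMeasurableSpace X]
    {ν : Measure X} [IsFiniteMeasure ν] {W : X → ENNReal} (hW : LowerSemicontinuous W) {A : ℝ}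
    (h : ∀ φ : X → ℝ, Continuous φ → (∀ x, 0 ≤ φ x) → (∀ x, ENNReal.ofReal (φ x) ≤ W x) →
      ∫ x, φ x ∂ν ≤ A) : ∫⁻ x, W x ∂ν ≤ ENNReal.ofReal A := by
  have hcont := continuous_lipschitzMinorant W
  have hof : ∀ k x, ENNReal.ofReal (lipschitzMinorant W k x).toReal = lipschitzMinorant W k x :=
    fun k x => ENNReal.ofReal_toReal (lipschitzMinorant_ne_top W k x)
  have hmeas : ∀ k, Measurable (lipschitzMinorant W k) := fun k => by
    have := (hcont k).measurable.ennreal_ofReal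
    simpa only [hof] using this
  calc ∫⁻ x, W x ∂ν = ∫⁻ x, ⨆ k, lipschitzMinorant W k x ∂ν := by
        simp only [iSup_lipschitzMinorant hW]
    _ = ⨆ k, ∫⁻ x, lipschitzMinorant W k x ∂ν :=
        lintegral_iSup hmeas (monotone_lipschitzMinorant W)
    _ ≤ ENNReal.ofReal A := iSup_le fun k => ?_
  have hint : Integrable (fun x => (lipschitzMinorant W k x).toReal) ν := by
    refine Integrable.of_bound (hcont k).aestronglyMeasurable k (Eventually.of_forall fun x => ?_)
    rw [Real.norm_of_nonneg ENNReal.toReal_nonneg]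
    exact ENNReal.toReal_le_of_le_ofReal (by positivity) (by
      rw [ENNReal.ofReal_natCast]
      exact (lipschitzMinorant_le W k x).trans (min_le_right _ _))
  rw [lintegral_congr fun x => (hof k x).symm]
  rw [← ofReal_integral_eq_lintegral_ofReal hint
    (Eventually.of_forall fun x => ENNReal.toReal_nonneg)]
  refine ENNReal.ofReal_le_ofReal (h _ (hcont k) (fun x => ENNReal.toReal_nonneg) fun x => ?_)
  rw [hof]
  exact (lipschitzMinorant_le W k x).trans (min_le_left _ _)

end LowerSemicontinuousApprox

/-! ### The nonnegative gap below a bound, which can be integrated without prior integrability of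
`u`. -/

section Gap

/-- The nonnegative part of `M - a`. -/
noncomputable def gap (M : ℝ) (a : EReal) : ENNReal := ((M : EReal) + -a).toENNReal

theorem gap_coe (M a : ℝ) : gap M a = ENNReal.ofReal (M - a) := by
  rw [gap, ← EReal.coe_neg, ← EReal.coe_add, EReal.toENNReal_of_ne_top (EReal.coe_ne_top _),
    EReal.toReal_coe, sub_eq_add_neg]

theorem gap_bot (M : ℝ) : gap M ⊥ = ⊤ := by
  simp [gap]

theorem gap_eq_top_iff {M : ℝ} {a : EReal} : gap M a = ⊤ ↔ a = ⊥ := by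
  induction a with
  | bot => simp [gap_bot]
  | coe a => simp [gap_coe]
  | top => simp [gap]

theorem gap_eq_ofReal {M : ℝ} {a : EReal} (h : a ≠ ⊥) (h' : a ≠ ⊤) :
    gap M a = ENNReal.ofReal (M - a.toReal) := by
  rw [← gap_coe, EReal.coe_toReal h' h]

theorem continuous_gap (M : ℝ) : Continuous (gap M) := by
  refine EReal.continuous_toENNReal.comp ?_
  rw [continuous_iff_continuousAt]
  intro a
  exact (EReal.continuousAt_add (p := ((M : EReal), -a)) (Or.inl (EReal.coe_ne_top _))
    (Or.inl (EReal.coe_ne_bot _))).comp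
      (f := fun a : EReal => ((M : EReal), -a)) (by fun_prop)

theorem antitone_gap (M : ℝ) : Antitone (gap M) := fun _ _ hab =>
  EReal.toENNReal_le_toENNReal (add_le_add le_rfl (EReal.neg_le_neg_iff.2 hab))

theorem le_sub_of_ofReal_le_gap {M t : ℝ} {a : EReal} (ha : a ≤ M)
    (h : ENNReal.ofReal t ≤ gap M a) : a ≤ ((M - t : ℝ) : EReal) := by
  induction a with
  | bot => exact bot_le
  | coe a =>
    rw [gap_coe] at h
    rw [EReal.coe_le_coe_iff] at ha ⊢
    have := (ENNReal.ofReal_le_ofReal_iff (by linarith)).1 h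
    linarith
  | top => exact absurd ha (not_le.2 (EReal.coe_lt_top M))

end Gap

/-! ### Sub-mean value inequality for viscosity subsolutions. -/

section SubMean

variable {E : Type*} [NormedAddCommGroup E] [InnerProductSpace ℝ E] [FiniteDimensional ℝ E]
  [MeasurableSpace E] [BorelSpace E] [Nontrivial E] (μ : Measure E) [μ.IsAddHaarMeasure]
  {ι : Type*} [Fintype ι] [Nonempty ι] (b : OrthonormalBasis ι ℝ E)

/-- Up to `δ`, `φ` is replaced by a polynomial, whose harmonic extension plus `c(|x|² - 1)` solves
`Δh = g₀` with boundary values above `u`. Comparison at the origin and the mean value property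
conclude. -/
theorem submean_of_continuous_majorant {u : E → EReal} {g₀ : ℝ}
    (husc : UpperSemicontinuousOn u (Metric.closedBall 0 1))
    (htop : ∀ x ∈ Metric.closedBall (0 : E) 1, u x ≠ ⊤)
    (hvisc : ∀ x ∈ Metric.ball (0 : E) 1, ∀ q, TouchesAbove u x q → g₀ ≤ secondOrderOp b q x)
    {φ : Metric.sphere (0 : E) 1 → ℝ} (hφ : Continuous φ)
    (hle : ∀ y : Metric.sphere (0 : E) 1, u y ≤ (φ y : EReal)) :
    u 0 ≤ ((∫ y, φ y ∂sphereProb μ - g₀ / (2 * Fintype.card ι) : ℝ) : EReal) := by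
  have hN : (0 : ℝ) < Fintype.card ι := by exact_mod_cast Fintype.card_pos
  have key : ∀ δ : ℝ, 0 < δ →
      u 0 ≤ ((∫ y, φ y ∂sphereProb μ - g₀ / (2 * Fintype.card ι) + δ : ℝ) : EReal) := by
    intro δ hδ
    -- Approximating `φ + δ/2` within `δ/2` places `p` between `φ` and `φ + δ` on the sphere.
    obtain ⟨p, hp⟩ := exists_polyFun_near_on_sphere b ⟨fun y => φ y + δ / 2, by fun_prop⟩
      (half_pos hδ)
    obtain ⟨h, hlap, hh⟩ := exists_harmonic_polynomial_eq_on_sphere b p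
    let c := g₀ / (2 * Fintype.card ι)
    have hsm : ContDiff ℝ 2 fun x : E => c * ‖x - 0‖ ^ 2 :=
      contDiff_const.mul (contDiff_norm_sub_sq 0)
    have hsm' : ContDiff ℝ 2 fun x : E => polyFun b h x + c * ‖x - 0‖ ^ 2 :=
      (contDiff_polyFun b h).add hsm
    have hcmp := comparison_unit_ball b husc htop hvisc
      (h := fun x => (polyFun b h x + c * ‖x - 0‖ ^ 2) + -c) (hsm'.add contDiff_const) ?_ ?_ 0
      (Metric.mem_closedBall_self zero_le_one)
    · refine hcmp.trans (EReal.coe_le_coe_iff.2 ?_)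
      have h1 : polyFun b h 0 = ∫ y : Metric.sphere (0 : E) 1, polyFun b p y ∂sphereProb μ := by
        rw [← integral_sphereProb_harmonic μ b hlap]
        exact integral_congr_ae (Eventually.of_forall fun y => hh y y.2)
      have h2 : ∫ y : Metric.sphere (0 : E) 1, polyFun b p y ∂sphereProb μ ≤
          ∫ y, (φ y + δ) ∂sphereProb μ := by
        refine integral_mono (integrable_sphereProb_of_continuous μ
          ((continuous_polyFun b p).comp continuous_subtype_val))
          (integrable_sphereProb_of_continuous μ (by fun_prop)) fun y => ?_
        have := (abs_lt.1 (hp y)).2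
        simp only [ContinuousMap.coe_mk] at this
        linarith
      rw [integral_add (integrable_sphereProb_of_continuous μ hφ) (integrable_const _)] at h2
      simp at h2
      simp only [sub_zero, norm_zero]
      rw [h1]
      simp only [c] at *
      linarith
    · intro x _
      rw [secondOrderOp_add b hsm'.contDiffAt contDiffAt_const, secondOrderOp_const,
        secondOrderOp_add b (contDiff_polyFun b h).contDiffAt hsm.contDiffAt,
        secondOrderOp_polyFun, hlap, secondOrderOp_const_mul b (contDiff_norm_sub_sq 0).contDiffAt,
        secondOrderOp_norm_sub_sq]
      simp only [b.norm_eq_one, one_pow, Finset.sum_const, Finset.card_univ, nsmul_eq_mul,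
        mul_one, c, polyFun, map_zero, zero_add, add_zero]
      rw [show g₀ / (2 * (Fintype.card ι : ℝ)) * (2 * Fintype.card ι) = g₀ by field_simp]
    · intro x hx
      have hx1 : ‖x‖ = 1 := by simpa using hx
      have h3 := hle ⟨x, hx⟩
      refine h3.trans (EReal.coe_le_coe_iff.2 ?_)
      rw [hh x hx, sub_zero, hx1]
      have := (abs_lt.1 (hp ⟨x, hx⟩)).1
      simp only [ContinuousMap.coe_mk] at this
      linarith
  have h0 := htop 0 (Metric.mem_closedBall_self zero_le_one)
  by_cases hbot : u 0 = ⊥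
  · rw [hbot]; exact bot_le
  · rw [← EReal.coe_toReal h0 hbot, EReal.coe_le_coe_iff]
    refine le_of_forall_pos_le_add fun δ hδ => ?_
    have := key δ hδ
    rwa [← EReal.coe_toReal h0 hbot, EReal.coe_le_coe_iff] at this

/-- The map `x ↦ z + r T x` pulls the operator in the directions `T (b k)` back to `r⁻²` times the
Laplacian, so the right-hand side becomes `r² g₀`. The gap of `u` is lower semicontinuous on the
sphere, and its continuous minorants `φ` yield continuous majorants `M - φ` of `u`. -/
theorem sphere_submean {u : E → EReal} {Ω : Set E} (husc : UpperSemicontinuousOn u Ω)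
    (htop : ∀ x ∈ Ω, u x ≠ ⊤) (T : E ≃L[ℝ] E) {z : E} {r : ℝ} (hr : 0 < r)
    (hsub : ∀ x ∈ Metric.closedBall (0 : E) 1, z + r • T x ∈ Ω) {g₀ : ℝ}
    (hvisc : ∀ x ∈ Metric.ball (0 : E) 1, ∀ q, TouchesAbove u (z + r • T x) q →
      g₀ ≤ secondOrderOp (fun k => T (b k)) q (z + r • T x))
    {M : ℝ} (hM : ∀ x ∈ Metric.sphere (0 : E) 1, u (z + r • T x) ≤ M) :
    ∫⁻ y : Metric.sphere (0 : E) 1, gap M (u (z + r • T y)) ∂sphereProb μ ≤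
      gap (M - r ^ 2 * g₀ / (2 * Fintype.card ι)) (u z) := by
  let v : E → EReal := fun x => u (z + r • T x)
  have hcont : Continuous fun x : E => z + r • T x := by fun_prop
  have hvusc : UpperSemicontinuousOn v (Metric.closedBall 0 1) := by
    intro x hx c hc
    have := husc _ (hsub x hx) c hc
    exact (hcont.continuousWithinAt.tendsto_nhdsWithin fun y hy => hsub y hy).eventually this
  have hvtop : ∀ x ∈ Metric.closedBall (0 : E) 1, v x ≠ ⊤ := fun x hx => htop _ (hsub x hx)
  have hvvisc : ∀ x ∈ Metric.ball (0 : E) 1, ∀ q, TouchesAbove v x q →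
      r ^ 2 * g₀ ≤ secondOrderOp b q x := by
    intro x hx q hq
    have h1 := hvisc x hx _ (hq.comp_affine T hr.ne' z)
    have h2 : secondOrderOp (fun k => T (b k)) (fun y => q ((r⁻¹ • (T.symm : E →L[ℝ] E)) y
        + -(r⁻¹ • T.symm z))) (z + r • T x) = (r ^ 2)⁻¹ * secondOrderOp b q x := by
      have hinv : (r⁻¹ • (T.symm : E →L[ℝ] E)) (z + r • T x) + -(r⁻¹ • T.symm z) = x := by
        simp [hr.ne']
      rw [secondOrderOp, secondOrderOp, Finset.mul_sum]
      refine Finset.sum_congr rfl fun k _ => ?_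
      rw [hess_comp_affine _ _ (by rw [hinv]; exact hq.1), hinv]
      simp only [smul_apply, ContinuousLinearEquiv.coe_coe, ContinuousLinearEquiv.symm_apply_apply]
      rw [hess_smul_smul]
      ring
    rw [h2] at h1
    have hr2 : 0 < r ^ 2 := by positivity
    rw [inv_mul_eq_div, le_div_iff₀ hr2] at h1
    linarith
  have hv0 : v 0 = u z := by simp [v]
  by_cases hbot : u z = ⊥
  · rw [hbot, gap_bot]; exact le_top
  have hz0 : u z ≠ ⊤ := by
    rw [← hv0]; exact hvtop 0 (Metric.mem_closedBall_self zero_le_one)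
  rw [gap_eq_ofReal hbot hz0]
  have hlsc : LowerSemicontinuous fun y : Metric.sphere (0 : E) 1 => gap M (u (z + r • T y)) := by
    have h1 : UpperSemicontinuous fun y : Metric.sphere (0 : E) 1 => v y := by
      intro y c hc
      have := hvusc y (Metric.sphere_subset_closedBall y.2) c hc
      have ht : Tendsto (fun y : Metric.sphere (0 : E) 1 => (y : E)) (𝓝 y)
          (𝓝[Metric.closedBall 0 1] (y : E)) :=
        tendsto_nhdsWithin_iff.2 ⟨continuous_subtype_val.continuousAt,
          Eventually.of_forall fun y => Metric.sphere_subset_closedBall y.2⟩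
      exact ht.eventually this
    exact (continuous_gap M).comp_upperSemicontinuous_antitone h1 (antitone_gap M)
  refine lintegral_le_of_continuous_minorants hlsc fun φ hφ hφ0 hφle => ?_
  have h3 := submean_of_continuous_majorant μ b hvusc hvtop hvvisc
    (φ := fun y => M - φ y) (by fun_prop)
    (fun y => le_sub_of_ofReal_le_gap (hM y y.2) (hφle y))
  rw [hv0, ← EReal.coe_toReal hz0 hbot, EReal.coe_le_coe_iff,
    integral_sub (integrable_const _) (integrable_sphereProb_of_continuous μ hφ)] at h3
  simp at h3
  linarith

end SubMean

/-! ### Radial averaging kernels and their convolutions. -/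

section Kernels

variable {E : Type*} [NormedAddCommGroup E] [InnerProductSpace ℝ E] [FiniteDimensional ℝ E]
  [MeasurableSpace E] [BorelSpace E]

/-- A smooth radial averaging kernel supported in the closed ball of radius `ε`. -/
structure IsAveragingKernel (μ : Measure E) (ε : ℝ) (η : E → ℝ) : Prop where
  contDiff : ContDiff ℝ ∞ η
  nonneg : ∀ x, 0 ≤ η x
  radial : ∀ x y, ‖x‖ = ‖y‖ → η x = η y
  eq_zero : ∀ x, ε < ‖x‖ → η x = 0
  integral_eq_one : ∫ x, η x ∂μ = 1

variable {μ : Measure E} {ε : ℝ} {η : E → ℝ}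

/-- The convolution of `f` with the kernel `η`. -/
noncomputable abbrev conv (μ : Measure E) (f η : E → ℝ) : E → ℝ :=
  convolution f η (ContinuousLinearMap.mul ℝ ℝ) μ

theorem conv_apply (f η : E → ℝ) (z : E) : conv μ f η z = ∫ t, f t * η (z - t) ∂μ := by
  simp [conv, convolution_def]

theorem IsAveragingKernel.hasCompactSupport (h : IsAveragingKernel μ ε η) :
    HasCompactSupport η := by
  refine HasCompactSupport.intro (isCompact_closedBall (0 : E) ε) fun x hx => h.eq_zero x ?_
  simpa using hx

theorem IsAveragingKernel.integrable [IsFiniteMeasureOnCompacts μ] (h : IsAveragingKernel μ ε η) :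
    Integrable η μ :=
  h.contDiff.continuous.integrable_of_hasCompactSupport h.hasCompactSupport

theorem IsAveragingKernel.exists_bound (h : IsAveragingKernel μ ε η) : ∃ C, ∀ x, ‖η x‖ ≤ C :=
  h.hasCompactSupport.exists_bound_of_continuous h.contDiff.continuous

theorem IsAveragingKernel.neg (h : IsAveragingKernel μ ε η) (x : E) : η (-x) = η x :=
  h.radial _ _ (norm_neg x)

theorem exists_closedBall_add_subset {Ω : Set E} (hΩ : IsOpen Ω) {z : E} (hε : 0 ≤ ε)
    (hz : Metric.closedBall z ε ⊆ Ω) : ∃ ρ > 0, Metric.closedBall z (ε + ρ) ⊆ Ω := by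
  obtain ⟨δ, hδ, h⟩ := (isCompact_closedBall z ε).exists_cthickening_subset_open hΩ hz
  exact ⟨δ, hδ, by rwa [cthickening_closedBall hδ.le hε, add_comm] at h⟩

theorem conv_congr_of_eqOn {f g : E → ℝ} (h : IsAveragingKernel μ ε η) {z : E}
    (hfg : EqOn f g (Metric.closedBall z ε)) : conv μ f η z = conv μ g η z := by
  rw [conv_apply, conv_apply]
  refine integral_congr_ae (Eventually.of_forall fun t => ?_)
  by_cases ht : t ∈ Metric.closedBall z ε
  · simp only [hfg ht]
  · have : η (z - t) = 0 := h.eq_zero _ (by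
      rw [Metric.mem_closedBall, dist_comm, dist_eq_norm] at ht
      exact not_le.1 ht)
    simp [this]

theorem integrable_conv_integrand {f : E → ℝ} {z : E} (h : IsAveragingKernel μ ε η)
    (hf : IntegrableOn f (Metric.closedBall z ε) μ) :
    Integrable (fun t => f t * η (z - t)) μ := by
  obtain ⟨C, hC⟩ := h.exists_bound
  have h1 : Integrable ((Metric.closedBall z ε).indicator f) μ :=
    hf.integrable_indicator Metric.isClosed_closedBall.measurableSet
  have h2 : Integrable (fun t => (Metric.closedBall z ε).indicator f t * η (z - t)) μ := by
    refine h1.mul_bdd (c := C) ?_ (Eventually.of_forall fun t => hC _)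
    exact (h.contDiff.continuous.comp (by fun_prop)).aestronglyMeasurable
  refine h2.congr (Eventually.of_forall fun t => ?_)
  by_cases ht : t ∈ Metric.closedBall z ε
  · simp [ht]
  · have : η (z - t) = 0 := h.eq_zero _ (by
      rw [Metric.mem_closedBall, dist_comm, dist_eq_norm] at ht
      exact not_le.1 ht)
    simp [this]

/-- Near `z` the convolution uses only the values of `f` on a slightly larger compact ball, so `f`
may be cut off there and becomes globally integrable. -/
theorem contDiffAt_conv [IsFiniteMeasureOnCompacts μ] {f : E → ℝ} {Ω : Set E} (hΩ : IsOpen Ω)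
    (hε : 0 ≤ ε) (h : IsAveragingKernel μ ε η) (hf : LocallyIntegrableOn f Ω μ) {z : E}
    (hz : Metric.closedBall z ε ⊆ Ω) : ContDiffAt ℝ ∞ (conv μ f η) z := by
  obtain ⟨ρ, hρ, hsub⟩ := exists_closedBall_add_subset hΩ hε hz
  have h1 : Integrable ((Metric.closedBall z (ε + ρ)).indicator f) μ :=
    (hf.integrableOn_compact_subset hsub (isCompact_closedBall _ _)).integrable_indicator
      Metric.isClosed_closedBall.measurableSet
  have h2 : ContDiff ℝ ∞ (conv μ ((Metric.closedBall z (ε + ρ)).indicator f) η) :=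
    h.hasCompactSupport.contDiff_convolution_right _ h1.locallyIntegrable h.contDiff
  refine h2.contDiffAt.congr_of_eventuallyEq ?_
  filter_upwards [Metric.ball_mem_nhds z hρ] with x hx
  refine conv_congr_of_eqOn h fun t ht => ?_
  have : t ∈ Metric.closedBall z (ε + ρ) := by
    rw [Metric.mem_closedBall] at ht ⊢
    rw [Metric.mem_ball] at hx
    linarith [dist_triangle t x z]
  simp [this]

theorem conv_const [μ.IsAddHaarMeasure]
    (h : IsAveragingKernel μ ε η) (c : ℝ) (z : E) : conv μ (fun _ => c) η z = c := by
  rw [conv_apply, integral_const_mul, integral_sub_left_eq_self, h.integral_eq_one, mul_one]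

theorem conv_le_of_le_on_ball [μ.IsAddHaarMeasure] {f g : E → ℝ} {z : E}
    (h : IsAveragingKernel μ ε η)
    (hf : IntegrableOn f (Metric.closedBall z ε) μ) (hg : IntegrableOn g (Metric.closedBall z ε) μ)
    (hle : ∀ᵐ t ∂μ, t ∈ Metric.closedBall z ε → f t ≤ g t) :
    conv μ f η z ≤ conv μ g η z := by
  rw [conv_apply, conv_apply]
  refine integral_mono_ae (integrable_conv_integrand h hf) (integrable_conv_integrand h hg) ?_
  filter_upwards [hle] with t ht
  by_cases hmem : t ∈ Metric.closedBall z ε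
  · exact mul_le_mul_of_nonneg_right (ht hmem) (h.nonneg _)
  · have : η (z - t) = 0 := h.eq_zero _ (by
      rw [Metric.mem_closedBall, dist_comm, dist_eq_norm] at hmem
      exact not_le.1 hmem)
    simp [this]

end Kernels

/-! ### Local integrability of subharmonic functions. -/

section Subharmonic

variable {E : Type*} [NormedAddCommGroup E] [InnerProductSpace ℝ E] [FiniteDimensional ℝ E]
  [MeasurableSpace E] [BorelSpace E] [Nontrivial E] {μ : Measure E} [μ.IsAddHaarMeasure]
  {ι : Type*} [Fintype ι] [Nonempty ι] (b : OrthonormalBasis ι ℝ E)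

theorem exists_bound_on_compact {X : Type*} [TopologicalSpace X] {u : X → EReal} {K : Set X}
    (hK : IsCompact K) (hu : UpperSemicontinuousOn u K) (htop : ∀ x ∈ K, u x ≠ ⊤) :
    ∃ M : ℝ, ∀ x ∈ K, u x ≤ M := by
  rcases K.eq_empty_or_nonempty with rfl | hne
  · exact ⟨0, by simp⟩
  obtain ⟨x, hx, hmax⟩ := hu.exists_isMaxOn hne hK
  refine ⟨(u x).toReal, fun y hy => (hmax hy : u y ≤ u x).trans ?_⟩
  exact EReal.le_coe_toReal (htop x hx)

theorem toSphere_eq_smul_sphereProb :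
    μ.toSphere = μ.toSphere univ • sphereProb μ := by
  rw [sphereProb, smul_smul, ENNReal.mul_inv_cancel
    (Measure.measure_univ_ne_zero.2 μ.toSphere_ne_zero) (measure_ne_top _ _), one_smul]

/-- In polar coordinates this is the spherical sub-mean value inequality, integrated over the radii
up to `R` against the profile `κ`. -/
theorem lintegral_gap_mul_radial_le {u : E → EReal} (hmeas : Measurable u) {Ω : Set E}
    (husc : UpperSemicontinuousOn u Ω) (htop : ∀ x ∈ Ω, u x ≠ ⊤)
    (hvisc : ∀ x ∈ Ω, ∀ q, TouchesAbove u x q → 0 ≤ secondOrderOp b q x)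
    {z : E} {R : ℝ} (hz : Metric.closedBall z R ⊆ Ω) {M : ℝ}
    (hM : ∀ x ∈ Metric.closedBall z R, u x ≤ M) {κ : ℝ → ENNReal} (hκ : Measurable κ)
    (hκR : ∀ r, R < r → κ r = 0) :
    ∫⁻ x, gap M (u (z + x)) * κ ‖x‖ ∂μ ≤ gap M (u z) * ∫⁻ x, κ ‖x‖ ∂μ := by
  have hgm : Measurable fun x => gap M (u (z + x)) :=
    (continuous_gap M).measurable.comp (hmeas.comp (by fun_prop))
  rw [lintegral_polar μ (F := fun x => gap M (u (z + x)) * κ ‖x‖)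
      (hgm.mul (hκ.comp measurable_norm)),
    lintegral_polar μ (F := fun x : E => κ ‖x‖) (hκ.comp measurable_norm)]
  have hnorm : ∀ (r : Ioi (0 : ℝ)) (y : Metric.sphere (0 : E) 1), ‖(r : ℝ) • (y : E)‖ = r := by
    intro r y
    rw [norm_smul, norm_eq_of_mem_sphere, mul_one, Real.norm_of_nonneg r.2.le]
  simp only [hnorm, lintegral_const]
  rw [← lintegral_const_mul _ (f := fun r : Ioi (0 : ℝ) => κ r * μ.toSphere univ) ((hκ.comp measurable_subtype_coe).mul_const _)]
  refine lintegral_mono fun r => ?_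
  have hgr : Measurable fun y : Metric.sphere (0 : E) 1 => gap M (u (z + (r : ℝ) • (y : E))) :=
    hgm.comp (by fun_prop)
  rw [lintegral_mul_const _ hgr]
  by_cases hr : R < r
  · simp [hκR _ hr]
  · rw [not_lt] at hr
    have hball : ∀ x ∈ Metric.closedBall (0 : E) 1, z + (r : ℝ) • x ∈ Metric.closedBall z R := by
      intro x hx
      rw [mem_closedBall_zero_iff] at hx
      rw [mem_closedBall_iff_norm, add_sub_cancel_left, norm_smul, Real.norm_of_nonneg r.2.le]
      exact (mul_le_of_le_one_right r.2.le hx).trans hr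
    have h1 := sphere_submean μ b husc htop (ContinuousLinearEquiv.refl ℝ E) (z := z) r.2
      (fun x hx => hz (hball x hx)) (g₀ := 0)
      (fun x hx q hq => hvisc _ (hz (hball x (Metric.ball_subset_closedBall hx))) q hq)
      (M := M) (fun x hx => hM _ (hball x (Metric.sphere_subset_closedBall hx)))
    simp only [ContinuousLinearEquiv.refl_apply, mul_zero, zero_div, sub_zero] at h1
    have h2 : ∫⁻ y : Metric.sphere (0 : E) 1, gap M (u (z + (r : ℝ) • (y : E))) ∂μ.toSphere =
        μ.toSphere univ *
          ∫⁻ y : Metric.sphere (0 : E) 1, gap M (u (z + (r : ℝ) • (y : E))) ∂sphereProb μ := by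
      conv_lhs => rw [toSphere_eq_smul_sphereProb (μ := μ), lintegral_smul_measure, smul_eq_mul]
    rw [h2]
    calc _ ≤ μ.toSphere univ * gap M (u z) * κ r := by gcongr
      _ = gap M (u z) * (κ r * μ.toSphere univ) := by ring

theorem exists_local_bound {u : E → EReal} {Ω : Set E} (hΩ : IsOpen Ω)
    (husc : UpperSemicontinuousOn u Ω) (htop : ∀ x ∈ Ω, u x ≠ ⊤) {z : E} (hz : z ∈ Ω) :
    ∃ R > 0, ∃ M : ℝ, Metric.closedBall z R ⊆ Ω ∧ ∀ x ∈ Metric.closedBall z R, u x ≤ M := by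
  obtain ⟨R, hR, hsub⟩ := Metric.nhds_basis_closedBall.mem_iff.1 (hΩ.mem_nhds hz)
  obtain ⟨M, hM⟩ := exists_bound_on_compact (isCompact_closedBall z R) (husc.mono hsub)
    fun x hx => htop x (hsub hx)
  exact ⟨R, hR, M, hsub, hM⟩

theorem setLIntegral_gap_lt_top {u : E → EReal} (hmeas : Measurable u) {Ω : Set E}
    (husc : UpperSemicontinuousOn u Ω) (htop : ∀ x ∈ Ω, u x ≠ ⊤)
    (hvisc : ∀ x ∈ Ω, ∀ q, TouchesAbove u x q → 0 ≤ secondOrderOp b q x)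
    {z : E} {R : ℝ} (hz : Metric.closedBall z R ⊆ Ω) {M : ℝ}
    (hM : ∀ x ∈ Metric.closedBall z R, u x ≤ M) (hbot : u z ≠ ⊥) :
    ∫⁻ x in Metric.closedBall z R, gap M (u x) ∂μ < ⊤ := by
  have h1 := lintegral_gap_mul_radial_le (μ := μ) b hmeas husc htop hvisc hz hM
    (κ := (Iic R).indicator 1) (measurable_one.indicator measurableSet_Iic)
    (fun r hr => by simp [hr])
  have h2 : ∫⁻ x in Metric.closedBall z R, gap M (u x) ∂μ =
      ∫⁻ x, gap M (u (z + x)) * (Iic R).indicator 1 ‖x‖ ∂μ := by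
    rw [← lintegral_indicator Metric.isClosed_closedBall.measurableSet,
      ← lintegral_add_left_eq_self _ z]
    refine lintegral_congr fun x => ?_
    by_cases hx : ‖x‖ ≤ R
    · rw [indicator_of_mem (by simpa [mem_closedBall_iff_norm] using hx),
        indicator_of_mem (by simpa using hx), Pi.one_apply, mul_one]
    · rw [indicator_of_notMem (by simpa [mem_closedBall_iff_norm] using hx),
        indicator_of_notMem (by simpa using hx), mul_zero]
  have h3 : ∫⁻ x : E, (Iic R).indicator 1 ‖x‖ ∂μ = μ (Metric.closedBall 0 R) := by
    rw [← lintegral_indicator_one Metric.isClosed_closedBall.measurableSet]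
    refine lintegral_congr fun x => ?_
    by_cases hx : ‖x‖ ≤ R
    · rw [indicator_of_mem (by simpa using hx), indicator_of_mem (by simpa using hx),
        Pi.one_apply, Pi.one_apply]
    · rw [indicator_of_notMem (by simpa using hx), indicator_of_notMem (by simpa using hx)]
  rw [h2]
  refine h1.trans_lt ?_
  rw [h3]
  refine ENNReal.mul_lt_top ?_ measure_closedBall_lt_top
  rw [lt_top_iff_ne_top]
  exact fun h => hbot (gap_eq_top_iff.1 h)

/-- A subharmonic function on a connected open set is locally `gap`-integrable. -/
theorem exists_setLIntegral_gap_lt_top {u : E → EReal} (hmeas : Measurable u) {Ω : Set E}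
    (hΩ : IsOpen Ω) (hconn : IsPreconnected Ω)
    (husc : UpperSemicontinuousOn u Ω) (htop : ∀ x ∈ Ω, u x ≠ ⊤)
    (hne : ∃ x ∈ Ω, u x ≠ ⊥)
    (hvisc : ∀ x ∈ Ω, ∀ q, TouchesAbove u x q → 0 ≤ secondOrderOp b q x) {z : E} (hz : z ∈ Ω) :
    ∃ r > 0, ∃ M : ℝ, (∀ x ∈ Metric.ball z r, u x ≤ M) ∧
      ∫⁻ x in Metric.ball z r, gap M (u x) ∂μ < ⊤ := by
  let G : Set E := {z | ∃ r > 0, ∃ M : ℝ, (∀ x ∈ Metric.ball z r, u x ≤ M) ∧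
      ∫⁻ x in Metric.ball z r, gap M (u x) ∂μ < ⊤}
  have hGopen : IsOpen G := by
    rw [Metric.isOpen_iff]
    rintro z ⟨r, hr, M, hM, hint⟩
    refine ⟨r / 2, half_pos hr, fun y hy => ?_⟩
    have hsub : Metric.ball y (r / 2) ⊆ Metric.ball z r :=
      Metric.ball_subset_ball' (by rw [Metric.mem_ball] at hy; linarith)
    exact ⟨r / 2, half_pos hr, M, fun x hx => hM x (hsub hx),
      (lintegral_mono_set hsub).trans_lt hint⟩
  -- If `y` is within `R/3` of `z`, the ball of radius `2R/3` about `y` contains the ball of radius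
  -- `R/3` about `z` and lies in the ball of radius `R`. One finite value near `z` therefore
  -- suffices.
  have hnear : ∀ z ∈ Ω, ∃ R > 0, ∀ y ∈ Metric.ball z R, u y ≠ ⊥ → z ∈ G := by
    intro z hz
    obtain ⟨R, hR, M, hsub, hM⟩ := exists_local_bound hΩ husc htop hz
    refine ⟨R / 3, by positivity, fun y hy hbot => ?_⟩
    rw [Metric.mem_ball] at hy
    have h1 : Metric.closedBall y (2 * R / 3) ⊆ Metric.closedBall z R :=
      Metric.closedBall_subset_closedBall' (by linarith)
    have h2 : Metric.ball z (R / 3) ⊆ Metric.closedBall y (2 * R / 3) := by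
      intro x hx
      rw [Metric.mem_ball] at hx
      rw [Metric.mem_closedBall]
      linarith [dist_triangle_right x y z]
    exact ⟨R / 3, by positivity, M, fun x hx => hM x (h1 (h2 hx)),
      (lintegral_mono_set h2).trans_lt (setLIntegral_gap_lt_top b hmeas husc htop hvisc
        (h1.trans hsub) (fun x hx => hM x (h1 hx)) hbot)⟩
  refine hconn.subset_of_closure_inter_subset hGopen ?_ ?_ hz
  · obtain ⟨x, hx, hbot⟩ := hne
    obtain ⟨R, hR, h⟩ := hnear x hx
    exact ⟨x, hx, h x (Metric.mem_ball_self hR) hbot⟩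
  -- `G` is relatively closed: near a limit point there is a ball on which `u` is finite almost
  -- everywhere, and it meets every neighbourhood reached by `hnear` in positive measure.
  · rintro x ⟨hxc, hx⟩
    obtain ⟨R, hR, h⟩ := hnear x hx
    obtain ⟨y, hyG, hxy⟩ := Metric.mem_closure_iff.1 hxc R hR
    obtain ⟨r, hr, M, hM, hint⟩ := hyG
    have hae := ae_lt_top ((continuous_gap M).measurable.comp hmeas) hint.ne
    have hopen : IsOpen (Metric.ball y r ∩ Metric.ball x R) :=
      Metric.isOpen_ball.inter Metric.isOpen_ball
    have hpos : μ (Metric.ball y r ∩ Metric.ball x R) ≠ 0 :=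
      (hopen.measure_pos μ ⟨y, Metric.mem_ball_self hr, by
        rw [Metric.mem_ball, dist_comm]; exact hxy⟩).ne'
    rw [ae_restrict_iff' Metric.isOpen_ball.measurableSet] at hae
    obtain ⟨t, ht, ht'⟩ := (hae.and_frequently (frequently_ae_mem_iff.2 hpos)).exists
    exact h t ht'.2 fun hb => (ht ht'.1).ne (by simp [hb, gap_bot])

theorem ae_ne_bot_and_locallyIntegrableOn {u : E → EReal} (hmeas : Measurable u) {Ω : Set E}
    (hΩ : IsOpen Ω) (hconn : IsPreconnected Ω)
    (husc : UpperSemicontinuousOn u Ω) (htop : ∀ x ∈ Ω, u x ≠ ⊤)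
    (hne : ∃ x ∈ Ω, u x ≠ ⊥)
    (hvisc : ∀ x ∈ Ω, ∀ q, TouchesAbove u x q → 0 ≤ secondOrderOp b q x) :
    (∀ᵐ x ∂μ, x ∈ Ω → u x ≠ ⊥) ∧ LocallyIntegrableOn (fun x => (u x).toReal) Ω μ := by
  have hloc := fun z (hz : z ∈ Ω) => exists_setLIntegral_gap_lt_top (μ := μ) b hmeas hΩ hconn
    husc htop hne hvisc hz
  have hae : ∀ {z : E} {r M : ℝ}, ∫⁻ x in Metric.ball z r, gap M (u x) ∂μ < ⊤ →
      ∀ᵐ x ∂μ.restrict (Metric.ball z r), u x ≠ ⊥ := by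
    intro z r M hint
    filter_upwards [ae_lt_top ((continuous_gap M).measurable.comp hmeas) hint.ne] with x hx hb
    exact hx.ne (by simp [hb, gap_bot])
  refine ⟨?_, fun z hz => ?_⟩
  · have h0 : μ {x | x ∈ Ω ∧ u x = ⊥} = 0 := by
      refine measure_null_of_locally_null _ fun z hz => ?_
      obtain ⟨r, hr, M, hM, hint⟩ := hloc z hz.1
      refine ⟨{x | x ∈ Ω ∧ u x = ⊥} ∩ Metric.ball z r,
        inter_mem self_mem_nhdsWithin (mem_nhdsWithin_of_mem_nhds (Metric.ball_mem_nhds z hr)), ?_⟩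
      have := hae hint
      rw [ae_restrict_iff' Metric.isOpen_ball.measurableSet, ae_iff] at this
      refine measure_mono_null ?_ this
      rintro x ⟨⟨hx1, hx2⟩, hx3⟩
      simp [hx2, Metric.mem_ball.1 hx3]
    rw [ae_iff]
    refine measure_mono_null ?_ h0
    intro x hx
    simpa using hx
  · obtain ⟨r, hr, M, hM, hint⟩ := hloc z hz
    obtain ⟨r', hr', hsub⟩ := Metric.isOpen_iff.1 hΩ z hz
    set ρ := min r r'
    have hρ : 0 < ρ := lt_min hr hr'
    have hb1 : Metric.ball z ρ ⊆ Metric.ball z r := Metric.ball_subset_ball (min_le_left _ _)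
    have hb2 : Metric.ball z ρ ⊆ Ω :=
      (Metric.ball_subset_ball (min_le_right _ _)).trans hsub
    have hint' : ∫⁻ x in Metric.ball z ρ, gap M (u x) ∂μ < ⊤ :=
      (lintegral_mono_set hb1).trans_lt hint
    refine ⟨Metric.ball z ρ, mem_nhdsWithin_of_mem_nhds (Metric.ball_mem_nhds z hρ),
      hmeas.ereal_toReal.aestronglyMeasurable, ?_⟩
    -- As `u ≤ M`, the absolute value of `u` is at most `(M - u) + |M|`.
    have hle : ∫⁻ x in Metric.ball z ρ, ‖(u x).toReal‖ₑ ∂μ ≤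
        ∫⁻ x in Metric.ball z ρ, (gap M (u x) + ENNReal.ofReal |M|) ∂μ := by
      refine lintegral_mono_ae ?_
      filter_upwards [hae hint', ae_restrict_mem Metric.isOpen_ball.measurableSet] with x hx hxb
      rw [gap_eq_ofReal hx (htop x (hb2 hxb)), ← ofReal_norm,
        ← ENNReal.ofReal_add _ (abs_nonneg M)]
      · refine ENNReal.ofReal_le_ofReal ?_
        have h1 := hM x (hb1 hxb)
        rw [← EReal.coe_toReal (htop x (hb2 hxb)) hx, EReal.coe_le_coe_iff] at h1
        rw [Real.norm_eq_abs, abs_le]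
        constructor <;> cases abs_cases M <;> linarith
      · have h1 := hM x (hb1 hxb)
        rw [← EReal.coe_toReal (htop x (hb2 hxb)) hx, EReal.coe_le_coe_iff] at h1
        linarith
    refine hle.trans_lt ?_
    rw [lintegral_add_right _ measurable_const, lintegral_const]
    refine ENNReal.add_lt_top.2 ⟨hint', ENNReal.mul_lt_top ENNReal.ofReal_lt_top ?_⟩
    rw [Measure.restrict_apply_univ]
    exact measure_ball_lt_top

end Subharmonic

/-! ### Convolution of viscosity subsolutions of linear equations. -/

section Convolution

variable {E : Type*} [NormedAddCommGroup E] [InnerProductSpace ℝ E] [FiniteDimensional ℝ E]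
  [MeasurableSpace E] [BorelSpace E] [Nontrivial E] {μ : Measure E} [μ.IsAddHaarMeasure]
  {ι : Type*} [Fintype ι] [Nonempty ι] (b : OrthonormalBasis ι ℝ E)
  {u : E → EReal} {Ω : Set E}

theorem IsAveragingKernel.eq_zero_of_notMem {ε : ℝ} {η : E → ℝ} (h : IsAveragingKernel μ ε η)
    {z t : E} (ht : t ∉ Metric.closedBall z ε) : η (z - t) = 0 :=
  h.eq_zero _ (by
    rw [Metric.mem_closedBall, dist_comm, dist_eq_norm] at ht
    exact not_le.1 ht)

/-- The mass of `gap M u` against an averaging kernel is `M` minus the convolution of `u`. -/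
theorem lintegral_gap_mul_kernel (htop : ∀ x ∈ Ω, u x ≠ ⊤)
    (hae : ∀ᵐ x ∂μ, x ∈ Ω → u x ≠ ⊥)
    (hloc : LocallyIntegrableOn (fun x => (u x).toReal) Ω μ) {ε : ℝ} {η : E → ℝ}
    (h : IsAveragingKernel μ ε η) {z : E} (hz : Metric.closedBall z ε ⊆ Ω) {M : ℝ}
    (hM : ∀ x ∈ Metric.closedBall z ε, u x ≤ M) :
    ∫⁻ t, gap M (u t) * ENNReal.ofReal (η (z - t)) ∂μ =
      ENNReal.ofReal (M - conv μ (fun x => (u x).toReal) η z) ∧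
    conv μ (fun x => (u x).toReal) η z ≤ M := by
  have hint : IntegrableOn (fun x => (u x).toReal) (Metric.closedBall z ε) μ :=
    hloc.integrableOn_compact_subset hz (isCompact_closedBall _ _)
  have hintM : IntegrableOn (fun _ : E => M) (Metric.closedBall z ε) μ :=
    integrableOn_const measure_closedBall_lt_top.ne
  have hleM : ∀ᵐ t ∂μ, t ∈ Metric.closedBall z ε → (u t).toReal ≤ M := by
    filter_upwards [hae] with t ht hmem
    have := hM t hmem
    rwa [← EReal.coe_toReal (htop t (hz hmem)) (ht (hz hmem)), EReal.coe_le_coe_iff] at this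
  refine ⟨?_, ?_⟩
  · have h1 : M - conv μ (fun x => (u x).toReal) η z =
        ∫ t, (M * η (z - t) - (u t).toReal * η (z - t)) ∂μ := by
      rw [integral_sub (integrable_conv_integrand h hintM) (integrable_conv_integrand h hint),
        ← conv_apply, ← conv_apply, conv_const h]
    rw [h1, ofReal_integral_eq_lintegral_ofReal
      (f := fun t => M * η (z - t) - (u t).toReal * η (z - t))
      ((integrable_conv_integrand h hintM).sub (integrable_conv_integrand h hint))]
    · refine lintegral_congr_ae ?_
      filter_upwards [hae, hleM] with t ht htM
      by_cases hmem : t ∈ Metric.closedBall z ε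
      · rw [gap_eq_ofReal (ht (hz hmem)) (htop t (hz hmem)), ← sub_mul,
          ENNReal.ofReal_mul (sub_nonneg.2 (htM hmem))]
      · simp [h.eq_zero_of_notMem hmem]
    · filter_upwards [hleM] with t htM
      by_cases hmem : t ∈ Metric.closedBall z ε
      · have := mul_nonneg (sub_nonneg.2 (htM hmem)) (h.nonneg (z - t))
        simp only [Pi.zero_apply]
        linarith
      · simp [h.eq_zero_of_notMem hmem]
  · rw [← conv_const h M z]
    exact conv_le_of_le_on_ball h hint hintM hleM

/-- The kernel is radial with mass one, so this is the radial sub-mean value inequality with the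
profile of `η` along a unit vector. -/
theorem le_conv (hmeas : Measurable u) (husc : UpperSemicontinuousOn u Ω)
    (htop : ∀ x ∈ Ω, u x ≠ ⊤) (hae : ∀ᵐ x ∂μ, x ∈ Ω → u x ≠ ⊥)
    (hloc : LocallyIntegrableOn (fun x => (u x).toReal) Ω μ)
    (hvisc : ∀ x ∈ Ω, ∀ q, TouchesAbove u x q → 0 ≤ secondOrderOp b q x) {ε : ℝ} {η : E → ℝ}
    (hε : 0 ≤ ε) (h : IsAveragingKernel μ ε η) {z : E} (hz : Metric.closedBall z ε ⊆ Ω) :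
    u z ≤ ((conv μ (fun x => (u x).toReal) η z : ℝ) : EReal) := by
  obtain ⟨M, hM⟩ := exists_bound_on_compact (isCompact_closedBall z ε) (husc.mono hz)
    fun x hx => htop x (hz hx)
  by_cases hbot : u z = ⊥
  · rw [hbot]; exact bot_le
  have hzΩ := hz (Metric.mem_closedBall_self hε)
  obtain ⟨e, he⟩ := exists_norm_eq E (c := 1) zero_le_one
  have hrad : ∀ x : E, η (‖x‖ • e) = η x := fun x =>
    h.radial _ _ (by rw [norm_smul, he, mul_one, norm_norm])
  have h1 := lintegral_gap_mul_radial_le (μ := μ) b hmeas husc htop hvisc hz hM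
    (κ := fun r => ENNReal.ofReal (η ((max r 0) • e)))
    (h.contDiff.continuous.comp (by fun_prop)).measurable.ennreal_ofReal
    (fun r hr => by
      have hr0 : 0 ≤ r := hε.trans hr.le
      rw [h.eq_zero _ (by rw [norm_smul, he, mul_one, Real.norm_eq_abs, max_eq_left hr0,
        abs_of_nonneg hr0]; exact hr), ENNReal.ofReal_zero])
  simp only [max_eq_left (norm_nonneg _), hrad] at h1
  rw [← ofReal_integral_eq_lintegral_ofReal h.integrable (Eventually.of_forall h.nonneg),
    h.integral_eq_one, ENNReal.ofReal_one, mul_one] at h1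
  obtain ⟨h2, h3⟩ := lintegral_gap_mul_kernel htop hae hloc h hz hM
  have h4 : ∫⁻ x, gap M (u (z + x)) * ENNReal.ofReal (η x) ∂μ =
      ∫⁻ t, gap M (u t) * ENNReal.ofReal (η (z - t)) ∂μ := by
    rw [← lintegral_add_left_eq_self (fun t => gap M (u t) * ENNReal.ofReal (η (z - t))) z]
    refine lintegral_congr fun x => ?_
    rw [show z - (z + x) = -x by abel, h.neg]
  rw [h4, h2, gap_eq_ofReal hbot (htop z hzΩ)] at h1
  have h5 := hM z (Metric.mem_closedBall_self hε)
  rw [← EReal.coe_toReal (htop z hzΩ) hbot, EReal.coe_le_coe_iff] at h5 ⊢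
  have := (ENNReal.ofReal_le_ofReal_iff (sub_nonneg.2 h5)).1 h1
  linarith

/-- Convolutions with small kernels eventually lie below any continuous strict majorant. -/
theorem exists_conv_lt_on_compact (hΩ : IsOpen Ω) (husc : UpperSemicontinuousOn u Ω)
    (htop : ∀ x ∈ Ω, u x ≠ ⊤) (hae : ∀ᵐ x ∂μ, x ∈ Ω → u x ≠ ⊥)
    (hloc : LocallyIntegrableOn (fun x => (u x).toReal) Ω μ) {K : Set E} (hK : IsCompact K)
    (hKΩ : K ⊆ Ω) {φ : E → ℝ} (hφ : ContinuousOn φ K) (hlt : ∀ z ∈ K, u z < φ z) :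
    ∃ ε₀ > 0, ∀ ε, 0 ≤ ε → ε < ε₀ → ∀ η : E → ℝ, IsAveragingKernel μ ε η → ∀ z ∈ K,
      conv μ (fun x => (u x).toReal) η z < φ z := by
  have hpt : ∀ z ∈ K, ∃ ρ > 0, ∀ ε, 0 ≤ ε → ε < ρ → ∀ η : E → ℝ, IsAveragingKernel μ ε η →
      ∀ z' ∈ K ∩ Metric.ball z ρ, conv μ (fun x => (u x).toReal) η z' < φ z' := by
    intro z hz
    -- A constant `a` separates `u` from `φ` near `z`, and averages of values below `a` stay at most
    -- `a`. The radius does not depend on the kernel, and compactness makes it uniform.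
    obtain ⟨a, ha1, ha2⟩ := EReal.lt_iff_exists_real_btwn.1 (hlt z hz)
    rw [EReal.coe_lt_coe_iff] at ha2
    have h1 : ∀ᶠ x in 𝓝 z, u x < a := by
      have := husc z (hKΩ hz) a ha1
      rwa [hΩ.nhdsWithin_eq (hKΩ hz)] at this
    have h2 : ∀ᶠ x in 𝓝 z, x ∈ K → a < φ x :=
      eventually_nhdsWithin_iff.1 ((hφ z hz).eventually (lt_mem_nhds ha2))
    obtain ⟨ρ, hρ, hball⟩ := Metric.eventually_nhds_iff_ball.1
      ((h1.and h2).and (hΩ.mem_nhds (hKΩ hz)))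
    refine ⟨ρ / 2, half_pos hρ, fun ε hε hερ η h z' hz' => ?_⟩
    have hsub : Metric.closedBall z' ε ⊆ Metric.ball z ρ := by
      intro x hx
      have := hz'.2
      rw [Metric.mem_ball] at this ⊢
      rw [Metric.mem_closedBall] at hx
      linarith [dist_triangle x z' z]
    have hsubΩ : Metric.closedBall z' ε ⊆ Ω := fun x hx => (hball x (hsub hx)).2
    have h3 := (lintegral_gap_mul_kernel htop hae hloc h hsubΩ
      (M := a) fun x hx => (hball x (hsub hx)).1.1.le).2
    exact h3.trans_lt ((hball z' (hsub (Metric.mem_closedBall_self hε))).1.2 hz'.1)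
  choose! ρ hρ hρ' using hpt
  obtain ⟨s, hs, hcov⟩ := hK.elim_nhds_subcover (fun z => Metric.ball z (ρ z))
    fun z hz => Metric.ball_mem_nhds z (hρ z hz)
  have hfin : ∃ ε₀ > 0, ∀ z ∈ s, ε₀ ≤ ρ z := by
    rcases s.eq_empty_or_nonempty with rfl | hne
    · exact ⟨1, one_pos, by simp⟩
    · obtain ⟨z₀, hz₀, hmin⟩ := s.exists_min_image ρ hne
      exact ⟨ρ z₀, hρ z₀ (hs z₀ hz₀), hmin⟩
  obtain ⟨ε₀, hε₀, hle⟩ := hfin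
  refine ⟨ε₀, hε₀, fun ε hε hlt η h z hz => ?_⟩
  obtain ⟨x, hx, hzx⟩ := mem_iUnion₂.1 (hcov hz)
  exact hρ' x (hs x hx) ε hε (hlt.trans_le (hle x hx)) η h z ⟨hz, hzx⟩

/-- The integrated sub-mean value inequality for convolutions. -/
theorem conv_add_le_integral_sphere (hmeas : Measurable u) (hΩ : IsOpen Ω)
    (husc : UpperSemicontinuousOn u Ω)
    (htop : ∀ x ∈ Ω, u x ≠ ⊤) (hae : ∀ᵐ x ∂μ, x ∈ Ω → u x ≠ ⊥)
    (hloc : LocallyIntegrableOn (fun x => (u x).toReal) Ω μ) (T : E ≃L[ℝ] E) {g : E → ℝ}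
    (hg : ContinuousOn g Ω)
    (hvisc : ∀ x ∈ Ω, ∀ q, TouchesAbove u x q → g x ≤ secondOrderOp (fun k => T (b k)) q x)
    {ε : ℝ} {η : E → ℝ} (hε : 0 ≤ ε) (h : IsAveragingKernel μ ε η) {z : E}
    (hz : Metric.closedBall z ε ⊆ Ω) {δ : ℝ} (hδ : 0 < δ) :
    ∃ r₀ > 0, ∀ r, 0 < r → r < r₀ →
      conv μ (fun x => (u x).toReal) η z +
        r ^ 2 * (conv μ g η z - δ) / (2 * Fintype.card ι) ≤
      ∫ y : Metric.sphere (0 : E) 1,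
        conv μ (fun x => (u x).toReal) η (z + r • T y) ∂sphereProb μ := by
  have hN : (1 : ℝ) ≤ Fintype.card ι := by exact_mod_cast Fintype.card_pos
  obtain ⟨ρ, hρ, hKΩ⟩ := exists_closedBall_add_subset hΩ hε hz
  set K := Metric.closedBall z (ε + ρ) with hKdef
  have hK : IsCompact K := isCompact_closedBall _ _
  obtain ⟨ρ', hρ', hunif⟩ := Metric.uniformContinuousOn_iff.1
    (hK.uniformContinuousOn_of_continuous (hg.mono hKΩ)) δ hδ
  obtain ⟨G, hG⟩ := hK.exists_bound_of_continuousOn (hg.mono hKΩ)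
  obtain ⟨M₀, hM₀⟩ := exists_bound_on_compact hK (husc.mono hKΩ) fun x hx => htop x (hKΩ hx)
  have hG0 : 0 ≤ G := (norm_nonneg _).trans (hG z (Metric.mem_closedBall_self (by positivity)))
  set C := ‖(T : E →L[ℝ] E)‖ + 1 with hC
  have hCpos : 0 < C := by positivity
  refine ⟨min 1 (min ρ ρ' / C), by positivity, fun r hr hrr => ?_⟩
  have hr1 : r < 1 := hrr.trans_le (min_le_left _ _)
  have hrC : r * C < min ρ ρ' := (lt_div_iff₀ hCpos).1 (hrr.trans_le (min_le_right _ _))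
  have hTx : ∀ x ∈ Metric.closedBall (0 : E) 1, ‖r • T x‖ < min ρ ρ' := by
    intro x hx
    rw [mem_closedBall_zero_iff] at hx
    refine lt_of_le_of_lt ?_ hrC
    rw [norm_smul, Real.norm_of_nonneg hr.le]
    gcongr
    calc ‖T x‖ ≤ ‖(T : E →L[ℝ] E)‖ * ‖x‖ := (T : E →L[ℝ] E).le_opNorm x
      _ ≤ ‖(T : E →L[ℝ] E)‖ * 1 := by gcongr
      _ ≤ C := by rw [hC]; linarith
  have hεK : Metric.closedBall z ε ⊆ K := Metric.closedBall_subset_closedBall (by linarith)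
  have hsK : ∀ s ∈ Metric.closedBall z ε, ∀ x ∈ Metric.closedBall (0 : E) 1, s + r • T x ∈ K := by
    intro s hs x hx
    have h1 := (hTx x hx).trans_le (min_le_left _ _)
    rw [Metric.mem_closedBall] at hs
    rw [hKdef, Metric.mem_closedBall]
    have h2 : dist (s + r • T x) s = ‖r • T x‖ := by rw [dist_eq_norm, add_sub_cancel_left]
    linarith [dist_triangle (s + r • T x) s z]
  -- The summand `G` absorbs `κ (g s - δ)`, as `κ ≤ 1`. This keeps `F` nonnegative, so that extended
  -- integrals can be compared.
  set M := M₀ + G with hMdef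
  set κ : ℝ := r ^ 2 / (2 * Fintype.card ι) with hκ
  have hκ0 : 0 ≤ κ := by positivity
  have hκ1 : κ ≤ 1 := by
    rw [hκ, div_le_one (by positivity)]
    nlinarith
  set w := conv μ (fun x => (u x).toReal) η with hw
  let F : E → ℝ := fun s => M - κ * (g s - δ) - (u s).toReal
  -- By uniform continuity `g` exceeds the constant `g s - δ` on the small ellipsoid about `s`, so
  -- the sub-mean value inequality applies with that constant.
  have hA : ∀ s ∈ Metric.closedBall z ε, ∫⁻ y : Metric.sphere (0 : E) 1,
      gap M (u (s + r • T y)) ∂sphereProb μ ≤ gap (M - κ * (g s - δ)) (u s) := by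
    intro s hs
    have := sphere_submean μ b husc htop T (z := s) hr (fun x hx => hKΩ (hsK s hs x hx))
      (g₀ := g s - δ) (fun x hx q hq => ?_) (M := M) (fun x hx => ?_)
    · rwa [mul_div_right_comm] at this
    · have hxc := Metric.ball_subset_closedBall hx
      have h1 := hvisc _ (hKΩ (hsK s hs x hxc)) q hq
      have h2 := hunif (s + r • T x) (hsK s hs x hxc) s (hεK hs) (by
        rw [dist_eq_norm, add_sub_cancel_left]
        exact (hTx x hxc).trans_le (min_le_right _ _))
      rw [Real.dist_eq, abs_lt] at h2
      linarith
    · refine (hM₀ _ (hsK s hs x (Metric.sphere_subset_closedBall hx))).trans ?_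
      rw [EReal.coe_le_coe_iff]
      linarith
  have hF0 : ∀ᵐ s ∂μ, s ∈ Metric.closedBall z ε → 0 ≤ F s := by
    filter_upwards [hae] with s hs hmem
    have h1 := hM₀ s (hεK hmem)
    rw [← EReal.coe_toReal (htop s (hz hmem)) (hs (hz hmem)), EReal.coe_le_coe_iff] at h1
    have h2 := (abs_le.1 (hG s (hεK hmem))).2
    have h3 : κ * (g s - δ) ≤ G := by
      calc κ * (g s - δ) ≤ κ * G := by gcongr; linarith
        _ ≤ 1 * G := by gcongr
        _ = G := one_mul G
    simp only [F]
    linarith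
  have hu_int : IntegrableOn (fun x => (u x).toReal) (Metric.closedBall z ε) μ :=
    hloc.integrableOn_compact_subset hz (isCompact_closedBall _ _)
  have hg_int : IntegrableOn g (Metric.closedBall z ε) μ :=
    (hg.mono hz).integrableOn_compact (isCompact_closedBall _ _)
  have hc_int : ∀ c : ℝ, IntegrableOn (fun _ : E => c) (Metric.closedBall z ε) μ := fun c =>
    integrableOn_const measure_closedBall_lt_top.ne
  have hF_int : Integrable (fun s => F s * η (z - s)) μ :=
    integrable_conv_integrand h (((hc_int M).sub ((hg_int.sub (hc_int δ)).const_mul κ)).sub hu_int)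
  have hFη0 : ∀ᵐ s ∂μ, 0 ≤ F s * η (z - s) := by
    filter_upwards [hF0] with s hs
    by_cases hmem : s ∈ Metric.closedBall z ε
    · exact mul_nonneg (hs hmem) (h.nonneg _)
    · simp [h.eq_zero_of_notMem hmem]
  have hFval : ∫ s, F s * η (z - s) ∂μ = M - κ * (conv μ g η z - δ) - w z := by
    have e : (fun s => F s * η (z - s)) = fun s =>
        ((M + κ * δ) * η (z - s) - κ * (g s * η (z - s))) - (u s).toReal * η (z - s) := by
      ext s; simp only [F]; ring
    have i1 := integrable_conv_integrand h (hc_int (M + κ * δ))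
    have i2 := (integrable_conv_integrand h hg_int).const_mul κ
    have i3 : Integrable (fun s => (M + κ * δ) * η (z - s) - κ * (g s * η (z - s))) μ := i1.sub i2
    rw [e, integral_sub i3 (integrable_conv_integrand h hu_int), integral_sub i1 i2,
      integral_const_mul κ, ← conv_apply, ← conv_apply, ← conv_apply,
      conv_const h]
    ring
  have hupper : ∫⁻ s, (∫⁻ y : Metric.sphere (0 : E) 1, gap M (u (s + r • T y)) ∂sphereProb μ) *
      ENNReal.ofReal (η (z - s)) ∂μ ≤ ENNReal.ofReal (∫ s, F s * η (z - s) ∂μ) := by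
    rw [ofReal_integral_eq_lintegral_ofReal hF_int hFη0]
    refine lintegral_mono_ae ?_
    filter_upwards [hae, hF0] with s hs hs0
    by_cases hmem : s ∈ Metric.closedBall z ε
    · rw [ENNReal.ofReal_mul (hs0 hmem)]
      gcongr
      have := hA s hmem
      rwa [gap_eq_ofReal (hs (hz hmem)) (htop s (hz hmem))] at this
    · simp [h.eq_zero_of_notMem hmem]
  have hball : ∀ y : Metric.sphere (0 : E) 1, Metric.closedBall (z + r • T y) ε ⊆ K := by
    intro y
    have h1 := (hTx y (Metric.sphere_subset_closedBall y.2)).trans_le (min_le_left _ _)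
    refine Metric.closedBall_subset_closedBall' ?_
    rw [dist_eq_norm, add_sub_cancel_left]
    linarith
  have hinner : ∀ y : Metric.sphere (0 : E) 1,
      ∫⁻ s, gap M (u (s + r • T y)) * ENNReal.ofReal (η (z - s)) ∂μ =
        ENNReal.ofReal (M - w (z + r • T y)) ∧ w (z + r • T y) ≤ M := by
    intro y
    obtain ⟨h1, h2⟩ := lintegral_gap_mul_kernel htop hae hloc h ((hball y).trans hKΩ) (M := M)
      fun x hx => (hM₀ x (hball y hx)).trans (by rw [EReal.coe_le_coe_iff]; linarith)
    refine ⟨?_, h2⟩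
    rw [← h1, ← lintegral_add_right_eq_self
      (fun t => gap M (u t) * ENNReal.ofReal (η (z + r • T y - t))) (r • T y)]
    refine lintegral_congr fun s => ?_
    rw [add_sub_add_right_eq_sub]
  have hmeas2 : Measurable fun p : E × Metric.sphere (0 : E) 1 =>
      gap M (u (p.1 + r • T p.2)) * ENNReal.ofReal (η (z - p.1)) := by
    refine Measurable.mul ?_ ?_
    · exact (continuous_gap M).measurable.comp (hmeas.comp (by fun_prop))
    · exact (h.contDiff.continuous.comp (by fun_prop)).measurable.ennreal_ofReal
  -- Tonelli exchanges the spherical mean with the convolution; the inner integral is then the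
  -- convolution at the translated point.
  have hswap : ∫⁻ s, (∫⁻ y : Metric.sphere (0 : E) 1, gap M (u (s + r • T y)) ∂sphereProb μ) *
      ENNReal.ofReal (η (z - s)) ∂μ =
      ∫⁻ y : Metric.sphere (0 : E) 1, ENNReal.ofReal (M - w (z + r • T y)) ∂sphereProb μ := by
    calc _ = ∫⁻ s, ∫⁻ y : Metric.sphere (0 : E) 1,
          gap M (u (s + r • T y)) * ENNReal.ofReal (η (z - s)) ∂sphereProb μ ∂μ := by
          refine lintegral_congr fun s => ?_
          rw [lintegral_mul_const]
          exact (continuous_gap M).measurable.comp (hmeas.comp (by fun_prop))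
      _ = ∫⁻ y : Metric.sphere (0 : E) 1, ∫⁻ s,
          gap M (u (s + r • T y)) * ENNReal.ofReal (η (z - s)) ∂μ ∂sphereProb μ :=
          lintegral_lintegral_swap hmeas2.aemeasurable
      _ = _ := lintegral_congr fun y => (hinner y).1
  have hwcont : Continuous fun y : Metric.sphere (0 : E) 1 => w (z + r • T y) := by
    rw [continuous_iff_continuousAt]
    intro y
    exact ContinuousAt.comp (g := w) (f := fun y : Metric.sphere (0 : E) 1 => z + r • T y)
      (contDiffAt_conv hΩ hε h hloc ((hball y).trans hKΩ)).continuousAt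
      (by fun_prop)
  have hwint := integrable_sphereProb_of_continuous μ hwcont
  rw [hswap, ← ofReal_integral_eq_lintegral_ofReal
    (f := fun y : Metric.sphere (0 : E) 1 => M - w (z + r • T y)) ((integrable_const M).sub hwint)
    (Eventually.of_forall fun y => sub_nonneg.2 (hinner y).2),
    ENNReal.ofReal_le_ofReal_iff (integral_nonneg_of_ae hFη0), hFval] at hupper
  rw [integral_sub (integrable_const M) hwint] at hupper
  simp at hupper
  have e2 : r ^ 2 * (conv μ g η z - δ) / (2 * Fintype.card ι) = κ * (conv μ g η z - δ) := by
    rw [hκ]; ring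
  rw [e2]
  linarith

/-- In the Taylor expansion of the smooth convolution on `z + r T y`, the linear term has mean zero
and the quadratic term has mean `r²/(2N)` times the operator, `N` being the real dimension. The
integrated sub-mean value inequality for one small `r` gives the claim up to `δ`. -/
theorem conv_le_secondOrderOp_conv (hmeas : Measurable u) (hΩ : IsOpen Ω)
    (husc : UpperSemicontinuousOn u Ω)
    (htop : ∀ x ∈ Ω, u x ≠ ⊤) (hae : ∀ᵐ x ∂μ, x ∈ Ω → u x ≠ ⊥)
    (hloc : LocallyIntegrableOn (fun x => (u x).toReal) Ω μ) (T : E ≃L[ℝ] E) {g : E → ℝ}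
    (hg : ContinuousOn g Ω)
    (hvisc : ∀ x ∈ Ω, ∀ q, TouchesAbove u x q → g x ≤ secondOrderOp (fun k => T (b k)) q x)
    {ε : ℝ} {η : E → ℝ} (hε : 0 ≤ ε) (h : IsAveragingKernel μ ε η) {z : E}
    (hz : Metric.closedBall z ε ⊆ Ω) :
    conv μ g η z ≤
      secondOrderOp (fun k => T (b k)) (conv μ (fun x => (u x).toReal) η) z := by
  have hN : (0 : ℝ) < Fintype.card ι := by exact_mod_cast Fintype.card_pos
  set w := conv μ (fun x => (u x).toReal) η with hw
  have hw2 : ContDiffAt ℝ 2 w z := (contDiffAt_conv hΩ hε h hloc hz).of_le ENat.LEInfty.out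
  set C := ‖(T : E →L[ℝ] E)‖ + 1 with hC
  have hCpos : 0 < C := by positivity
  refine le_of_forall_pos_le_add fun δ hδ => ?_
  obtain ⟨r₀, hr₀, hr⟩ := conv_add_le_integral_sphere b hmeas hΩ husc htop hae hloc T hg hvisc hε h hz
    (half_pos hδ)
  -- Chosen so that the Taylor error `δ' (r C)²` equals `(δ/2) r²/(2N)`; the other `δ/2` comes from
  -- the sub-mean value inequality.
  set δ' := δ / (4 * Fintype.card ι * C ^ 2) with hδ'
  have hδ'pos : 0 < δ' := by positivity
  have ht := (Asymptotics.isLittleO_iff.1 (isLittleO_taylor_two hw2)) hδ'pos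
  have hcd : ∀ᶠ x in 𝓝 (0 : E), ContinuousAt w (z + x) := by
    have h1 : ∀ᶠ x in 𝓝 z, ContinuousAt w x := by
      filter_upwards [hw2.eventually (by simp)] with x hx
      exact hx.continuousAt
    have h2 : Tendsto (fun x : E => z + x) (𝓝 0) (𝓝 z) := by
      have : Continuous fun x : E => z + x := by fun_prop
      simpa using this.tendsto 0
    exact h2.eventually h1
  obtain ⟨ρ, hρ, hball⟩ := Metric.eventually_nhds_iff_ball.1 (ht.and hcd)
  obtain ⟨r, hrpos, hrlt⟩ : ∃ r : ℝ, 0 < r ∧ r < min r₀ (ρ / C) := exists_between (by positivity)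
  have hrC : r * C < ρ := (lt_div_iff₀ hCpos).1 (hrlt.trans_le (min_le_right _ _))
  have hT : ∀ y : Metric.sphere (0 : E) 1, ‖r • T y‖ ≤ r * C := by
    intro y
    rw [norm_smul, Real.norm_of_nonneg hrpos.le]
    gcongr
    calc ‖T y‖ ≤ ‖(T : E →L[ℝ] E)‖ * ‖(y : E)‖ := (T : E →L[ℝ] E).le_opNorm y
      _ ≤ C := by rw [norm_eq_of_mem_sphere, mul_one, hC]; linarith
  have hmem : ∀ y : Metric.sphere (0 : E) 1, r • T y ∈ Metric.ball (0 : E) ρ := fun y => by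
    rw [mem_ball_zero_iff]; exact (hT y).trans_lt hrC
  have h1 := hr r hrpos (hrlt.trans_le (min_le_left _ _))
  let l : E →L[ℝ] ℝ := (fderiv ℝ w z).comp (T : E →L[ℝ] E)
  let B : E →L[ℝ] E →L[ℝ] ℝ :=
    (fderiv ℝ (fderiv ℝ w) z).bilinearComp (T : E →L[ℝ] E) (T : E →L[ℝ] E)
  have hpt : ∀ y : Metric.sphere (0 : E) 1,
      w (z + r • T y) ≤ w z + r * l y + r ^ 2 / 2 * B y y + δ' * (r * C) ^ 2 := by
    intro y
    have h2 := (hball _ (hmem y)).1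
    rw [Real.norm_eq_abs, Real.norm_of_nonneg (by positivity)] at h2
    have h3 := (abs_le.1 h2).2
    rw [hess_smul_smul, map_smul, smul_eq_mul] at h3
    have h4 : δ' * ‖r • T y‖ ^ 2 ≤ δ' * (r * C) ^ 2 := by
      gcongr; exact hT y
    have h5 : hess w z (T y) (T y) = B y y := rfl
    have h6 : fderiv ℝ w z (T y) = l y := rfl
    rw [h5, h6] at h3
    linarith
  have hwcont : Continuous fun y : Metric.sphere (0 : E) 1 => w (z + r • T y) := by
    rw [continuous_iff_continuousAt]
    intro y
    exact ContinuousAt.comp (g := w) (f := fun y : Metric.sphere (0 : E) 1 => z + r • T y)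
      (hball _ (hmem y)).2 (by fun_prop)
  have hcint : ∀ {φ : Metric.sphere (0 : E) 1 → ℝ}, Continuous φ → Integrable φ (sphereProb μ) :=
    fun hφ => integrable_sphereProb_of_continuous μ hφ
  have i1 := hcint (φ := fun _ => w z) (by fun_prop)
  have i2 := hcint (φ := fun y => r * l y) (by fun_prop)
  have i3 := hcint (φ := fun y => r ^ 2 / 2 * B y y) (by fun_prop)
  have i4 := hcint (φ := fun _ => δ' * (r * C) ^ 2) (by fun_prop)
  have i12 : Integrable (fun y : Metric.sphere (0 : E) 1 => w z + r * l y) (sphereProb μ) :=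
    i1.add i2
  have i123 : Integrable (fun y : Metric.sphere (0 : E) 1 => w z + r * l y + r ^ 2 / 2 * B y y)
    (sphereProb μ) := i12.add i3
  have h7 : ∫ y : Metric.sphere (0 : E) 1, w (z + r • T y) ∂sphereProb μ ≤
      ∫ y : Metric.sphere (0 : E) 1,
        (w z + r * l y + r ^ 2 / 2 * B y y + δ' * (r * C) ^ 2) ∂sphereProb μ :=
    integral_mono (hcint hwcont) (i123.add i4) hpt
  have h8 : ∫ y : Metric.sphere (0 : E) 1,
      (w z + r * l y + r ^ 2 / 2 * B y y + δ' * (r * C) ^ 2) ∂sphereProb μ =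
      w z + r ^ 2 / 2 * ((∑ k, B (b k) (b k)) / Fintype.card ι) + δ' * (r * C) ^ 2 := by
    rw [integral_add i123 i4, integral_add i12 i3, integral_add i1 i2,
      integral_const_mul, integral_const_mul, integral_sphereProb_linear,
      integral_sphereProb_bilin μ b]
    simp
  have h9 : ∑ k, B (b k) (b k) = secondOrderOp (fun k => T (b k)) w z := rfl
  have h10 := h1.trans (h7.trans_eq h8)
  rw [h9] at h10
  have h11 : δ' * (r * C) ^ 2 = r ^ 2 * (δ / 2) / (2 * Fintype.card ι) := by
    rw [hδ']; field_simp; ring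
  have h12 : r ^ 2 / (2 * Fintype.card ι) * (conv μ g η z) ≤
      r ^ 2 / (2 * Fintype.card ι) * (secondOrderOp (fun k => T (b k)) w z + δ) := by
    rw [h11] at h10
    have e1 : r ^ 2 * (conv μ g η z - δ / 2) / (2 * Fintype.card ι) =
      r ^ 2 / (2 * Fintype.card ι) * conv μ g η z -
        r ^ 2 * (δ / 2) / (2 * Fintype.card ι) := by ring
    have e2 : r ^ 2 / 2 * (secondOrderOp (fun k => T (b k)) w z / Fintype.card ι) =
      r ^ 2 / (2 * Fintype.card ι) * secondOrderOp (fun k => T (b k)) w z := by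
      field_simp
    have e3 : r ^ 2 / (2 * Fintype.card ι) * (secondOrderOp (fun k => T (b k)) w z + δ) =
      r ^ 2 / (2 * Fintype.card ι) * secondOrderOp (fun k => T (b k)) w z +
        r ^ 2 * (δ / 2) / (2 * Fintype.card ι) + r ^ 2 * (δ / 2) / (2 * Fintype.card ι) := by ring
    rw [e1, e2] at h10
    rw [e3]
    linarith
  exact le_of_mul_le_mul_left h12 (by positivity)

end Convolution

/-! ### Stability of viscosity inequalities under limits. -/

section Stability

variable {E : Type*} [NormedAddCommGroup E] [InnerProductSpace ℝ E] [ProperSpace E]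

/-- Test functions of a limit of classical subsolutions satisfy the inequality of the limit. -/
theorem le_secondOrderOp_of_approx {ι : Type*} [Fintype ι] (w : ι → E) {u : E → EReal} {z₀ : E}
    {v : ℕ → E → ℝ} {ρ g₀ : ℝ} (hρ : 0 < ρ)
    (hcd : ∀ᶠ j in atTop, ∀ z ∈ Metric.ball z₀ ρ, ContDiffAt ℝ 2 (v j) z)
    (hz₀ : ∀ᶠ j in atTop, u z₀ ≤ ((v j z₀ : ℝ) : EReal))
    (hlt : ∀ K : Set E, IsCompact K → K ⊆ Metric.ball z₀ ρ → ∀ φ : E → ℝ, ContinuousOn φ K →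
      (∀ z ∈ K, u z < φ z) → ∀ᶠ j in atTop, ∀ z ∈ K, v j z < φ z)
    (hop : ∀ c < g₀, ∃ ρ' > 0, ∀ᶠ j in atTop, ∀ z ∈ Metric.ball z₀ ρ', c ≤ secondOrderOp w (v j) z)
    {q : E → ℝ} (hq : TouchesAbove u z₀ q) : g₀ ≤ secondOrderOp w q z₀ := by
  by_contra! hcon
  obtain ⟨c, hc1, hc2⟩ := exists_between hcon
  obtain ⟨ρ', hρ', hop⟩ := hop c hc2
  set S := 2 * ∑ k, ‖w k‖ ^ 2 with hS
  have hS0 : 0 ≤ S := by positivity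
  -- Adding `δ‖z - z₀‖²` raises the operator by `δ S`, at most half of the available room.
  set δ := (c - secondOrderOp w q z₀) / (2 * (S + 1)) with hδ
  have hδpos : 0 < δ := div_pos (sub_pos.2 hc1) (by positivity)
  have hδS : secondOrderOp w q z₀ + δ * S < c := by
    have : δ * S ≤ (c - secondOrderOp w q z₀) / 2 := by
      rw [hδ, div_mul_eq_mul_div, div_le_div_iff₀ (by positivity) (by positivity)]
      nlinarith [sub_pos.2 hc1]
    linarith
  set Q : E → ℝ := fun z => q z + δ * ‖z - z₀‖ ^ 2 with hQ
  have hnorm : ∀ z, ContDiffAt ℝ 2 (fun x : E => ‖x - z₀‖ ^ 2) z := fun z =>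
    (contDiff_norm_sub_sq z₀).contDiffAt
  have hQcd : ∀ z, ContDiffAt ℝ 2 q z → ContDiffAt ℝ 2 Q z := fun z hz =>
    hz.add (contDiffAt_const.mul (hnorm z))
  have hopQ : ∀ z, ContDiffAt ℝ 2 q z → secondOrderOp w Q z = secondOrderOp w q z + δ * S := by
    intro z hz
    rw [hQ, secondOrderOp_add w hz (contDiffAt_const.mul (hnorm z)),
      secondOrderOp_const_mul w (hnorm z), secondOrderOp_norm_sub_sq]
  have hnear : ∀ᶠ z in 𝓝 z₀, ContDiffAt ℝ 2 q z ∧ secondOrderOp w Q z < c := by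
    have h1 := hq.1.eventually (by simp)
    have h2 := (continuousAt_secondOrderOp w hq.1).eventually_lt_const
      (show secondOrderOp w q z₀ < c - δ * S by linarith)
    filter_upwards [h1, h2] with z hz1 hz2
    refine ⟨hz1, ?_⟩
    rw [hopQ z hz1]; linarith
  obtain ⟨r, hr, hball⟩ := Metric.eventually_nhds_iff_ball.1 (hnear.and hq.2.2)
  obtain ⟨s, hs, hs'⟩ : ∃ s : ℝ, 0 < s ∧ s < min r (min ρ ρ') := exists_between (by positivity)
  have hsr : s < r := hs'.trans_le (min_le_left _ _)
  have hsρ : s < ρ := hs'.trans_le ((min_le_right _ _).trans (min_le_left _ _))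
  have hsρ' : s < ρ' := hs'.trans_le ((min_le_right _ _).trans (min_le_right _ _))
  have hmemr : ∀ z ∈ Metric.closedBall z₀ s, z ∈ Metric.ball z₀ r := fun z hz =>
    (Metric.mem_closedBall.1 hz).trans_lt hsr
  have hmemρ : ∀ z ∈ Metric.closedBall z₀ s, z ∈ Metric.ball z₀ ρ := fun z hz =>
    (Metric.mem_closedBall.1 hz).trans_lt hsρ
  have hQcont : ContinuousOn Q (Metric.closedBall z₀ s) := fun z hz =>
    (hQcd z (hball z (hmemr z hz)).1.1).continuousAt.continuousWithinAt
  -- `Q` lies strictly above `u` on the sphere, so eventually above `v j` there, while `v j z₀ ≥ u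
  -- z₀ = Q z₀`. Hence `v j - Q` has an interior maximum, where its second derivatives are
  -- nonpositive.
  have hsph := hlt (Metric.sphere z₀ s) (isCompact_sphere z₀ s)
    (fun z hz => hmemρ z (Metric.sphere_subset_closedBall hz)) Q
    (hQcont.mono Metric.sphere_subset_closedBall) (by
      intro z hz
      refine ((hball z (hmemr z (Metric.sphere_subset_closedBall hz))).2).trans_lt ?_
      rw [EReal.coe_lt_coe_iff, hQ]
      have : ‖z - z₀‖ = s := mem_sphere_iff_norm.1 hz
      simp only [this]
      have : 0 < δ * s ^ 2 := by positivity
      linarith)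
  obtain ⟨j, hj1, hj2, hj3, hj4⟩ := (hcd.and (hz₀.and (hsph.and hop))).exists
  have hcont : ContinuousOn (fun z => v j z - Q z) (Metric.closedBall z₀ s) := fun z hz =>
    ((hj1 z (hmemρ z hz)).continuousAt.continuousWithinAt).sub (hQcont z hz)
  obtain ⟨x, hx, hmax⟩ := (isCompact_closedBall z₀ s).exists_isMaxOn
    ⟨z₀, Metric.mem_closedBall_self hs.le⟩ hcont
  have h0 : 0 ≤ v j z₀ - Q z₀ := by
    rw [hq.2.1, EReal.coe_le_coe_iff] at hj2
    simp only [hQ, sub_self, norm_zero]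
    norm_num
    exact hj2
  have hxball : x ∈ Metric.ball z₀ s := by
    rcases (Metric.mem_closedBall.1 hx).lt_or_eq with h | h
    · exact h
    · exfalso
      have h1 := hj3 x h
      have h2 : v j z₀ - Q z₀ ≤ v j x - Q x := hmax (Metric.mem_closedBall_self hs.le)
      linarith
  have hloc : IsLocalMax (fun z => v j z - Q z) x := by
    filter_upwards [Metric.isOpen_ball.mem_nhds hxball] with y hy
    exact hmax (Metric.ball_subset_closedBall hy)
  have hle : secondOrderOp w (v j) x ≤ secondOrderOp w Q x :=
    Finset.sum_le_sum fun k _ => hess_le_of_isLocalMax_sub (hj1 x (hmemρ x hx))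
      (hQcd x (hball x (hmemr x hx)).1.1) hloc (w k)
  have h1 := hj4 x (Metric.ball_subset_ball hsρ'.le hxball)
  have h2 := (hball x (hmemr x hx)).1.2
  linarith

end Stability

/-! ### The cone and the affine majorants of `f`. -/

section Cone

variable {n : ℕ} {Γ : Set (Fin n → ℝ)} {f : (Fin n → ℝ) → ℝ}

theorem mem_gammaCone_of_pos {x : Fin n → ℝ} (hx : ∀ i, 0 < x i) (k : ℕ) (hk : k ≤ n) :
    x ∈ GammaCone n k := by
  intro j _ hjk
  refine Finset.sum_pos (fun s _ => Finset.prod_pos fun i _ => hx i) ?_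
  exact Finset.powersetCard_nonempty.2 (by simpa using hjk.trans hk)

theorem IsAdmissibleCone.mem_of_pos (hΓ : IsAdmissibleCone Γ) {x : Fin n → ℝ}
    (hx : ∀ i, 0 < x i) : x ∈ Γ :=
  hΓ.gamma_n_subset (mem_gammaCone_of_pos hx n le_rfl)

theorem IsAdmissibleCone.mem_closure_of_nonneg (hΓ : IsAdmissibleCone Γ) {x : Fin n → ℝ}
    (hx : ∀ i, 0 ≤ x i) : x ∈ closure Γ := by
  have hc : Continuous fun t : ℝ => x + t • (1 : Fin n → ℝ) := by fun_prop
  have ht : Tendsto (fun t : ℝ => x + t • (1 : Fin n → ℝ)) (𝓝[>] 0) (𝓝 x) := by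
    have := hc.tendsto 0
    rw [zero_smul, add_zero] at this
    exact this.mono_left nhdsWithin_le_nhds
  refine mem_closure_of_tendsto ht ?_
  filter_upwards [self_mem_nhdsWithin] with t ht
  refine hΓ.mem_of_pos fun i => ?_
  have : (0 : ℝ) < t := ht
  simpa using add_pos_of_nonneg_of_pos (hx i) this

/-- The midpoint of a point of the closure and an interior point is interior; doubling it stays in
the cone. -/
theorem IsAdmissibleCone.add_mem (hΓ : IsAdmissibleCone Γ) {x y : Fin n → ℝ}
    (hx : x ∈ closure Γ) (hy : y ∈ Γ) : x + y ∈ Γ := by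
  have h := hΓ.convex.combo_closure_interior_mem_interior hx (hΓ.isOpen.interior_eq.symm ▸ hy)
    (a := 1 / 2) (b := 1 / 2) (by norm_num) (by norm_num) (by norm_num)
  rw [hΓ.isOpen.interior_eq] at h
  have := hΓ.smul_mem _ h 2 two_pos
  rwa [smul_add, smul_smul, smul_smul, mul_one_div_cancel two_ne_zero, one_smul, one_smul] at this

theorem IsAdmissibleCone.smul_mem_closure (hΓ : IsAdmissibleCone Γ) {x : Fin n → ℝ}
    (hx : x ∈ closure Γ) {t : ℝ} (ht : 0 < t) : t • x ∈ closure Γ :=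
  map_mem_closure (f := fun y => t • y) (by fun_prop) hx fun y hy => hΓ.smul_mem y hy t ht

theorem IsAdmissibleCone.symmetric_closure (hΓ : IsAdmissibleCone Γ) {x : Fin n → ℝ}
    (hx : x ∈ closure Γ) (π : Equiv.Perm (Fin n)) : x ∘ π ∈ closure Γ :=
  map_mem_closure (f := fun y : Fin n → ℝ => y ∘ π) (by fun_prop) hx
    fun y hy => hΓ.symmetric y hy π

theorem IsAdmissibleCone.sum_nonneg (hΓ : IsAdmissibleCone Γ) {x : Fin n → ℝ}
    (hx : x ∈ closure Γ) : 0 ≤ ∑ i, x i := by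
  have : x ∈ closure {y : Fin n → ℝ | 0 ≤ ∑ i, y i} := by
    refine closure_mono (fun y hy => ?_) hx
    have := hΓ.subset_gamma_one hy 1 le_rfl le_rfl
    simp only [sigma, Finset.powersetCard_one, Finset.sum_map, Function.Embedding.coeFn_mk,
      Finset.prod_singleton] at this
    exact this.le
  rwa [IsClosed.closure_eq] at this
  exact isClosed_le continuous_const (by fun_prop)

theorem IsAdmissibleFunction.nonneg (hΓ : IsAdmissibleCone Γ) (hf : IsAdmissibleFunction Γ f)
    {x : Fin n → ℝ} (hx : x ∈ closure Γ) : 0 ≤ f x := by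
  by_cases h : x ∈ Γ
  · exact (hf.pos x h).le
  · exact (hf.zero_on_frontier x ⟨hx, by rwa [hΓ.isOpen.interior_eq]⟩).ge

/-- `x ↦ a + ∑ i, p i * x i` is an affine majorant of `f` on `closure Γ` with positive slopes. -/
structure IsMajorant (Γ : Set (Fin n → ℝ)) (f : (Fin n → ℝ) → ℝ) (a : ℝ) (p : Fin n → ℝ) :
    Prop where
  pos : ∀ i, 0 < p i
  le : ∀ x ∈ closure Γ, f x ≤ a + ∑ i, p i * x i

theorem continuousLinearMap_pi_apply (l : (Fin n → ℝ) →L[ℝ] ℝ) (x : Fin n → ℝ) :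
    l x = ∑ i, l (Pi.single i 1) * x i := by
  conv_lhs => rw [pi_eq_sum_univ' x]
  rw [map_sum]
  refine Finset.sum_congr rfl fun i _ => ?_
  rw [map_smul, smul_eq_mul, mul_comm]

/-- Hahn–Banach gives an affine majorant of the concave continuous `f`. Its slopes are nonnegative,
and a small multiple of `∑ yᵢ`, nonnegative on `closure Γ`, makes them positive. -/
theorem exists_majorant_lt (hΓ : IsAdmissibleCone Γ) (hf : IsAdmissibleFunction Γ f)
    {x : Fin n → ℝ} (hx : x ∈ closure Γ) {η : ℝ} (hη : 0 < η) :
    ∃ a p, IsMajorant Γ f a p ∧ a + ∑ i, p i * x i < f x + η := by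
  obtain ⟨l, c, hle, hval⟩ := hf.concave.neg.exists_affine_le_of_lt (𝕜 := ℝ) hx
    (a := (-f) x - η / 2) (by linarith) isClosed_closure hf.continuousOn.neg.lowerSemicontinuousOn
  have hle' : ∀ y ∈ closure Γ, l y + c ≤ -f y := fun y hy => hle ⟨y, hy⟩
  have hval' : l x + c = -f x - η / 2 := hval
  -- The coordinate rays lie in `closure Γ` and `f ≥ 0` there, so the majorant cannot tend to `-∞`
  -- along them.
  have hp : ∀ i, l (Pi.single i 1) ≤ 0 := by
    intro i
    by_contra! hpos
    have hmem : ∀ s : ℝ, 0 ≤ s → s * l (Pi.single i 1) + c ≤ 0 := by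
      intro s hs
      have h1 : s • (Pi.single i 1 : Fin n → ℝ) ∈ closure Γ := by
        refine hΓ.mem_closure_of_nonneg fun j => mul_nonneg hs ?_
        by_cases h : j = i
        · subst h; simp
        · simp [h]
      have h2 := hle' _ h1
      rw [map_smul, smul_eq_mul] at h2
      linarith [hf.nonneg hΓ h1]
    have := hmem ((|c| + 1) / l (Pi.single i 1)) (by positivity)
    rw [div_mul_cancel₀ _ hpos.ne'] at this
    linarith [neg_abs_le c]
  have hS : 0 ≤ ∑ i, x i := hΓ.sum_nonneg hx
  set δ := η / (4 * (∑ i, x i + 1)) with hδ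
  have hδpos : 0 < δ := by positivity
  have hδS : δ * ∑ i, x i ≤ η / 4 := by
    rw [hδ, div_mul_eq_mul_div, div_le_div_iff₀ (by positivity) (by positivity)]
    nlinarith
  have hval2 : ∀ y : Fin n → ℝ, -c + ∑ i, (-l (Pi.single i 1) + δ) * y i =
      -(l y + c) + δ * ∑ i, y i := by
    intro y
    rw [continuousLinearMap_pi_apply l y]
    simp only [add_mul, Finset.sum_add_distrib, neg_mul, Finset.sum_neg_distrib, Finset.mul_sum]
    ring
  refine ⟨-c, fun i => -l (Pi.single i 1) + δ, ⟨fun i => ?_, fun y hy => ?_⟩, ?_⟩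
  · have := hp i; linarith
  · rw [hval2]
    have h1 := hle' y hy
    have h2 := mul_nonneg hδpos.le (hΓ.sum_nonneg hy)
    linarith
  · rw [hval2, hval']
    linarith

/-- A linear functional separating `x` from the closed convex cone is nonnegative on the cone and
negative at `x`. A large multiple of it, added to any majorant, lowers the value at `x` at will. -/
theorem exists_majorant_lt_of_notMem (hΓ : IsAdmissibleCone Γ) (hf : IsAdmissibleFunction Γ f)
    {x : Fin n → ℝ} (hx : x ∉ closure Γ) (c : ℝ) :
    ∃ a p, IsMajorant Γ f a p ∧ a + ∑ i, p i * x i < c := by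
  have h0 : (0 : Fin n → ℝ) ∈ closure Γ := hΓ.mem_closure_of_nonneg fun _ => le_rfl
  obtain ⟨l, t, hlx, hl⟩ := geometric_hahn_banach_point_closed hΓ.convex.closure
    isClosed_closure hx
  have ht : t < 0 := by simpa using hl 0 h0
  have hlnn : ∀ y ∈ closure Γ, 0 ≤ l y := by
    intro y hy
    by_contra! hneg
    -- Rescaling `y` would produce a point of the cone where `l` equals exactly `t`.
    have h1 := hl _ (hΓ.smul_mem_closure hy (div_pos_of_neg_of_neg ht hneg))
    rw [map_smul, smul_eq_mul, div_mul_cancel₀ _ hneg.ne] at h1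
    exact lt_irrefl _ h1
  obtain ⟨a, p, hap, -⟩ := exists_majorant_lt hΓ hf h0 one_pos
  set s := (|a + ∑ i, p i * x i - c| + 1) / -(l x) with hs
  have hlx0 : l x < 0 := hlx.trans ht
  have hspos : 0 < s := div_pos (by positivity) (neg_pos.2 hlx0)
  have hval : ∀ y : Fin n → ℝ, a + ∑ i, (p i + s * l (Pi.single i 1)) * y i =
      a + ∑ i, p i * y i + s * l y := by
    intro y
    rw [continuousLinearMap_pi_apply l y]
    simp only [add_mul, Finset.sum_add_distrib, Finset.mul_sum, mul_assoc, add_assoc]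
  refine ⟨a, fun i => p i + s * l (Pi.single i 1), ⟨fun i => ?_, fun y hy => ?_⟩, ?_⟩
  · have : 0 ≤ l (Pi.single i 1) := hlnn _ (hΓ.mem_closure_of_nonneg fun j => by
      by_cases h : j = i
      · subst h; simp
      · simp [h])
    have := hap.pos i
    positivity
  · rw [hval]
    have h1 := hap.le y hy
    have h2 := mul_nonneg hspos.le (hlnn y hy)
    linarith
  · rw [hval]
    have h1 : s * l x = -(|a + ∑ i, p i * x i - c| + 1) := by
      rw [hs, div_mul_eq_mul_div, div_eq_iff (neg_pos.2 hlx0).ne']; ring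
    linarith [le_abs_self (a + ∑ i, p i * x i - c)]

end Cone

/-! ### Diagonals of unitary conjugates and the linearization of `F`. -/

section Conjugation

open Matrix

variable {n : ℕ} {Γ : Set (Fin n → ℝ)} {f : (Fin n → ℝ) → ℝ} {A : Matrix (Fin n) (Fin n) ℂ}

/-- The real parts of the diagonal entries of `U A U*`. -/
def diagConj (U A : Matrix (Fin n) (Fin n) ℂ) (i : Fin n) : ℝ := ((U * A * star U) i i).re

theorem continuous_diagConj (U : Matrix (Fin n) (Fin n) ℂ) : Continuous (diagConj U) := by
  unfold diagConj
  refine continuous_pi fun i => Complex.continuous_re.comp ?_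
  exact Continuous.matrix_elem (by fun_prop) i i

/-- By Birkhoff's theorem `M` is a convex combination of permutation matrices. -/
theorem mulVec_mem_of_doublyStochastic {K : Set (Fin n → ℝ)} (hK : Convex ℝ K)
    (hsymm : ∀ x ∈ K, ∀ π : Equiv.Perm (Fin n), x ∘ π ∈ K) {M : Matrix (Fin n) (Fin n) ℝ}
    (hM : M ∈ doublyStochastic ℝ (Fin n)) {x : Fin n → ℝ} (hx : x ∈ K) : M *ᵥ x ∈ K := by
  obtain ⟨w, hw0, hw1, rfl⟩ := exists_eq_sum_perm_of_mem_doublyStochastic hM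
  rw [sum_mulVec]
  simp only [smul_mulVec, permMatrix_mulVec]
  exact hK.sum_mem (fun σ _ => hw0 σ) hw1 fun σ _ => hsymm x hx σ

/-- Schur's observation: the diagonal is the image of `x` under the matrix `|W i j|²`, which is
doubly stochastic because `W` is unitary. -/
theorem diagConj_diagonal_mem {K : Set (Fin n → ℝ)} (hK : Convex ℝ K)
    (hsymm : ∀ x ∈ K, ∀ π : Equiv.Perm (Fin n), x ∘ π ∈ K) {W : Matrix (Fin n) (Fin n) ℂ}
    (hW : W ∈ unitaryGroup (Fin n) ℂ) {x : Fin n → ℝ} (hx : x ∈ K) :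
    diagConj W (diagonal fun i => (x i : ℂ)) ∈ K := by
  have hM : (Matrix.of fun i j => Complex.normSq (W i j)) ∈ doublyStochastic ℝ (Fin n) := by
    rw [mem_doublyStochastic_iff_sum]
    refine ⟨fun i j => Complex.normSq_nonneg _, fun i => ?_, fun j => ?_⟩
    · have := congr_fun₂ (mem_unitaryGroup_iff.1 hW) i i
      rw [mul_apply, one_apply_eq] at this
      have := congr_arg Complex.re this
      simpa [star_apply, Complex.mul_conj] using this
    · have := congr_fun₂ (mem_unitaryGroup_iff'.1 hW) j j
      rw [mul_apply, one_apply_eq] at this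
      have := congr_arg Complex.re this
      simpa [star_apply, mul_comm, Complex.mul_conj] using this
  convert mulVec_mem_of_doublyStochastic hK hsymm hM hx using 1
  ext i
  simp only [diagConj, mulVec, dotProduct, of_apply]
  rw [mul_apply, Complex.re_sum]
  refine Finset.sum_congr rfl fun j _ => ?_
  rw [mul_diagonal, star_apply, mul_right_comm, RCLike.star_def, Complex.mul_conj,
    ← Complex.ofReal_mul, Complex.ofReal_re]

theorem spectral_eq (hA : A.IsHermitian) :
    A = (hA.eigenvectorUnitary : Matrix (Fin n) (Fin n) ℂ) *
      diagonal (fun i => (hA.eigenvalues i : ℂ)) * star (hA.eigenvectorUnitary : Matrix _ _ ℂ) := by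
  conv_lhs => rw [hA.spectral_theorem]
  rfl

theorem diagConj_mem_of_conj {K : Set (Fin n → ℝ)} (hK : Convex ℝ K)
    (hsymm : ∀ x ∈ K, ∀ π : Equiv.Perm (Fin n), x ∘ π ∈ K) {U W : Matrix (Fin n) (Fin n) ℂ}
    (hU : U ∈ unitaryGroup (Fin n) ℂ) (hW : W ∈ unitaryGroup (Fin n) ℂ) {x : Fin n → ℝ}
    (hx : x ∈ K) : diagConj U (W * diagonal (fun i => (x i : ℂ)) * star W) ∈ K := by
  have := diagConj_diagonal_mem hK hsymm (mul_mem hU hW) hx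
  convert this using 1
  unfold diagConj
  simp only [star_mul, Matrix.mul_assoc]

theorem diagConj_mem (hA : A.IsHermitian) {K : Set (Fin n → ℝ)} (hK : Convex ℝ K)
    (hsymm : ∀ x ∈ K, ∀ π : Equiv.Perm (Fin n), x ∘ π ∈ K) (hx : hA.eigenvalues ∈ K)
    {U : Matrix (Fin n) (Fin n) ℂ} (hU : U ∈ unitaryGroup (Fin n) ℂ) : diagConj U A ∈ K := by
  rw [spectral_eq hA]
  exact diagConj_mem_of_conj hK hsymm hU hA.eigenvectorUnitary.2 hx

theorem diagConj_eigenvectorUnitary (hA : A.IsHermitian) :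
    diagConj (star (hA.eigenvectorUnitary : Matrix _ _ ℂ)) A = hA.eigenvalues := by
  have h1 := mem_unitaryGroup_iff'.1 hA.eigenvectorUnitary.2
  refine (congrArg _ (spectral_eq hA)).trans ?_
  ext i
  unfold diagConj
  rw [star_star, Matrix.mul_assoc, Matrix.mul_assoc, h1, Matrix.mul_one, ← Matrix.mul_assoc, h1,
    Matrix.one_mul, diagonal_apply_eq, Complex.ofReal_re]

theorem isHermitian_conj_diagonal (W : Matrix (Fin n) (Fin n) ℂ) (x : Fin n → ℝ) :
    (W * diagonal (fun i => (x i : ℂ)) * star W).IsHermitian := by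
  refine isHermitian_mul_mul_conjTranspose W ?_
  rw [isHermitian_diagonal_iff]
  intro i
  simp [IsSelfAdjoint]

/-- The eigenvalue vector is itself the diagonal of a unitary conjugate, so Schur's observation
applies and the eigenvalues need not be matched with `x` up to order. -/
theorem conj_diagonal_mem_mGamma (hΓ : IsAdmissibleCone Γ) {W : Matrix (Fin n) (Fin n) ℂ}
    (hW : W ∈ unitaryGroup (Fin n) ℂ) {x : Fin n → ℝ} (hx : x ∈ Γ) :
    W * diagonal (fun i => (x i : ℂ)) * star W ∈ MGamma Γ := by
  refine ⟨isHermitian_conj_diagonal W x, ?_⟩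
  rw [← diagConj_eigenvectorUnitary]
  exact diagConj_mem_of_conj hΓ.convex hΓ.symmetric (Unitary.star_mem (SetLike.coe_mem _)) hW hx

/-- With the diagonalizing unitary of `A` held fixed, both directions are images of closures under
continuous maps; continuity of eigenvalues is not needed. -/
theorem mem_closure_mGamma_iff (hΓ : IsAdmissibleCone Γ) (hA : A.IsHermitian) :
    A ∈ closure (MGamma Γ) ↔ hA.eigenvalues ∈ closure Γ := by
  constructor
  · intro h
    rw [← diagConj_eigenvectorUnitary]
    refine map_mem_closure (continuous_diagConj _) h ?_
    rintro B ⟨hB, hBΓ⟩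
    exact diagConj_mem hB hΓ.convex hΓ.symmetric hBΓ (Unitary.star_mem (SetLike.coe_mem _))
  · intro h
    rw [spectral_eq hA]
    refine map_mem_closure (f := fun x : Fin n → ℝ =>
      (hA.eigenvectorUnitary : Matrix (Fin n) (Fin n) ℂ) * diagonal (fun i => (x i : ℂ)) *
        star (hA.eigenvectorUnitary : Matrix _ _ ℂ)) (by fun_prop) h ?_
    intro x hx
    exact conj_diagonal_mem_mGamma hΓ hA.eigenvectorUnitary.2 hx

theorem add_smul_one_mem_mGamma (hΓ : IsAdmissibleCone Γ) (hA : A.IsHermitian)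
    (h : A ∈ closure (MGamma Γ)) {t : ℝ} (ht : 0 < t) : A + (t : ℂ) • 1 ∈ MGamma Γ := by
  rw [mem_closure_mGamma_iff hΓ hA] at h
  have h1 := mem_unitaryGroup_iff.1 hA.eigenvectorUnitary.2
  have h2 : hA.eigenvalues + (fun _ => t) ∈ Γ := hΓ.add_mem h (hΓ.mem_of_pos fun _ => ht)
  have h3 := conj_diagonal_mem_mGamma hΓ hA.eigenvectorUnitary.2 h2
  convert h3 using 1
  have h4 : (diagonal fun i => (((hA.eigenvalues + fun _ => t : Fin n → ℝ) i : ℝ) : ℂ)) =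
      diagonal (fun i => (hA.eigenvalues i : ℂ)) + (t : ℂ) • (1 : Matrix (Fin n) (Fin n) ℂ) := by
    rw [smul_one_eq_diagonal, diagonal_add]
    simp
  rw [h4, Matrix.mul_add, Matrix.add_mul, ← spectral_eq hA, Matrix.mul_smul, Matrix.smul_mul,
    Matrix.mul_one, h1]

theorem coe_le_fOp_iff (hΓ : IsAdmissibleCone Γ) (hA : A.IsHermitian) {c : ℝ} :
    (c : EReal) ≤ FOp Γ f A ↔ hA.eigenvalues ∈ closure Γ ∧ c ≤ f hA.eigenvalues := by
  unfold FOp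
  rw [← mem_closure_mGamma_iff hΓ hA]
  split_ifs with h
  · rw [EReal.coe_le_coe_iff]
    exact ⟨fun hc => ⟨h.2, hc⟩, fun hc => hc.2⟩
  · simp only [le_bot_iff, EReal.coe_ne_bot, false_iff]
    exact fun hc => h ⟨hA, hc.1⟩

/-- The superlevel sets of `f` in `closure Γ` are convex and symmetric, so they contain the
diagonals of all conjugates of `A` once they contain its eigenvalues. Conversely the diagonalizing
unitary and near-optimal majorants recover both membership in `closure Γ` and the value of `f`. -/
theorem coe_le_fOp_iff_majorants (hΓ : IsAdmissibleCone Γ) (hf : IsAdmissibleFunction Γ f)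
    (hA : A.IsHermitian) {c : ℝ} :
    (c : EReal) ≤ FOp Γ f A ↔ ∀ a p, IsMajorant Γ f a p → ∀ U ∈ unitaryGroup (Fin n) ℂ,
      c ≤ a + ∑ i, p i * diagConj U A i := by
  rw [coe_le_fOp_iff hΓ hA]
  constructor
  · rintro ⟨h1, h2⟩ a p hap U hU
    have h3 : diagConj U A ∈ {x ∈ closure Γ | f hA.eigenvalues ≤ f x} := by
      refine diagConj_mem hA (hf.concave.convex_ge _) ?_ ⟨h1, le_rfl⟩ hU
      rintro x ⟨hx1, hx2⟩ π
      exact ⟨hΓ.symmetric_closure hx1 π, by rwa [hf.symmetric x hx1 π]⟩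
    exact h2.trans (h3.2.trans (hap.le _ h3.1))
  · intro h
    have h' : ∀ a p, IsMajorant Γ f a p → c ≤ a + ∑ i, p i * hA.eigenvalues i := by
      intro a p hap
      have := h a p hap _ (Unitary.star_mem (SetLike.coe_mem hA.eigenvectorUnitary))
      rwa [diagConj_eigenvectorUnitary] at this
    have hmem : hA.eigenvalues ∈ closure Γ := by
      by_contra hmem
      obtain ⟨a, p, hap, hlt⟩ := exists_majorant_lt_of_notMem hΓ hf hmem c
      exact hlt.not_ge (h' a p hap)
    refine ⟨hmem, le_of_forall_pos_le_add fun η hη => ?_⟩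
    obtain ⟨a, p, hap, hlt⟩ := exists_majorant_lt hΓ hf hmem hη
    exact (h' a p hap).trans hlt.le

theorem sum_diagConj_nonneg (hΓ : IsAdmissibleCone Γ) (hA : A.IsHermitian)
    (h : hA.eigenvalues ∈ closure Γ) {U : Matrix (Fin n) (Fin n) ℂ}
    (hU : U ∈ unitaryGroup (Fin n) ℂ) : 0 ≤ ∑ i, diagConj U A i :=
  hΓ.sum_nonneg (diagConj_mem hA hΓ.convex.closure (fun _ hx π => hΓ.symmetric_closure hx π) h hU)

end Conjugation

/-! ### The complex Hessian and real second order operators. -/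

section Levi

open Matrix

variable {n : ℕ}

theorem secondDeriv_eq_hess (q : Cn n → ℝ) (z v w : Cn n) : secondDeriv q z v w = hess q z v w := by
  rw [secondDeriv, iteratedFDeriv_two_apply]; rfl

theorem complexHessian_congr {q r : Cn n → ℝ} {z : Cn n} (h : q =ᶠ[𝓝 z] r) :
    complexHessian q z = complexHessian r z := by
  unfold complexHessian
  simp only [secondDeriv_eq_hess, hess_congr h]

theorem isHermitian_complexHessian {q : Cn n → ℝ} {z : Cn n} (hq : ContDiffAt ℝ 2 q z) :
    (complexHessian q z).IsHermitian := by
  ext j k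
  simp only [complexHessian, secondDeriv_eq_hess, conjTranspose_apply, of_apply]
  rw [hess_symm hq (EuclideanSpace.single k 1) (EuclideanSpace.single j 1),
    hess_symm hq (EuclideanSpace.single k Complex.I) (EuclideanSpace.single j Complex.I),
    hess_symm hq (EuclideanSpace.single k 1) (EuclideanSpace.single j Complex.I),
    hess_symm hq (EuclideanSpace.single k Complex.I) (EuclideanSpace.single j 1)]
  simp
  ring

theorem toLp_eq_sum_single (v : Fin n → ℂ) : (WithLp.toLp 2 v : Cn n) =
    ∑ j, ((v j).re • EuclideanSpace.single j (1 : ℂ) +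
      (v j).im • EuclideanSpace.single j Complex.I) := by
  ext k
  simp only [WithLp.ofLp_sum, Finset.sum_apply, PiLp.add_apply, PiLp.smul_apply]
  rw [Finset.sum_eq_single k]
  · simp [mul_comm _ Complex.I, Complex.ext_iff]
  · intro j _ hj
    simp [hj.symm]
  · simp

/-- A diagonal entry of `U Hq U*` is a quarter of the Laplacian along the complex line through the
corresponding row of `U`; expanding in the vectors `e_j`, `i e_j` shows it. -/
theorem diagConj_complexHessian (q : Cn n → ℝ) (z : Cn n) (U : Matrix (Fin n) (Fin n) ℂ)
    (i : Fin n) : diagConj U (complexHessian q z) i =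
      (hess q z (WithLp.toLp 2 (U i)) (WithLp.toLp 2 (U i)) +
        hess q z (WithLp.toLp 2 (Complex.I • U i)) (WithLp.toLp 2 (Complex.I • U i))) / 4 := by
  have hexp : ∀ (c d : Fin n → ℝ),
      hess q z (∑ j, (c j • EuclideanSpace.single j (1 : ℂ) + d j • EuclideanSpace.single j Complex.I))
        (∑ j, (c j • EuclideanSpace.single j (1 : ℂ) + d j • EuclideanSpace.single j Complex.I)) =
      ∑ k, ∑ j, (c j * c k * hess q z (EuclideanSpace.single j 1) (EuclideanSpace.single k 1) +
        c j * d k * hess q z (EuclideanSpace.single j 1) (EuclideanSpace.single k Complex.I) +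
        d j * c k * hess q z (EuclideanSpace.single j Complex.I) (EuclideanSpace.single k 1) +
        d j * d k * hess q z (EuclideanSpace.single j Complex.I)
          (EuclideanSpace.single k Complex.I)) := by
    intro c d
    unfold hess
    rw [map_sum]
    refine Finset.sum_congr rfl fun k _ => ?_
    rw [map_sum, FunLike.coe_sum, Finset.sum_apply]
    refine Finset.sum_congr rfl fun j _ => ?_
    simp only [map_add, map_smul, _root_.add_apply, _root_.smul_apply, smul_eq_mul]
    ring
  rw [toLp_eq_sum_single (U i), toLp_eq_sum_single (Complex.I • U i), hexp, hexp,
    ← Finset.sum_add_distrib, Finset.sum_div]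
  unfold diagConj
  rw [mul_apply, Complex.re_sum]
  refine Finset.sum_congr rfl fun k _ => ?_
  rw [mul_apply, Finset.sum_mul, Complex.re_sum, ← Finset.sum_add_distrib, Finset.sum_div]
  refine Finset.sum_congr rfl fun j _ => ?_
  simp only [complexHessian, secondDeriv_eq_hess, of_apply, star_apply, Pi.smul_apply, smul_eq_mul,
    Complex.mul_re, Complex.mul_im, Complex.I_re, Complex.I_im, RCLike.star_def, Complex.conj_re,
    Complex.conj_im, Complex.div_re, Complex.div_im, Complex.add_re, Complex.add_im,
    Complex.ofReal_re, Complex.ofReal_im, Complex.re_ofNat, Complex.im_ofNat, Complex.normSq_ofNat]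
  ring

/-- The real orthonormal basis of `ℂⁿ` formed by the vectors `e_j` and `i e_j`. -/
noncomputable def realBasis (n : ℕ) : OrthonormalBasis (Σ _ : Fin n, Fin 2) ℝ (Cn n) :=
  Pi.orthonormalBasis fun _ => Complex.orthonormalBasisOneI

theorem realBasis_zero (j : Fin n) : realBasis n ⟨j, 0⟩ = EuclideanSpace.single j (1 : ℂ) := by
  unfold realBasis
  rw [Pi.orthonormalBasis_apply]
  simp

theorem realBasis_one (j : Fin n) : realBasis n ⟨j, 1⟩ = EuclideanSpace.single j Complex.I := by
  unfold realBasis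
  rw [Pi.orthonormalBasis_apply]
  simp

theorem secondOrderOp_realBasis_comp (T : Cn n → Cn n) (q : Cn n → ℝ) (z : Cn n) :
    secondOrderOp (fun k => T (realBasis n k)) q z =
      ∑ j, (hess q z (T (EuclideanSpace.single j 1)) (T (EuclideanSpace.single j 1)) +
        hess q z (T (EuclideanSpace.single j Complex.I))
          (T (EuclideanSpace.single j Complex.I))) := by
  unfold secondOrderOp
  rw [Fintype.sum_sigma]
  refine Finset.sum_congr rfl fun j _ => ?_
  simp only [Fin.sum_univ_two, realBasis_zero, realBasis_one]

theorem secondOrderOp_realBasis (q : Cn n → ℝ) (z : Cn n) :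
    secondOrderOp (realBasis n) q z = 4 * ∑ i, diagConj 1 (complexHessian q z) i := by
  rw [show (⇑(realBasis n)) = fun k => id (realBasis n k) from rfl, secondOrderOp_realBasis_comp,
    Finset.mul_sum]
  refine Finset.sum_congr rfl fun i _ => ?_
  have h1 : (WithLp.toLp 2 ((1 : Matrix (Fin n) (Fin n) ℂ) i) : Cn n) =
      EuclideanSpace.single i 1 := by
    ext k; simp [one_apply, eq_comm]
  have h2 : (WithLp.toLp 2 (Complex.I • (1 : Matrix (Fin n) (Fin n) ℂ) i) : Cn n) =
      EuclideanSpace.single i Complex.I := by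
    ext k; simp [one_apply, eq_comm]
  rw [diagConj_complexHessian, h1, h2]
  simp only [id]
  ring

/-- The weighted sum `∑ p_i (U Hq U*)_{ii}` is the Laplacian of `q` in suitable real linear
coordinates. -/
theorem exists_equiv_secondOrderOp_eq {p : Fin n → ℝ} (hp : ∀ i, 0 < p i)
    {U : Matrix (Fin n) (Fin n) ℂ} (hU : U ∈ unitaryGroup (Fin n) ℂ) :
    ∃ T : Cn n ≃L[ℝ] Cn n, ∀ (q : Cn n → ℝ) (z : Cn n),
      secondOrderOp (fun k => T (realBasis n k)) q z =
        ∑ i, p i * diagConj U (complexHessian q z) i := by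
  -- The scaling gives `s i ^ 2 = p i / 4`, which matches the quarter in the complex Hessian.
  set s : Fin n → ℝ := fun i => √(p i) / 2 with hs
  have hspos : ∀ i, 0 < s i := fun i => by
    have := Real.sqrt_pos.2 (hp i)
    simp only [hs]; positivity
  -- The transpose makes `M` send `e_j` to `s j` times the `j`-th row of `U`.
  set M : Matrix (Fin n) (Fin n) ℂ := Uᵀ * diagonal (fun i => (s i : ℂ)) with hM
  set M' : Matrix (Fin n) (Fin n) ℂ := diagonal (fun i => ((s i)⁻¹ : ℂ)) * (star U)ᵀ with hM'
  have hinv : M' * M = 1 := by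
    have h1 : (star U)ᵀ * Uᵀ = 1 := by
      rw [← transpose_mul, mem_unitaryGroup_iff.1 hU, transpose_one]
    rw [hM, hM', Matrix.mul_assoc, ← Matrix.mul_assoc _ Uᵀ, h1, Matrix.one_mul, diagonal_mul_diagonal,
      ← diagonal_one]
    congr 1
    ext i
    rw [inv_mul_cancel₀]
    exact_mod_cast (hspos i).ne'
  let L : Cn n →ₗ[ℝ] Cn n := (Matrix.toEuclideanLin M).restrictScalars ℝ
  have hLapply : ∀ x : Cn n, L x = WithLp.toLp 2 (M *ᵥ x.ofLp) := fun x => rfl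
  have hinj : Function.Injective L := by
    intro x y hxy
    rw [hLapply, hLapply] at hxy
    have h1 : M *ᵥ x.ofLp = M *ᵥ y.ofLp := by simpa using hxy
    have h2 := congrArg (fun v => M' *ᵥ v) h1
    simp only [mulVec_mulVec, hinv, one_mulVec] at h2
    ext k
    exact congrFun h2 k
  let T : Cn n ≃L[ℝ] Cn n := (LinearEquiv.ofInjectiveEndo L hinj).toContinuousLinearEquiv
  have hT : ∀ (j : Fin n) (c : ℂ), T (EuclideanSpace.single j c) =
      s j • (WithLp.toLp 2 (c • U j) : Cn n) := by
    intro j c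
    change L _ = _
    rw [hLapply]
    ext k
    rw [hM]
    simp [Matrix.mul_diagonal]
    ring
  refine ⟨T, fun q z => ?_⟩
  rw [secondOrderOp_realBasis_comp]
  refine Finset.sum_congr rfl fun j _ => ?_
  have hsq : s j * s j = p j / 4 := by
    simp only [hs]
    rw [div_mul_div_comm, Real.mul_self_sqrt (hp j).le]; norm_num
  rw [hT, hT, hess_smul_smul, hess_smul_smul, hsq, one_smul, diagConj_complexHessian]
  ring

/-- The complex Hessian of `|z|²` is the identity. The summand `1` keeps the correction positive at
the origin, which later yields strict inequalities. -/
theorem complexHessian_add_const_mul_normSq {q : Cn n → ℝ} {z : Cn n} (hq : ContDiffAt ℝ 2 q z)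
    (c : ℝ) : complexHessian (fun x => q x + c * (1 + ‖x‖ ^ 2)) z =
      complexHessian q z + (c : ℂ) • 1 := by
  have h0 : ContDiffAt ℝ 2 (fun x : Cn n => ‖x - 0‖ ^ 2) z := (contDiff_norm_sub_sq 0).contDiffAt
  have h1 : ContDiffAt ℝ 2 (fun x : Cn n => c * (1 + ‖x‖ ^ 2)) z := by
    simp only [sub_zero] at h0
    exact contDiffAt_const.mul (contDiffAt_const.add h0)
  have hh : ∀ v w : Cn n, hess (fun x : Cn n => c * (1 + ‖x‖ ^ 2)) z v w = 2 * c * inner ℝ v w := by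
    intro v w
    have h2 := hess_norm_sub_sq (0 : Cn n) z v w
    simp only [sub_zero] at h2 h0
    rw [hess_const_mul (contDiffAt_const.add h0), hess_add contDiffAt_const h0, hess_const, h2]
    ring
  have hs : ∀ v w : Cn n, secondDeriv (fun x => q x + c * (1 + ‖x‖ ^ 2)) z v w =
      secondDeriv q z v w + 2 * c * inner ℝ v w := by
    intro v w
    rw [secondDeriv_eq_hess, secondDeriv_eq_hess, hess_add hq h1, hh]
  have hin : ∀ (j k : Fin n) (a b : ℂ), inner ℝ (EuclideanSpace.single j a : Cn n)
      (EuclideanSpace.single k b) = if j = k then inner ℝ a b else 0 := by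
    intro j k a b
    rw [PiLp.inner_apply]
    rw [Finset.sum_eq_single j]
    · by_cases h : j = k
      · subst h; simp
      · simp [h]
    · intro l _ hl
      simp [hl]
    · simp
  ext j k
  simp only [complexHessian, hs, hin, of_apply, Matrix.add_apply, Matrix.smul_apply, one_apply]
  by_cases h : j = k
  · subst h
    simp [Complex.inner]
    ring
  · simp [h]

end Levi

/-! ### Standard mollifiers and the shrunken domains. -/

section Mollifier

variable {n : ℕ} {χ : Cn n → ℝ} {ε : ℝ} {Ω : Set (Cn n)}

theorem isAveragingKernel_mollifier (hχ : IsStandardMollifier χ) (hε : 0 < ε) :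
    IsAveragingKernel (volume : Measure (Cn n)) ε (mollifier χ ε) where
  contDiff := contDiff_const.mul (hχ.contDiff.comp (contDiff_const_smul _))
  nonneg z := mul_nonneg (by positivity) (hχ.nonneg _)
  radial x y h := by
    unfold mollifier
    rw [hχ.radial (ε⁻¹ • x) (ε⁻¹ • y) (by rw [norm_smul, norm_smul, h])]
  eq_zero x hx := by
    have : ε⁻¹ • x ∉ Function.support χ := by
      intro hmem
      have h1 := mem_closedBall_zero_iff.1 (hχ.support_subset hmem)
      rw [norm_smul, norm_inv, Real.norm_of_nonneg hε.le, inv_mul_le_iff₀ hε] at h1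
      linarith
    rw [mollifier, Function.notMem_support.1 this, mul_zero]
  integral_eq_one := by
    unfold mollifier
    have hfin : Module.finrank ℝ (Cn n) = 2 * n := by
      rw [finrank_real_of_complex, finrank_euclideanSpace_fin]
    rw [integral_const_mul, Measure.integral_comp_smul, hχ.integral_eq_one, hfin,
      abs_of_pos (by positivity), inv_pow, inv_inv, smul_eq_mul, mul_one,
      inv_mul_cancel₀ (by positivity)]

/-- The ball is connected and misses the frontier, so it cannot meet both the interior and the
exterior of `Ω`. -/
theorem closedBall_subset_of_mem_shrink {z : Cn n} (hε : 0 ≤ ε) (hz : z ∈ shrink Ω ε) :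
    Metric.closedBall z ε ⊆ Ω := by
  have hfr : ∀ y ∈ Metric.closedBall z ε, y ∉ frontier Ω := fun y hy hyfr => by
    have h1 := Metric.infDist_le_dist_of_mem (x := z) hyfr
    rw [Metric.mem_closedBall, dist_comm] at hy
    linarith [hz.2]
  have hz' : z ∈ Metric.closedBall z ε := Metric.mem_closedBall_self hε
  intro w hw
  by_contra hwΩ
  have hint : ∀ y ∈ Metric.closedBall z ε, y ∉ interior Ω → y ∉ closure Ω := fun y hy hyi hyc =>
    hfr y hy ⟨hyc, hyi⟩
  obtain ⟨y, -, hy1, hy2⟩ := (convex_closedBall z ε).isPreconnected (interior Ω) (closure Ω)ᶜ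
    isOpen_interior isClosed_closure.isOpen_compl
    (fun y hy => or_iff_not_imp_left.2 (hint y hy))
    ⟨z, hz', not_imp_not.1 (hint z hz') (subset_closure hz.1)⟩
    ⟨w, hw, hint w hw fun h => hwΩ (interior_subset h)⟩
  exact hy2 (subset_closure (interior_subset hy1))

/-- The frontier must be nonempty because `Metric.infDist` to the empty set is `0`. -/
theorem mem_shrink_of_closedBall_subset (hΩ : IsOpen Ω) (hfr : (frontier Ω).Nonempty) {z : Cn n}
    {R : ℝ} (hε : 0 ≤ ε) (hR : ε < R) (hz : Metric.closedBall z R ⊆ Ω) : z ∈ shrink Ω ε := by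
  refine ⟨hz (Metric.mem_closedBall_self (hε.trans hR.le)), hR.trans_le ?_⟩
  rw [Metric.le_infDist hfr]
  intro y hy
  by_contra! hlt
  have : y ∈ Ω := hz (by rw [Metric.mem_closedBall, dist_comm]; exact hlt.le)
  rw [hΩ.frontier_eq] at hy
  exact hy.2 this

theorem isOpen_shrink (hΩ : IsOpen Ω) : IsOpen (shrink Ω ε) :=
  hΩ.inter (isOpen_lt continuous_const (Metric.continuous_infDist_pt _))

end Mollifier

/-! ### From `F(Hu)` to families of linear operators, and convolution of subsolutions. -/

section Linearization

variable {n : ℕ} {Γ : Set (Fin n → ℝ)} {f : (Fin n → ℝ) → ℝ} {Ω : Set (Cn n)}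

/-- The pairs `(a, T)` for which `a + Δ` in the real linear coordinates given by `T` dominates the
operator `q ↦ F(Hq)`. -/
def dominatingOps (Γ : Set (Fin n → ℝ)) (f : (Fin n → ℝ) → ℝ) : Set (ℝ × (Cn n ≃L[ℝ] Cn n)) :=
  {aT | ∃ p, IsMajorant Γ f aT.1 p ∧ ∃ U ∈ Matrix.unitaryGroup (Fin n) ℂ,
    ∀ (q : Cn n → ℝ) (z : Cn n), secondOrderOp (fun k => aT.2 (realBasis n k)) q z =
      ∑ i, p i * diagConj U (complexHessian q z) i}

theorem coe_le_fOp_complexHessian_iff (hΓ : IsAdmissibleCone Γ) (hf : IsAdmissibleFunction Γ f)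
    {q : Cn n → ℝ} {z : Cn n} (hq : ContDiffAt ℝ 2 q z) {c : ℝ} :
    (c : EReal) ≤ FOp Γ f (complexHessian q z) ↔ ∀ aT ∈ dominatingOps Γ f,
      c ≤ aT.1 + secondOrderOp (fun k => aT.2 (realBasis n k)) q z := by
  rw [coe_le_fOp_iff_majorants hΓ hf (isHermitian_complexHessian hq)]
  constructor
  · rintro h ⟨a, T⟩ ⟨p, hap, U, hU, hT⟩
    rw [hT]
    exact h a p hap U hU
  · intro h a p hap U hU
    obtain ⟨T, hT⟩ := exists_equiv_secondOrderOp_eq hap.pos hU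
    have := h (a, T) ⟨p, hap, U, hU, hT⟩
    rwa [hT] at this

/-- Since `Γ ⊆ Γ_1` the complex Hessian has nonnegative trace; this makes every viscosity
subsolution subharmonic. -/
theorem laplacian_nonneg_of_coe_le_fOp (hΓ : IsAdmissibleCone Γ)
    {q : Cn n → ℝ} {z : Cn n} (hq : ContDiffAt ℝ 2 q z) {c : ℝ}
    (h : (c : EReal) ≤ FOp Γ f (complexHessian q z)) :
    0 ≤ secondOrderOp (realBasis n) q z := by
  rw [secondOrderOp_realBasis]
  have hA := isHermitian_complexHessian hq
  have := sum_diagConj_nonneg hΓ hA ((coe_le_fOp_iff hΓ hA).1 h).1 (one_mem _)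
  linarith

theorem zero_le_fOp_of_mem_mGamma (hΓ : IsAdmissibleCone Γ) (hf : IsAdmissibleFunction Γ f)
    {A : Matrix (Fin n) (Fin n) ℂ} (h : A ∈ MGamma Γ) : ((0 : ℝ) : EReal) ≤ FOp Γ f A := by
  obtain ⟨hA, hmem⟩ := h
  rw [coe_le_fOp_iff hΓ hA]
  exact ⟨subset_closure hmem, (hf.pos _ hmem).le⟩

theorem mem_closure_mGamma_of_coe_le_fOp {A : Matrix (Fin n) (Fin n) ℂ} {c : ℝ}
    (h : (c : EReal) ≤ FOp Γ f A) : A.IsHermitian ∧ A ∈ closure (MGamma Γ) := by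
  unfold FOp at h
  split_ifs at h with hA
  · exact hA
  · simp at h

variable {u : Cn n → EReal} {g : Cn n → ℝ}

theorem IsViscositySubsolution.laplacian_nonneg (hΓ : IsAdmissibleCone Γ)
    (h : IsViscositySubsolution Γ f Ω (fun z _ => g z) u) :
    ∀ x ∈ Ω, ∀ q, TouchesAbove u x q → 0 ≤ secondOrderOp (realBasis n) q x :=
  fun x hx q hq => laplacian_nonneg_of_coe_le_fOp hΓ hq.1 (h x hx q hq)

theorem IsViscositySubsolution.zero (hg : ∀ z ∈ Ω, 0 ≤ g z)
    (h : IsViscositySubsolution Γ f Ω (fun z _ => g z) u) :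
    IsViscositySubsolution Γ f Ω (fun _ _ => 0) u :=
  fun x hx q hq => le_trans (EReal.coe_le_coe_iff.2 (hg x hx)) (h x hx q hq)

theorem IsViscositySubsolution.ae_ne_bot_and_locallyIntegrableOn (hn : 1 ≤ n)
    (hΓ : IsAdmissibleCone Γ) (hΩ : IsOpen Ω) (hconn : IsConnected Ω) (hu : IsUSC Ω u)
    (hmeas : Measurable u) (h : IsViscositySubsolution Γ f Ω (fun z _ => g z) u) :
    (∀ᵐ x, x ∈ Ω → u x ≠ ⊥) ∧ LocallyIntegrableOn (fun x => (u x).toReal) Ω volume := by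
  have : NeZero n := ⟨by omega⟩
  have : Nontrivial (Cn n) := inferInstance
  exact HessianViscosity.ae_ne_bot_and_locallyIntegrableOn (realBasis n) hmeas hΩ
    hconn.isPreconnected hu.upperSemicontinuousOn hu.ne_top hu.not_identically_bot
    (h.laplacian_nonneg hΓ)

theorem conv_sub_const {E : Type*} [NormedAddCommGroup E] [InnerProductSpace ℝ E]
    [FiniteDimensional ℝ E] [MeasurableSpace E] [BorelSpace E] {μ : Measure E} [μ.IsAddHaarMeasure]
    {ε : ℝ} {η g : E → ℝ} {z : E} (h : IsAveragingKernel μ ε η)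
    (hg : IntegrableOn g (Metric.closedBall z ε) μ) (a : ℝ) :
    conv μ (fun x => g x - a) η z = conv μ g η z - a := by
  have h1 := integrable_conv_integrand h hg
  have h2 := integrable_conv_integrand h
    (integrableOn_const (measure_closedBall_lt_top (x := z) (r := ε) (μ := μ)).ne (C := a))
  conv_rhs => rw [← conv_const h a z]
  rw [conv_apply, conv_apply, conv_apply, ← integral_sub h1 h2]
  simp only [sub_mul]

/-- Each dominating operator gives a linear viscosity inequality with right-hand side `g - a`.
Convolution preserves it, and all of them together give the inequality for `F`. -/
theorem IsViscositySubsolution.conv_le_fOp (hn : 1 ≤ n)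
    (hΓ : IsAdmissibleCone Γ) (hf : IsAdmissibleFunction Γ f) (hΩ : IsOpen Ω)
    (hconn : IsConnected Ω) (hu : IsUSC Ω u)
    (hmeas : Measurable u) (h : IsViscositySubsolution Γ f Ω (fun z _ => g z) u)
    (hg : ContinuousOn g Ω) {ε : ℝ} {η : Cn n → ℝ} (hε : 0 ≤ ε)
    (hη : IsAveragingKernel volume ε η) {z : Cn n} (hz : Metric.closedBall z ε ⊆ Ω) :
    ((conv volume g η z : ℝ) : EReal) ≤
      FOp Γ f (complexHessian (conv volume (fun x => (u x).toReal) η) z) := by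
  have : NeZero n := ⟨by omega⟩
  have : Nontrivial (Cn n) := inferInstance
  obtain ⟨hae, hloc⟩ := h.ae_ne_bot_and_locallyIntegrableOn hn hΓ hΩ hconn hu hmeas
  have hcd : ContDiffAt ℝ 2 (conv volume (fun x => (u x).toReal) η) z :=
    (contDiffAt_conv hΩ hε hη hloc hz).of_le ENat.LEInfty.out
  rw [coe_le_fOp_complexHessian_iff hΓ hf hcd]
  rintro ⟨a, T⟩ haT
  have h1 := conv_le_secondOrderOp_conv (realBasis n) hmeas hΩ hu.upperSemicontinuousOn hu.ne_top
    hae hloc T (g := fun x => g x - a) (hg.sub continuousOn_const) (by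
      intro x hx q hq
      have := (coe_le_fOp_complexHessian_iff hΓ hf hq.1).1 (h x hx q hq) _ haT
      dsimp only at this ⊢
      linarith) hε hη hz
  rw [conv_sub_const hη ((hg.mono hz).integrableOn_compact (isCompact_closedBall _ _))] at h1
  dsimp only
  linarith

end Linearization

/-! ### The equivalences between viscosity, smooth approximation and mollification. -/

section Approximation

variable {n : ℕ} {Γ : Set (Fin n → ℝ)} {f : (Fin n → ℝ) → ℝ} {Ω : Set (Cn n)}
  {u : Cn n → EReal} {χ : Cn n → ℝ}

/-- Dini's argument: an inequality holding at one index near a point persists for later indices by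
monotonicity. -/
theorem eventually_lt_on_compact_of_antitone {X : Type*} [TopologicalSpace X] {K : Set X}
    (hK : IsCompact K) {u : X → EReal} {v : ℕ → X → ℝ} {φ : X → ℝ}
    (hv : ∀ j, ContinuousOn (v j) K) (hφ : ContinuousOn φ K)
    (hanti : ∀ x ∈ K, Antitone fun j => v j x)
    (hlim : ∀ x ∈ K, Tendsto (fun j => ((v j x : ℝ) : EReal)) atTop (𝓝 (u x)))
    (hlt : ∀ x ∈ K, u x < φ x) : ∀ᶠ j in atTop, ∀ x ∈ K, v j x < φ x := by
  suffices ∀ᶠ j in atTop, ∀ x ∈ K, x ∈ K → v j x < φ x from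
    this.mono fun j hj x hx => hj x hx hx
  refine hK.induction_on (p := fun s => ∀ᶠ j in atTop, ∀ x ∈ s, x ∈ K → v j x < φ x) ?_ ?_ ?_ ?_
  · simp
  · exact fun s t hst ht => ht.mono fun j hj x hx => hj x (hst hx)
  · exact fun s t hs ht => (hs.and ht).mono fun j hj x hx => hx.elim (hj.1 x) (hj.2 x)
  · intro x hx
    obtain ⟨J, hJ⟩ := ((hlim x hx).eventually_lt_const (hlt x hx)).exists
    rw [EReal.coe_lt_coe_iff] at hJ
    refine ⟨{y | v J y < φ y}, ((hv J x hx).eventually_lt (hφ x hx) hJ), ?_⟩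
    filter_upwards [eventually_ge_atTop J] with j hj y hy hyK
    exact (hanti y hyK hj).trans_lt hy

theorem IsGammaSubharmonic.isViscositySubsolution (hΓ : IsAdmissibleCone Γ)
    (hf : IsAdmissibleFunction Γ f) (hΩ : IsOpen Ω) (h : IsGammaSubharmonic Γ Ω u) :
    IsViscositySubsolution Γ f Ω (fun _ _ => 0) u := by
  intro z₀ hz₀ q hq
  refine (coe_le_fOp_complexHessian_iff hΓ hf hq.1).2 fun aT haT => ?_
  obtain ⟨R, hR, hsub⟩ := Metric.nhds_basis_closedBall.mem_iff.1 (hΩ.mem_nhds hz₀)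
  obtain ⟨v, hv1, hv2, hv3⟩ := h (Metric.ball z₀ R) Metric.isOpen_ball
    ((isCompact_closedBall z₀ R).of_isClosed_subset isClosed_closure Metric.closure_ball_subset_closedBall)
    (Metric.closure_ball_subset_closedBall.trans hsub)
  have hcd : ∀ j, ∀ z ∈ Metric.ball z₀ R, ContDiffAt ℝ 2 (v j) z := fun j z hz =>
    (((hv1 j).1.contDiffAt (Metric.isOpen_ball.mem_nhds hz))).of_le ENat.LEInfty.out
  have hanti : ∀ z ∈ Metric.ball z₀ R, Antitone fun j => v j z := fun z hz =>
    antitone_nat_of_succ_le (hv2 z hz)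
  have hmem := Metric.mem_ball_self (x := z₀) hR
  have key := le_secondOrderOp_of_approx (fun k => aT.2 (realBasis n k)) (g₀ := -aT.1) hR
    (Eventually.of_forall hcd)
    (Eventually.of_forall fun j => Antitone.le_of_tendsto
      (f := fun j => ((v j z₀ : ℝ) : EReal))
      (fun i j hij => EReal.coe_le_coe_iff.2 (hanti z₀ hmem hij)) (hv3 z₀ hmem) j)
    (fun K hK hKs φ hφ hlt => eventually_lt_on_compact_of_antitone hK
      (fun j z hz => (hcd j z (hKs hz)).continuousAt.continuousWithinAt) hφ
      (fun z hz => hanti z (hKs hz)) (fun z hz => hv3 z (hKs hz)) hlt)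
    (fun c hc => ⟨R, hR, Eventually.of_forall fun j z hz => by
      have := (coe_le_fOp_complexHessian_iff hΓ hf (hcd j z hz)).1
        (zero_le_fOp_of_mem_mGamma hΓ hf ((hv1 j).2 z hz)) aT haT
      linarith⟩) hq
  linarith

theorem exists_seq_of_step {P : ℕ → ℝ → Prop} {Q : ℕ → ℝ → ℝ → Prop} (h0 : ∃ e, P 0 e)
    (hstep : ∀ j e, P j e → ∃ e', P (j + 1) e' ∧ Q j e e') :
    ∃ ε : ℕ → ℝ, (∀ j, P j (ε j)) ∧ ∀ j, Q j (ε j) (ε (j + 1)) := by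
  obtain ⟨e₀, he₀⟩ := h0
  choose! next hnext using hstep
  let ε : ℕ → ℝ := fun j => Nat.rec e₀ (fun j e => next j e) j
  have hP : ∀ j, P j (ε j) := fun j => by
    induction j with
    | zero => exact he₀
    | succ j ih => exact (hnext j _ ih).1
  exact ⟨ε, hP, fun j => (hnext j _ (hP j)).2⟩

/-- Convolutions have Hessians in the closure of `M(Γ, n)`; adding a positive multiple of `1 + |z|²`
moves them into `M(Γ, n)`. The decreasing weights leave room to choose each radius so small that the
next function lies below the previous one. -/
theorem IsViscositySubsolution.isGammaSubharmonic (hn : 1 ≤ n) (hΓ : IsAdmissibleCone Γ)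
    (hf : IsAdmissibleFunction Γ f) (hΩ : IsOpen Ω) (hconn : IsConnected Ω) (hu : IsUSC Ω u)
    (hmeas : Measurable u) (hχ : IsStandardMollifier χ)
    (h : IsViscositySubsolution Γ f Ω (fun _ _ => 0) u) : IsGammaSubharmonic Γ Ω u := by
  have : NeZero n := ⟨by omega⟩
  have : Nontrivial (Cn n) := inferInstance
  intro U hU hK hKΩ
  obtain ⟨R, hR, hthick⟩ := hK.exists_cthickening_subset_open hΩ hKΩ
  have hball : ∀ z ∈ closure U, ∀ ε ≤ R, Metric.closedBall z ε ⊆ Ω := fun z hz ε hε =>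
    (Metric.closedBall_subset_closedBall hε).trans
      ((Metric.closedBall_subset_cthickening hz R).trans hthick)
  obtain ⟨hae, hloc⟩ :=
    h.ae_ne_bot_and_locallyIntegrableOn (g := fun _ => 0) hn hΓ hΩ hconn hu hmeas
  set w : ℝ → Cn n → ℝ := fun ε => conv volume (fun x => (u x).toReal) (mollifier χ ε) with hw
  have hker := fun ε (hε : 0 < ε) => isAveragingKernel_mollifier hχ hε
  have hcd : ∀ ε, 0 < ε → ε ≤ R → ∀ z ∈ closure U, ContDiffAt ℝ ∞ (w ε) z :=
    fun ε h0 h1 z hz => contDiffAt_conv hΩ h0.le (hker ε h0) hloc (hball z hz ε h1)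
  have hle : ∀ ε, 0 < ε → ε ≤ R → ∀ z ∈ closure U, u z ≤ (w ε z : ℝ) := fun ε h0 h1 z hz =>
    le_conv (realBasis n) hmeas hu.upperSemicontinuousOn hu.ne_top hae hloc
      (h.laplacian_nonneg (g := fun _ => 0) hΓ) h0.le (hker ε h0) (hball z hz ε h1)
  set W : ℕ → ℝ → Cn n → ℝ := fun j ε z => w ε z + 1 / ((j : ℝ) + 1) * (1 + ‖z‖ ^ 2) with hWdef
  obtain ⟨ε, hP, hQ⟩ := exists_seq_of_step
    (P := fun j e => 0 < e ∧ e ≤ R ∧ e ≤ 1 / ((j : ℝ) + 1))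
    (Q := fun j e e' => ∀ z ∈ closure U, W (j + 1) e' z < W j e z)
    ⟨min R 1, by positivity, min_le_left _ _, by simp⟩ (by
      rintro j e ⟨he0, heR, -⟩
      have hcont : ContinuousOn (fun z => W j e z - 1 / (((j + 1 : ℕ) : ℝ) + 1) * (1 + ‖z‖ ^ 2))
          (closure U) := by
        have h1 : ContinuousOn (w e) (closure U) := fun z hz =>
          (hcd e he0 heR z hz).continuousAt.continuousWithinAt
        simp only [hWdef]
        fun_prop
      -- The weight drops from `1/(j+1)` to `1/(j+2)`, so even after subtracting the next correction
      -- a continuous strict majorant of `u` remains. Small convolutions lie below it on the compact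
      -- `closure U`.
      have hltW : ∀ z ∈ closure U,
          u z < ((W j e z - 1 / (((j + 1 : ℕ) : ℝ) + 1) * (1 + ‖z‖ ^ 2) : ℝ) : EReal) := by
        intro z hz
        refine (hle e he0 heR z hz).trans_lt (EReal.coe_lt_coe_iff.2 ?_)
        have h1 : 1 / (((j + 1 : ℕ) : ℝ) + 1) < 1 / ((j : ℝ) + 1) := by
          apply one_div_lt_one_div_of_lt (by positivity)
          push_cast; linarith
        have h2 : 0 < 1 + ‖z‖ ^ 2 := by positivity
        simp only [hWdef]
        nlinarith
      obtain ⟨ε₀, hε₀, hlt⟩ := exists_conv_lt_on_compact hΩ hu.upperSemicontinuousOn hu.ne_top hae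
        hloc hK hKΩ hcont hltW
      refine ⟨min (ε₀ / 2) (min R (1 / (((j + 1 : ℕ) : ℝ) + 1))), ⟨by positivity,
        (min_le_right _ _).trans (min_le_left _ _),
        (min_le_right _ _).trans (min_le_right _ _)⟩, fun z hz => ?_⟩
      have hpos : 0 < min (ε₀ / 2) (min R (1 / (((j + 1 : ℕ) : ℝ) + 1))) := by positivity
      have := hlt _ hpos.le ((min_le_left _ _).trans_lt (half_lt_self hε₀)) _ (hker _ hpos) z hz
      simp only [hWdef, hw] at this ⊢
      linarith)
  refine ⟨fun j => W j (ε j), fun j => ⟨?_, ?_⟩, fun z hz j => (hQ j z (subset_closure hz)).le, ?_⟩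
  · intro z hz
    refine ContDiffAt.contDiffWithinAt ?_
    exact (hcd _ (hP j).1 (hP j).2.1 z (subset_closure hz)).add
      (contDiffAt_const.mul (contDiffAt_const.add (contDiffAt_id.norm_sq ℝ)))
  · intro z hz
    have hz' := subset_closure hz
    have h2 : ContDiffAt ℝ 2 (w (ε j)) z :=
      (hcd _ (hP j).1 (hP j).2.1 z hz').of_le ENat.LEInfty.out
    obtain ⟨hA, hmem⟩ := mem_closure_mGamma_of_coe_le_fOp
      (h.conv_le_fOp (g := fun _ => 0) hn hΓ hf hΩ hconn hu hmeas continuousOn_const (hP j).1.le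
        (hker _ (hP j).1) (hball z hz' _ (hP j).2.1))
    simp only [hWdef]
    rw [complexHessian_add_const_mul_normSq h2]
    exact add_smul_one_mem_mGamma hΓ hA hmem (by positivity)
  · intro z hz
    have hz' := subset_closure hz
    have hlow : ∀ j, u z ≤ (W j (ε j) z : ℝ) := fun j =>
      (hle _ (hP j).1 (hP j).2.1 z hz').trans (EReal.coe_le_coe_iff.2
        (le_add_of_nonneg_right (by positivity)))
    -- All approximants lie above `u z`. For `u z < t < s < a` the convolution drops below `t` and
    -- the correction below `s - t`, because the radii tend to `0`.
    rw [tendsto_order]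
    refine ⟨fun a ha => Eventually.of_forall fun j => ha.trans_le (hlow j), fun a ha => ?_⟩
    obtain ⟨s, hs1, hs2⟩ := EReal.lt_iff_exists_real_btwn.1 ha
    obtain ⟨t, ht1, ht2⟩ := EReal.lt_iff_exists_real_btwn.1 hs1
    rw [EReal.coe_lt_coe_iff] at ht2
    obtain ⟨ε₀, hε₀, hlt⟩ := exists_conv_lt_on_compact hΩ hu.upperSemicontinuousOn hu.ne_top hae
      hloc (isCompact_singleton (x := z)) (singleton_subset_iff.2 (hKΩ hz')) (φ := fun _ => t)
      continuousOn_const (by simpa using ht1)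
    have hlim : Tendsto (fun j : ℕ => 1 / ((j : ℝ) + 1)) atTop (𝓝 0) :=
      tendsto_one_div_add_atTop_nhds_zero_nat
    have hlim2 : Tendsto (fun j : ℕ => 1 / ((j : ℝ) + 1) * (1 + ‖z‖ ^ 2)) atTop (𝓝 0) := by
      simpa using hlim.mul_const (1 + ‖z‖ ^ 2)
    filter_upwards [hlim.eventually_lt_const hε₀, hlim2.eventually_lt_const (sub_pos.2 ht2)]
      with j hj1 hj2
    refine (EReal.coe_lt_coe_iff.2 ?_).trans hs2
    have := hlt _ (hP j).1.le ((hP j).2.2.trans_lt hj1) _ (hker _ (hP j).1) z rfl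
    simp only [hWdef, hw]
    linarith

/-- The convolutions with `ε = 1/(j+1)` lie above `u` and are eventually below any continuous strict
majorant on compact sets, so stability applies to each dominating operator separately. -/
theorem isViscositySubsolution_of_classical (hn : 1 ≤ n) (hΓ : IsAdmissibleCone Γ)
    (hf : IsAdmissibleFunction Γ f) (hΩ : IsOpen Ω) (hconn : IsConnected Ω)
    (hfr : (frontier Ω).Nonempty) (hu : IsUSC Ω u)
    (hmeas : Measurable u) (hχ : IsStandardMollifier χ) {ψ : Cn n → ℝ} (hψ : ContinuousOn ψ Ω)
    (h : IsViscositySubsolution Γ f Ω (fun _ _ => 0) u)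
    (hcl : ∀ ε, 0 < ε → IsClassicalSubsolution Γ f (shrink Ω ε) (mollify χ ε ψ)
      (mollify χ ε fun z => (u z).toReal)) :
    IsViscositySubsolution Γ f Ω (fun z _ => ψ z) u := by
  have : NeZero n := ⟨by omega⟩
  have : Nontrivial (Cn n) := inferInstance
  obtain ⟨hae, hloc⟩ :=
    h.ae_ne_bot_and_locallyIntegrableOn (g := fun _ => 0) hn hΓ hΩ hconn hu hmeas
  intro z₀ hz₀ q hq
  refine (coe_le_fOp_complexHessian_iff hΓ hf hq.1).2 fun aT haT => ?_
  obtain ⟨R, hR, hsub⟩ := Metric.nhds_basis_closedBall.mem_iff.1 (hΩ.mem_nhds hz₀)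
  have hker := fun ε (hε : 0 < ε) => isAveragingKernel_mollifier hχ hε
  have hpos : ∀ j : ℕ, 0 < 1 / ((j : ℝ) + 1) := fun j => by positivity
  have hlim : Tendsto (fun j : ℕ => 1 / ((j : ℝ) + 1)) atTop (𝓝 0) :=
    tendsto_one_div_add_atTop_nhds_zero_nat
  have hball : ∀ z ∈ Metric.ball z₀ (R / 2), Metric.closedBall z (R / 2) ⊆ Ω := fun z hz =>
    (Metric.closedBall_subset_closedBall' (by
      have := Metric.mem_ball.1 hz; linarith)).trans hsub
  have hsmall := hlim.eventually_lt_const (half_pos hR)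
  have hcd : ∀ᶠ j : ℕ in atTop, ∀ z ∈ Metric.ball z₀ (R / 2),
      ContDiffAt ℝ 2 (mollify χ (1 / ((j : ℝ) + 1)) fun z => (u z).toReal) z := by
    filter_upwards [hsmall] with j hj z hz
    exact (contDiffAt_conv hΩ (hpos j).le (hker _ (hpos j)) hloc
      ((Metric.closedBall_subset_closedBall hj.le).trans (hball z hz))).of_le ENat.LEInfty.out
  have key := le_secondOrderOp_of_approx (fun k => aT.2 (realBasis n k)) (g₀ := ψ z₀ - aT.1)
    (half_pos hR) hcd (u := u) ?_ ?_ ?_ hq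
  · change ψ z₀ ≤ _
    linarith
  · filter_upwards [hsmall] with j hj
    exact le_conv (realBasis n) hmeas hu.upperSemicontinuousOn hu.ne_top hae hloc
      (h.laplacian_nonneg (g := fun _ => 0) hΓ) (hpos j).le (hker _ (hpos j))
      ((Metric.closedBall_subset_closedBall hj.le).trans
        (hball z₀ (Metric.mem_ball_self (half_pos hR))))
  · intro K hK hKs φ hφ hlt
    obtain ⟨ε₀, hε₀, hlt⟩ := exists_conv_lt_on_compact hΩ hu.upperSemicontinuousOn hu.ne_top hae
      hloc hK (fun z hz => hball z (hKs hz) (Metric.mem_closedBall_self (half_pos hR).le)) hφ hlt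
    filter_upwards [hlim.eventually_lt_const hε₀] with j hj
    exact hlt _ (hpos j).le hj _ (hker _ (hpos j))
  · intro c hc
    -- Continuity of `ψ` keeps it above `c + a` near `z₀`, and its averages over small balls inherit
    -- the bound.
    have hψ' : ∀ᶠ z in 𝓝 z₀, c + aT.1 < ψ z :=
      (hψ.continuousAt (hΩ.mem_nhds hz₀)).eventually_const_lt (by linarith)
    obtain ⟨r, hr, hrψ⟩ := Metric.eventually_nhds_iff_ball.1 hψ'
    refine ⟨min (r / 2) (R / 2), by positivity, ?_⟩
    filter_upwards [hsmall, hcd, hlim.eventually_lt_const (half_pos hr)] with j hj hcdj hjr z hz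
    have hzR : z ∈ Metric.ball z₀ (R / 2) := Metric.ball_subset_ball (min_le_right _ _) hz
    have hzr : dist z z₀ < r / 2 := Metric.ball_subset_ball (min_le_left _ _) hz
    have hzsub : Metric.closedBall z (1 / ((j : ℝ) + 1)) ⊆ Ω :=
      (Metric.closedBall_subset_closedBall hj.le).trans (hball z hzR)
    have h1 : c + aT.1 ≤ mollify χ (1 / ((j : ℝ) + 1)) ψ z := by
      rw [← conv_const (hker _ (hpos j)) (c + aT.1) z]
      refine conv_le_of_le_on_ball (hker _ (hpos j))
        (integrableOn_const measure_closedBall_lt_top.ne)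
        ((hψ.mono hzsub).integrableOn_compact (isCompact_closedBall _ _))
        (Eventually.of_forall fun t ht => (hrψ t ?_).le)
      rw [Metric.mem_ball]
      linarith [dist_triangle t z z₀, Metric.mem_closedBall.1 ht]
    have h2 := (coe_le_fOp_complexHessian_iff hΓ hf (hcdj z hzR)).1
      ((hcl _ (hpos j)).2 z
        (mem_shrink_of_closedBall_subset hΩ hfr (hpos j).le hj (hball z hzR))) aT haT
    linarith

theorem IsViscositySubsolution.isClassicalSubsolution (hn : 1 ≤ n) (hΓ : IsAdmissibleCone Γ)
    (hf : IsAdmissibleFunction Γ f) (hΩ : IsOpen Ω) (hconn : IsConnected Ω) (hu : IsUSC Ω u)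
    (hmeas : Measurable u) (hχ : IsStandardMollifier χ) {ψ : Cn n → ℝ} (hψ : ContinuousOn ψ Ω)
    (h : IsViscositySubsolution Γ f Ω (fun z _ => ψ z) u) {ε : ℝ} (hε : 0 < ε) :
    IsClassicalSubsolution Γ f (shrink Ω ε) (mollify χ ε ψ)
      (mollify χ ε fun z => (u z).toReal) := by
  have hker := isAveragingKernel_mollifier hχ hε
  obtain ⟨hae, hloc⟩ := h.ae_ne_bot_and_locallyIntegrableOn hn hΓ hΩ hconn hu hmeas
  refine ⟨fun z hz => ?_, fun z hz => ?_⟩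
  · exact ((contDiffAt_conv hΩ hε.le hker hloc
      (closedBall_subset_of_mem_shrink hε.le hz)).of_le ENat.LEInfty.out).contDiffWithinAt
  · exact h.conv_le_fOp hn hΓ hf hΩ hconn hu hmeas hψ hε.le hker
      (closedBall_subset_of_mem_shrink hε.le hz)

end Approximation

/-! ### Independence of the values of `u` outside `Ω`. -/

section Restriction

variable {n : ℕ} {Γ : Set (Fin n → ℝ)} {f : (Fin n → ℝ) → ℝ} {Ω : Set (Cn n)}
  {u v : Cn n → EReal} {χ : Cn n → ℝ}

theorem IsUSC.congr (h : EqOn u v Ω) (hu : IsUSC Ω u) : IsUSC Ω v where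
  upperSemicontinuousOn := by
    intro x hx y hy
    rw [← h hx] at hy
    filter_upwards [hu.upperSemicontinuousOn x hx y hy, self_mem_nhdsWithin] with z hz hzΩ
    rwa [← h hzΩ]
  ne_top z hz := h hz ▸ hu.ne_top z hz
  not_identically_bot := by
    obtain ⟨z, hz, hne⟩ := hu.not_identically_bot
    exact ⟨z, hz, h hz ▸ hne⟩

theorem IsViscositySubsolution.congr (hΩ : IsOpen Ω) (h : EqOn u v Ω) {ψ : Cn n → ℝ → ℝ}
    (hu : IsViscositySubsolution Γ f Ω ψ u) : IsViscositySubsolution Γ f Ω ψ v := by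
  rintro z hz q ⟨hq1, hq2, hq3⟩
  refine hu z hz q ⟨hq1, (h hz).trans hq2, ?_⟩
  filter_upwards [hq3, hΩ.mem_nhds hz] with x hx hxΩ
  rwa [h hxΩ]

theorem IsGammaSubharmonic.congr (h : EqOn u v Ω) (hu : IsGammaSubharmonic Γ Ω u) :
    IsGammaSubharmonic Γ Ω v := by
  intro U hU hK hKΩ
  obtain ⟨w, hw1, hw2, hw3⟩ := hu U hU hK hKΩ
  exact ⟨w, hw1, hw2, fun z hz => h (hKΩ (subset_closure hz)) ▸ hw3 z hz⟩

theorem IsClassicalSubsolution.congr {U : Set (Cn n)} (hU : IsOpen U) {g w w' : Cn n → ℝ}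
    (h : EqOn w w' U) (hw : IsClassicalSubsolution Γ f U g w) :
    IsClassicalSubsolution Γ f U g w' := by
  refine ⟨hw.1.congr fun z hz => (h hz).symm, fun z hz => ?_⟩
  rw [← complexHessian_congr (h.eventuallyEq_of_mem (hU.mem_nhds hz))]
  exact hw.2 z hz

theorem mollify_toReal_eqOn (hχ : IsStandardMollifier χ) (h : EqOn u v Ω) {ε : ℝ} (hε : 0 < ε) :
    EqOn (mollify χ ε fun z => (u z).toReal) (mollify χ ε fun z => (v z).toReal) (shrink Ω ε) := by
  intro z hz
  refine conv_congr_of_eqOn (isAveragingKernel_mollifier hχ hε) fun t ht => ?_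
  simp only [h (closedBall_subset_of_mem_shrink hε.le hz ht)]

open Classical in
-- Semicontinuity controls `u` only on `Ω`; extension by `-∞` gives a Borel function on the whole
-- space.
theorem measurable_piecewise_bot (hΩ : IsOpen Ω) (hu : UpperSemicontinuousOn u Ω) :
    Measurable (Ω.piecewise u fun _ => ⊥) := by
  refine measurable_of_Iio fun a => ?_
  rw [piecewise_preimage]
  obtain ⟨V, hV, hVeq⟩ := upperSemicontinuousOn_iff_preimage_Iio.1 hu a
  rw [Set.ite, inter_comm, hVeq]
  exact (hΩ.inter hV).measurableSet.union
    ((measurable_const measurableSet_Iio).diff hΩ.measurableSet)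

theorem frontier_nonempty_of_isBounded (hn : 1 ≤ n) (hne : Ω.Nonempty)
    (hb : Bornology.IsBounded Ω) : (frontier Ω).Nonempty := by
  have : NeZero n := ⟨by omega⟩
  rw [nonempty_frontier_iff]
  refine ⟨hne, ?_⟩
  rintro rfl
  exact NormedSpace.unbounded_univ ℝ (Cn n) hb

end Restriction

end HessianViscosity

/-! ### The main theorem. -/

open HessianViscosity in
/-- The first two conjuncts say that the notions in the third are meaningful: the two usual
descriptions of `Γ`-subharmonic functions agree, and such functions are finite almost everywhere
and locally integrable, so that the convolutions `u ∗ χ_ε` make sense. -/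
theorem theorem1p1 {n : ℕ} (hn : 1 ≤ n)
    (Γ : Set (Fin n → ℝ)) (hΓ : IsAdmissibleCone Γ)
    (f : (Fin n → ℝ) → ℝ) (hf : IsAdmissibleFunction Γ f)
    (Ω : Set (Cn n)) (hΩ_open : IsOpen Ω) (hΩ_conn : IsConnected Ω)
    (hΩ_bdd : Bornology.IsBounded Ω)
    (ψ : Cn n → ℝ) (hψ_cont : ContinuousOn ψ (closure Ω)) (hψ_nonneg : ∀ z ∈ closure Ω, 0 ≤ ψ z)
    (χ : Cn n → ℝ) (hχ : IsStandardMollifier χ)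
    (u : Cn n → EReal) (hu : IsUSC Ω u) :
    (IsGammaSubharmonic Γ Ω u ↔ IsViscositySubsolution Γ f Ω (fun _ _ => 0) u) ∧
    (IsGammaSubharmonic Γ Ω u →
      (∀ᵐ z ∂(volume.restrict Ω), u z ≠ ⊥) ∧
      LocallyIntegrableOn (fun z => (u z).toReal) Ω volume) ∧
    (IsViscositySubsolution Γ f Ω (fun z _ => ψ z) u ↔
      IsGammaSubharmonic Γ Ω u ∧
      ∀ ε : ℝ, 0 < ε →
        IsClassicalSubsolution Γ f (shrink Ω ε) (mollify χ ε ψ)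
          (mollify χ ε (fun z => (u z).toReal))) := by
  classical
  -- The measure theory is carried out for the Borel function `v`, and the conclusions return to `u`
  -- because each depends only on values in `Ω`.
  set v : Cn n → EReal := Ω.piecewise u fun _ => ⊥ with hv
  have huv : EqOn u v Ω := fun z hz => (piecewise_eq_of_mem Ω _ _ hz).symm
  have hmeas : Measurable v := measurable_piecewise_bot hΩ_open hu.upperSemicontinuousOn
  have hvusc : IsUSC Ω v := hu.congr huv
  have hfr := frontier_nonempty_of_isBounded hn hΩ_conn.nonempty hΩ_bdd
  have hψΩ : ContinuousOn ψ Ω := hψ_cont.mono subset_closure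
  have ha : IsViscositySubsolution Γ f Ω (fun _ _ => 0) u → IsGammaSubharmonic Γ Ω u := fun h =>
    ((h.congr hΩ_open huv).isGammaSubharmonic hn hΓ hf hΩ_open hΩ_conn hvusc hmeas hχ).congr huv.symm
  refine ⟨⟨fun h => h.isViscositySubsolution hΓ hf hΩ_open, ha⟩, fun h => ?_,
    fun h => ⟨?_, fun ε hε => ?_⟩, fun h => ?_⟩
  · obtain ⟨h1, h2⟩ := ((h.isViscositySubsolution hΓ hf hΩ_open).congr hΩ_open
      huv).ae_ne_bot_and_locallyIntegrableOn (g := fun _ => 0) hn hΓ hΩ_open hΩ_conn hvusc hmeas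
    refine ⟨?_, ?_⟩
    · rw [ae_restrict_iff' hΩ_open.measurableSet]
      filter_upwards [h1] with z hz hzΩ
      rw [huv hzΩ]
      exact hz hzΩ
    · refine (locallyIntegrableOn_congr ?_).2 h2
      filter_upwards [ae_restrict_mem hΩ_open.measurableSet] with z hz
      rw [huv hz]
  · exact ha (h.zero fun z hz => hψ_nonneg z (subset_closure hz))
  · exact ((h.congr hΩ_open huv).isClassicalSubsolution hn hΓ hf hΩ_open hΩ_conn hvusc hmeas hχ hψΩ
      hε).congr (isOpen_shrink hΩ_open) (mollify_toReal_eqOn hχ huv.symm hε)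
  · refine (isViscositySubsolution_of_classical hn hΓ hf hΩ_open hΩ_conn hfr hvusc hmeas hχ hψΩ
      ((h.1.isViscositySubsolution hΓ hf hΩ_open).congr hΩ_open huv)
      fun ε hε => ?_).congr hΩ_open huv.symm
    exact (h.2 ε hε).congr (isOpen_shrink hΩ_open) (mollify_toReal_eqOn hχ huv hε)
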